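/- **Setting.** Let $C$ be a Riemann surface (Hausdorff, second countable) with a spin structure $T^*_{C,-}$, i.e. a holomorphic line bundle with an isomorphism $T^*_{C,-}\otimes T^*_{C,-}\cong\omega_C$. Choose holomorphic charts $x_\alpha:U_\alpha\to\mathbb C$ covering $C$, with transition functions $x_\beta=f_{\alpha\beta}(x_\alpha)$, and frames $\theta_\alpha$ of $T^*_{C,-}$ over $U_\alpha$ with $\theta_\alpha\otimes\theta_\alpha=dx_\alpha$ and $\theta_\beta=\zeta_{\alpha\beta}\theta_\alpha$, so that $\zeta_{\alpha\beta}^2=f_{\alpha\beta}'$. The super Riemann surface $S(C,T^*_{C,-})$ has the local coordinates $(x|\theta)$, the transition maps $\rho_{\alpha\beta}:\ y=f_{\alpha\beta}(x),\ \eta=\theta\,\zeta_{\alpha\beta}(x)$, and the superconformal structure generated by $D=D_{(x|\theta)}=\partial_\theta+\theta\,\partial_x$. Let $\mathbb A^{0|n}_{\mathbb C}=\mathrm{Spec}\,\mathbb C[\xi_1,\dots,\xi_n]$ with odd parameters $\xi_i$. A map $u$ over $\mathbb A^{0|n}_{\mathbb C}$ between domains of $\mathbb C^{1|1}$ is superconformal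 if $u_*D_{(x|\theta)}=h\,D_{(y|\eta)}$ with $h$ nowhere vanishing. A deformation $\mathcal X\to\mathbb A^{0|n}_{\mathbb C}$ of $S(C,T^*_{C,-})$ is given by holomorphic superconformal transition maps $\vartheta_{\alpha\beta}$ over $\mathbb A^{0|n}_{\mathbb C}$ that satisfy the cocycle conditions and reduce to $\rho_{\alpha\beta}$ modulo $(\xi_1,\dots,\xi_n)$. Smooth functions are functions of $(x,\widetilde x|\theta,\xi)$, where $\widetilde x$ is the complex conjugate of $x$ on the reduced space and odd variables are not conjugated; maps over $\mathbb A^{0|n}_{\mathbb C}$ pull back the conjugate coordinate to the conjugate of the reduced map. The Dolbeault operator in local coordinates is $\widetilde\partial=d\widetilde x\,\partial/\partial\widetilde x$. An identification of the smooth supermanifold $\mathcal X^\infty$ underlying $\mathcal X$ with $S(C,T^*_{\mathcal X,-})^\infty=S(C,T^*_{C,-})^\infty\times\mathbb A^{0|n}_{\mathbb C}$ is a diffeomorphism $\Phi:S(C,T^*_{C,-})^\infty\times\mathbb A^{0|n}_{\mathbb C}\to\mathcal X^\infty$ over $\mathbb A^{0|n}_{\mathbb C}$ which is the identity modulo $(\xi_1,\dots,\xi_n)$;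 in charts it is given by $x_\xi=u_\alpha^+(x,\widetilde x|\theta,\xi)$, $\theta_\xi=u_\alpha^-(x,\widetilde x|\theta,\xi)$, with $u_\beta\circ\rho_{\alpha\beta}=\vartheta_{\alpha\beta}\circ u_\alpha$. It is called superconformal if all $u_\alpha$ are superconformal. Write $\widetilde\partial_\xi=\Phi^*\circ\widetilde\partial_{\mathcal X}\circ(\Phi^*)^{-1}$ for the complex structure of $\mathcal X$ transported by $\Phi$. A smooth vector $(0,1)$-form $\varphi$ on $S(C,T^*_{C,-})^\infty\times\mathbb A^{0|n}_{\mathbb C}$ is locally of the form $d\widetilde x\,(a\,\partial_x+b\,\partial_\theta)$ with smooth functions $a,b$ of $(x,\widetilde x|\theta,\xi)$, the local expressions agreeing on overlaps; it is even if $a$ is even and $b$ is odd, and an even form is superconformal if locally $[\varphi,D_{(x|\theta)}]=c\,D_{(x|\theta)}$ for some smooth $c$ (a function times $d\widetilde x$). **Theorem.** Let $\mathcal X\to\mathbb A^{0|n}_{\mathbb C}$ be a deformation of $S(C,T^*_{C,-})$. Then there exists a superconformal identification $\Phi$ of $S(C,T^*_{C,-})^\infty\times\mathbb A^{0|n}_{\mathbb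 C}$ with $\mathcal X^\infty$. Moreover, for every identification $\Phi$ there exists a smooth, even vector $(0,1)$-form $\varphi(\xi)$ on $S(C,T^*_{C,-})^\infty\times\mathbb A^{0|n}_{\mathbb C}$ such that $$\varphi(\xi)\equiv0 \mod (\xi_1,\dots,\xi_n)\qquad\text{and}\qquad \widetilde\partial_\xi=\widetilde\partial-\varphi(\xi),$$ and $\varphi(\xi)$ is superconformal whenever $\Phi$ is superconformal. -/

import Mathlib

open scoped Manifold ContDiff

noncomputable section

/-! ## The Grassmann algebra -/

/-- The complex Grassmann algebra on `m` anticommuting generators `e_0, …, e_{m-1}`; an element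
`∑_I a_I e_I` (with `e_I` the product of the `e_i`, `i ∈ I`, in increasing order) is stored as the
family of its coefficients `a_I`. -/
def Grassmann (m : ℕ) : Type := Finset (Fin m) → ℂ

namespace Grassmann

variable {m : ℕ}

instance : NormedAddCommGroup (Grassmann m) :=
  inferInstanceAs (NormedAddCommGroup (Finset (Fin m) → ℂ))

instance : NormedSpace ℂ (Grassmann m) :=
  inferInstanceAs (NormedSpace ℂ (Finset (Fin m) → ℂ))

instance : NormedSpace ℝ (Grassmann m) :=
  inferInstanceAs (NormedSpace ℝ (Finset (Fin m) → ℂ))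

instance : IsScalarTower ℝ ℂ (Grassmann m) :=
  inferInstanceAs (IsScalarTower ℝ ℂ (Finset (Fin m) → ℂ))

@[ext] theorem ext {a b : Grassmann m} (h : ∀ I, a I = b I) : a = b := funext h

/-- The sign in `e_I * e_J = sgn I J • e_{I ∪ J}` for disjoint `I`, `J`: one factor `-1` for every
pair `(i, j) ∈ I × J` with `j < i`. -/
def sgn (I J : Finset (Fin m)) : ℂ := ∏ i ∈ I, ∏ j ∈ J, if j < i then -1 else 1

theorem sgn_union_left {I J K : Finset (Fin m)} (h : Disjoint I J) :
    sgn (I ∪ J) K = sgn I K * sgn J K := Finset.prod_union h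

theorem sgn_union_right {I J K : Finset (Fin m)} (h : Disjoint J K) :
    sgn I (J ∪ K) = sgn I J * sgn I K := by
  simp only [sgn, Finset.prod_union h, Finset.prod_mul_distrib]

instance : One (Grassmann m) := ⟨fun I => if I = ∅ then 1 else 0⟩

instance : Mul (Grassmann m) :=
  ⟨fun a b K => ∑ I ∈ K.powerset, sgn I (K \ I) * a I * b (K \ I)⟩

theorem one_apply (I : Finset (Fin m)) : (1 : Grassmann m) I = if I = ∅ then 1 else 0 := rfl

theorem mul_apply (a b : Grassmann m) (K : Finset (Fin m)) :
    (a * b) K = ∑ I ∈ K.powerset, sgn I (K \ I) * a I * b (K \ I) := rfl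

theorem add_apply (a b : Grassmann m) (K : Finset (Fin m)) : (a + b) K = a K + b K := rfl

theorem zero_apply (K : Finset (Fin m)) : (0 : Grassmann m) K = 0 := rfl

theorem smul_apply (c : ℂ) (a : Grassmann m) (K : Finset (Fin m)) : (c • a) K = c * a K := rfl

protected theorem one_mul (a : Grassmann m) : 1 * a = a := by
  ext K
  rw [mul_apply, Finset.sum_eq_single ∅]
  · simp [one_apply, sgn]
  · intro I _ hI
    simp [one_apply, hI]
  · simp

protected theorem mul_one (a : Grassmann m) : a * 1 = a := by
  ext K
  rw [mul_apply, Finset.sum_eq_single K]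
  · simp [one_apply, sgn]
  · intro I hI hne
    have : K \ I ≠ ∅ := by
      intro h
      exact hne (Finset.Subset.antisymm (Finset.mem_powerset.1 hI)
        (Finset.sdiff_eq_empty_iff_subset.1 h))
    simp [one_apply, this]
  · simp

protected theorem mul_assoc (a b c : Grassmann m) : a * b * c = a * (b * c) := by
  ext K
  simp only [mul_apply, Finset.mul_sum, Finset.sum_mul]
  rw [Finset.sum_sigma', Finset.sum_sigma']
  refine Finset.sum_bij' (fun p _ => ⟨p.2, p.1 \ p.2⟩) (fun p _ => ⟨p.1 ∪ p.2, p.1⟩) ?_ ?_ ?_ ?_ ?_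
  · rintro ⟨L, I⟩ h
    simp only [Finset.mem_sigma, Finset.mem_powerset] at h ⊢
    exact ⟨h.2.trans h.1, Finset.sdiff_subset_sdiff h.1 le_rfl⟩
  · rintro ⟨I, J⟩ h
    simp only [Finset.mem_sigma, Finset.mem_powerset] at h ⊢
    exact ⟨Finset.union_subset h.1 (h.2.trans Finset.sdiff_subset), Finset.subset_union_left⟩
  · rintro ⟨L, I⟩ h
    simp only [Finset.mem_sigma, Finset.mem_powerset] at h
    simp [Finset.union_sdiff_of_subset h.2]
  · rintro ⟨I, J⟩ h
    simp only [Finset.mem_sigma, Finset.mem_powerset] at h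
    have hd : Disjoint I J := (Finset.disjoint_sdiff).mono_right h.2
    simp [Finset.union_sdiff_cancel_left hd]
  · rintro ⟨L, I⟩ h
    simp only [Finset.mem_sigma, Finset.mem_powerset] at h
    obtain ⟨hL, hI⟩ := h
    dsimp only
    have e1 : (K \ I) \ (L \ I) = K \ L := by
      ext x
      simp only [Finset.mem_sdiff]
      constructor
      · rintro ⟨⟨h1, h2⟩, h3⟩
        exact ⟨h1, fun hx => h3 ⟨hx, h2⟩⟩
      · rintro ⟨h1, h2⟩
        exact ⟨⟨h1, fun hx => h2 (hI hx)⟩, fun hx => h2 hx.1⟩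
    have e2 : K \ I = (L \ I) ∪ (K \ L) := by
      ext x
      simp only [Finset.mem_sdiff, Finset.mem_union]
      constructor
      · rintro ⟨h1, h2⟩
        by_cases hx : x ∈ L
        · exact Or.inl ⟨hx, h2⟩
        · exact Or.inr ⟨h1, hx⟩
      · rintro (⟨h1, h2⟩ | ⟨h1, h2⟩)
        · exact ⟨hL h1, h2⟩
        · exact ⟨h1, fun hx => h2 (hI hx)⟩
    have d1 : Disjoint (L \ I) (K \ L) :=
      (Finset.disjoint_sdiff).mono_left Finset.sdiff_subset
    have s1 : sgn L (K \ L) = sgn I (K \ L) * sgn (L \ I) (K \ L) := by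
      rw [← sgn_union_left Finset.disjoint_sdiff, Finset.union_sdiff_of_subset hI]
    have s2 : sgn I (K \ I) = sgn I (L \ I) * sgn I (K \ L) := by
      rw [e2, sgn_union_right d1]
    rw [e1, s1, s2]
    ring

instance : Ring (Grassmann m) :=
  { (inferInstance : AddCommGroup (Grassmann m)) with
    mul_assoc := Grassmann.mul_assoc
    one_mul := Grassmann.one_mul
    mul_one := Grassmann.mul_one
    zero_mul := fun a => by ext K; simp [mul_apply, zero_apply]
    mul_zero := fun a => by ext K; simp [mul_apply, zero_apply]
    left_distrib := fun a b c => by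
      ext K; simp only [mul_apply, add_apply, mul_add, Finset.sum_add_distrib]
    right_distrib := fun a b c => by
      ext K; simp only [mul_apply, add_apply, mul_add, add_mul, Finset.sum_add_distrib] }

instance : Algebra ℂ (Grassmann m) :=
  Algebra.ofModule
    (fun c a b => by
      ext K
      simp only [mul_apply, smul_apply, Finset.mul_sum]
      exact Finset.sum_congr rfl fun I _ => by ring)
    (fun c a b => by
      ext K
      simp only [mul_apply, smul_apply, Finset.mul_sum]
      exact Finset.sum_congr rfl fun I _ => by ring)

/-- The generator `e_i`. -/
def gen (i : Fin m) : Grassmann m := fun I => if I = {i} then 1 else 0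

/-- The body (degree zero part) of an element. -/
def body (a : Grassmann m) : ℂ := a ∅

/-- Even elements: only products of an even number of generators occur. -/
def IsEven (a : Grassmann m) : Prop := ∀ I, Odd I.card → a I = 0

/-- Odd elements: only products of an odd number of generators occur. -/
def IsOdd (a : Grassmann m) : Prop := ∀ I, Even I.card → a I = 0

end Grassmann

/-! ## Superfunctions on domains of `ℂ^{1|1} × 𝔸^{0|n}`

The coordinates are `(x, x̃ | θ, ξ_1, …, ξ_n)`. The Grassmann algebra has `n + 1` generators; the
generator `0` is `θ` and the generator `i + 1` is the `i`-th parameter `ξ`. Odd variables are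
not conjugated. A superfunction is a function of `x ∈ ℂ` with values in the Grassmann algebra,
considered on some open set. -/

/-- Superfunctions of `(x, x̃ | θ, ξ_1, …, ξ_n)`. -/
abbrev SuperFun (n : ℕ) : Type := ℂ → Grassmann (n + 1)

namespace SuperFun

variable {n : ℕ}

/-- The odd coordinate `θ`. -/
def theta (n : ℕ) : Grassmann (n + 1) := Grassmann.gen 0

/-- The parameter `ξ_i`. -/
def xi {n : ℕ} (i : Fin n) : Grassmann (n + 1) := Grassmann.gen i.succ

/-- Congruence modulo the (two-sided) ideal generated by `ξ_1, …, ξ_n`. -/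
def ModXi (a b : Grassmann (n + 1)) : Prop := a - b ∈ TwoSidedIdeal.span (Set.range (xi (n := n)))

/-- Smooth superfunctions on a set. -/
def SmoothOn (F : SuperFun n) (U : Set ℂ) : Prop := ContDiffOn ℝ ∞ F U

/-- `∂F/∂x`. -/
def dx (F : SuperFun n) : SuperFun n := fun z =>
  (1 / 2 : ℂ) • (fderiv ℝ F z 1 - Complex.I • fderiv ℝ F z Complex.I)

/-- `∂F/∂x̃`. -/
def dxt (F : SuperFun n) : SuperFun n := fun z =>
  (1 / 2 : ℂ) • (fderiv ℝ F z 1 + Complex.I • fderiv ℝ F z Complex.I)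

/-- The part `A` in the decomposition `F = A + θ B` with `A`, `B` free of `θ`. -/
def thetaFree (F : SuperFun n) : SuperFun n := fun z I => if 0 ∈ I then 0 else F z I

/-- The odd (left) derivation `∂F/∂θ`: the part `B` in the decomposition `F = A + θ B` with `A`,
`B` free of `θ`. -/
def dtheta (F : SuperFun n) : SuperFun n := fun z I => if 0 ∈ I then 0 else F z (insert 0 I)

/-- The superconformal generator `D = ∂/∂θ + θ ∂/∂x`. -/
def D (F : SuperFun n) : SuperFun n := fun z => dtheta F z + theta n * dx F z

end SuperFun

open SuperFun

/-! ## Maps between superdomains -/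

/-- The data of a map over `𝔸^{0|n}` of superdomains, `y = even (x, x̃ | θ, ξ)`,
`η = odd (x, x̃ | θ, ξ)` (and `ξ_i ↦ ξ_i`). The conjugate coordinate `ỹ` is pulled back to the
complex conjugate of the body of `y`. -/
structure SuperMap (n : ℕ) where
  even : SuperFun n
  odd : SuperFun n

namespace SuperMap

variable {n : ℕ}

/-- The map of reduced spaces. -/
def base (u : SuperMap n) : ℂ → ℂ := fun x => (u.even x).body

/-- The pullback `u^* F` of a superfunction `F = A + θ B`. It is obtained by the substitution
`y = y₀ + N`, `η = odd`, where `y₀` is the body of `y` and `N` is nilpotent, and by Taylor's formula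
in the variable `y` (which is a finite sum, because `N ^ (n + 2) = 0`). -/
def pull (u : SuperMap n) (F : SuperFun n) : SuperFun n := fun x =>
  ∑ k ∈ Finset.range (n + 2), ((k.factorial : ℂ)⁻¹) •
    ((u.even x - algebraMap ℂ (Grassmann (n + 1)) (u.base x)) ^ k *
      ((dx^[k] (thetaFree F)) (u.base x) + u.odd x * (dx^[k] (dtheta F)) (u.base x)))

/-- `u` is a smooth map from the superdomain over `U` to the superdomain over `V`. -/
structure IsSmooth (u : SuperMap n) (U V : Set ℂ) : Prop where
  smooth_even : SmoothOn u.even U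
  smooth_odd : SmoothOn u.odd U
  isEven : ∀ x ∈ U, (u.even x).IsEven
  isOdd : ∀ x ∈ U, (u.odd x).IsOdd
  mapsTo : Set.MapsTo u.base U V

/-- `u` is a holomorphic map from the superdomain over `U` to the superdomain over `V`. -/
structure IsHolomorphic (u : SuperMap n) (U V : Set ℂ) : Prop extends u.IsSmooth U V where
  holomorphic_even : DifferentiableOn ℂ u.even U
  holomorphic_odd : DifferentiableOn ℂ u.odd U

/-- `u` is superconformal: `u_* D = h D` with a smooth nowhere vanishing function `h`, that is
`D (u^* F) = h u^* (D F)` for every function `F` on the target. -/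
def IsSuperconformal (u : SuperMap n) (U V : Set ℂ) : Prop :=
  ∃ h : SuperFun n, SmoothOn h U ∧ (∀ x ∈ U, (h x).body ≠ 0) ∧
    ∀ F : SuperFun n, SmoothOn F V → Set.EqOn (D (u.pull F)) (fun x => h x * u.pull (D F) x) U

/-- `u` and `v` restrict to the same map on the central fibre `ξ = 0`, over `U`. -/
def EqModXi (u v : SuperMap n) (U : Set ℂ) : Prop :=
  ∀ x ∈ U, ModXi (u.even x) (v.even x) ∧ ModXi (u.odd x) (v.odd x)

/-- `w = v ∘ u` over `U`. -/
def IsComp (w v u : SuperMap n) (U : Set ℂ) : Prop :=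
  Set.EqOn w.even (u.pull v.even) U ∧ Set.EqOn w.odd (u.pull v.odd) U

/-- The identity map, `y = x`, `η = θ`. -/
def ident (n : ℕ) : SuperMap n where
  even := fun x => algebraMap ℂ _ x
  odd := fun _ => theta n

end SuperMap

/-! ## Super Riemann surfaces and their deformations -/

/-- A Riemann surface `C` with a spin structure `T^*_{C,-}`, presented by an atlas. The holomorphic
charts `x_α = chart α` cover `C`; the line bundle `T^*_{C,-}` has a frame `θ_α` over the domain of
the chart `α`, with `θ_α ⊗ θ_α` corresponding to `d x_α` under the isomorphism of
`T^*_{C,-} ⊗ T^*_{C,-}` with the canonical bundle, and `θ_β = zeta α β · θ_α` on overlaps, where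
`zeta α β` is written in the coordinate `x_α`. Equivalently, this is a superconformal atlas of the
super Riemann surface `S(C, T^*_{C,-})`, with transition functions
`x_β = f_{αβ}(x_α)`, `θ_β = θ_α ζ_{αβ}(x_α)`. -/
structure SuperRiemannSurface (ι : Type*) (C : Type*) [TopologicalSpace C] [ChartedSpace ℂ C] where
  chart : ι → OpenPartialHomeomorph C ℂ
  chart_mem : ∀ α, chart α ∈ IsManifold.maximalAtlas 𝓘(ℂ) ω C
  cover : ∀ p : C, ∃ α, p ∈ (chart α).source
  zeta : ι → ι → ℂ → ℂ
  zeta_holomorphic : ∀ α β, DifferentiableOn ℂ (zeta α β) ((chart α).symm.trans (chart β)).source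
  zeta_sq : ∀ α β, ∀ x ∈ ((chart α).symm.trans (chart β)).source,
    zeta α β x ^ 2 = deriv ((chart α).symm.trans (chart β)) x
  zeta_cocycle : ∀ α β γ, ∀ x ∈ ((chart α).symm.trans (chart β)).source ∩
      ((chart α).symm.trans (chart γ)).source,
    zeta α γ x = zeta β γ ((chart α).symm.trans (chart β) x) * zeta α β x

namespace SuperRiemannSurface

variable {ι C : Type*} [TopologicalSpace C] [ChartedSpace ℂ C]

/-- The image of the chart `α`. -/
def dom (S : SuperRiemannSurface ι C) (α : ι) : Set ℂ := (S.chart α).target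

/-- The image in the chart `α` of the intersection of the domains of the charts `α` and `β`. -/
def overlap (S : SuperRiemannSurface ι C) (α β : ι) : Set ℂ :=
  ((S.chart α).symm.trans (S.chart β)).source

/-- The transition function `f_{αβ}` of `C`. -/
def trans (S : SuperRiemannSurface ι C) (α β : ι) : ℂ → ℂ :=
  (S.chart α).symm.trans (S.chart β)

/-- The transition map `y = f_{αβ}(x)`, `η = θ ζ_{αβ}(x)` of the product
`S(C, T^*_{C,-}) × 𝔸^{0|n}`. -/
def rho (S : SuperRiemannSurface ι C) (n : ℕ) (α β : ι) : SuperMap n where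
  even := fun x => algebraMap ℂ _ (S.trans α β x)
  odd := fun x => S.zeta α β x • theta n

end SuperRiemannSurface

/-- A deformation `𝒳 → 𝔸^{0|n}` of a super Riemann surface, given by its atlas: for every pair of
charts a holomorphic superconformal transition map `ϑ_{αβ}` over `𝔸^{0|n}` which restricts on the
central fibre to the transition map of the given super Riemann surface; these maps satisfy the
cocycle conditions. -/
structure Deformation {ι C : Type*} [TopologicalSpace C] [ChartedSpace ℂ C]
    (S : SuperRiemannSurface ι C) (n : ℕ) where
  transition : ι → ι → SuperMap n
  holomorphic : ∀ α β, (transition α β).IsHolomorphic (S.overlap α β) (S.overlap β α)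
  superconformal : ∀ α β, (transition α β).IsSuperconformal (S.overlap α β) (S.overlap β α)
  central : ∀ α β, (transition α β).EqModXi (S.rho n α β) (S.overlap α β)
  inverse : ∀ α β, (SuperMap.ident n).IsComp (transition β α) (transition α β) (S.overlap α β)
  cocycle : ∀ α β γ, (transition α γ).IsComp (transition β γ) (transition α β)
    (S.overlap α β ∩ S.overlap α γ)

/-- A diffeomorphism, over `𝔸^{0|n}`, of `S(C, T^*_{C,-})^∞ × 𝔸^{0|n}` with the smooth
supermanifold `𝒳^∞` underlying the deformation `𝒳`, which is the identity on the central fibre. In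
the charts `α` it is given by `x_ξ = u_α^+(x, x̃ | θ, ξ)`, `θ_ξ = u_α^-(x, x̃ | θ, ξ)`, and on
overlaps `u_β ∘ ρ_{αβ} = ϑ_{αβ} ∘ u_α`. (Such a map is invertible since it is the identity modulo
the nilpotent ideal `(ξ_1, …, ξ_n)`.) -/
structure SmoothIdentification {ι C : Type*} [TopologicalSpace C] [ChartedSpace ℂ C]
    {S : SuperRiemannSurface ι C} {n : ℕ} (X : Deformation S n) where
  map : ι → SuperMap n
  smooth : ∀ α, (map α).IsSmooth (S.dom α) (S.dom α)
  central : ∀ α, (map α).EqModXi (SuperMap.ident n) (S.dom α)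
  glue_even : ∀ α β, Set.EqOn ((S.rho n α β).pull (map β).even)
    ((map α).pull (X.transition α β).even) (S.overlap α β)
  glue_odd : ∀ α β, Set.EqOn ((S.rho n α β).pull (map β).odd)
    ((map α).pull (X.transition α β).odd) (S.overlap α β)

namespace SmoothIdentification

variable {ι C : Type*} [TopologicalSpace C] [ChartedSpace ℂ C]
  {S : SuperRiemannSurface ι C} {n : ℕ} {X : Deformation S n}

/-- The diffeomorphism respects the (relative) superconformal structures: in the charts,
`(u_α)_* D_{(x|θ)} = h D_{(x_ξ|θ_ξ)}` with `h` nowhere vanishing. -/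
def IsSuperconformal (Φ : SmoothIdentification X) : Prop :=
  ∀ α, (Φ.map α).IsSuperconformal (S.dom α) (S.dom α)

/-- The complex structure `∂̃_ξ` of `𝒳`, transported along the diffeomorphism `Φ` to
`S(C, T^*_{C,-})^∞ × 𝔸^{0|n}`, is `d x̃ ⊗ P α` in the charts `α`: on functions over open subsets
one has `P ∘ Φ^* = Φ^* ∘ ∂/∂x̃_ξ`, where `d x̃_ξ ∂/∂x̃_ξ` is the Dolbeault operator of `𝒳^∞`. -/
def IsComplexStructure (Φ : SmoothIdentification X) (P : ι → SuperFun n → SuperFun n) : Prop :=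
  ∀ α, ∀ V : Set ℂ, IsOpen V → V ⊆ S.dom α → ∀ F : SuperFun n, SmoothOn F V →
    Set.EqOn (P α ((Φ.map α).pull F)) ((Φ.map α).pull (dxt F)) V

end SmoothIdentification

/-! ## Vector `(0,1)`-forms -/

/-- A smooth vector `(0,1)`-form on `S(C, T^*_{C,-})^∞ × 𝔸^{0|n}`, relative to `𝔸^{0|n}`. In the
chart `α` it is `d x̃ ⊗ (a_α ∂/∂x + b_α ∂/∂θ)`; on overlaps the local expressions are
related by the transition map `ρ_{αβ}`, with `d x̃_β = conj (f_{αβ}') d x̃_α`. -/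
structure VectorForm {ι C : Type*} [TopologicalSpace C] [ChartedSpace ℂ C]
    (S : SuperRiemannSurface ι C) (n : ℕ) where
  a : ι → SuperFun n
  b : ι → SuperFun n
  smooth_a : ∀ α, SmoothOn (a α) (S.dom α)
  smooth_b : ∀ α, SmoothOn (b α) (S.dom α)
  glue : ∀ α β, ∀ F : SuperFun n, SmoothOn F (S.overlap β α) → ∀ x ∈ S.overlap α β,
    a α x * dx ((S.rho n α β).pull F) x + b α x * dtheta ((S.rho n α β).pull F) x =
      (starRingEnd ℂ) (deriv (S.trans α β) x) •
        (S.rho n α β).pull (fun y => a β y * dx F y + b β y * dtheta F y) x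

namespace VectorForm

variable {ι C : Type*} [TopologicalSpace C] [ChartedSpace ℂ C]
  {S : SuperRiemannSurface ι C} {n : ℕ}

/-- The coefficient of `d x̃` of the form, acting as a vector field on the functions in the
chart `α`. -/
def act (φ : VectorForm S n) (α : ι) (F : SuperFun n) : SuperFun n := fun x =>
  φ.a α x * dx F x + φ.b α x * dtheta F x

/-- The form is even (`∂/∂x` and `d x̃` are even, `∂/∂θ` is odd). -/
def IsEven (φ : VectorForm S n) : Prop :=
  ∀ α, ∀ x ∈ S.dom α, (φ.a α x).IsEven ∧ (φ.b α x).IsOdd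

/-- The form vanishes modulo the ideal `(ξ_1, …, ξ_n)`. -/
def VanishesModXi (φ : VectorForm S n) : Prop :=
  ∀ α, ∀ x ∈ S.dom α, ModXi (φ.a α x) 0 ∧ ModXi (φ.b α x) 0

/-- An even form is superconformal if `[φ, D] = c D` in the charts, for smooth `c` (multiplied
by `d x̃`). -/
def IsSuperconformal (φ : VectorForm S n) : Prop :=
  ∀ α, ∃ c : SuperFun n, SmoothOn c (S.dom α) ∧
    ∀ F : SuperFun n, SmoothOn F (S.dom α) → ∀ x ∈ S.dom α,
      φ.act α (D F) x - D (φ.act α F) x = c x * D F x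

end VectorForm

/-- The operator `∂̃ - φ` on `S(C, T^*_{C,-})^∞ × 𝔸^{0|n}` (the coefficient of `d x̃` in the
chart `α`). -/
def perturbedDolbeault {ι C : Type*} [TopologicalSpace C] [ChartedSpace ℂ C]
    {S : SuperRiemannSurface ι C} {n : ℕ} (φ : VectorForm S n) (α : ι) (F : SuperFun n) :
    SuperFun n := fun x => dxt F x - φ.act α F x

end

/-! Existence of a superconformal identification. Write a map of superdomains as `x_ξ = g + θ μ`,
`θ_ξ = ψ + θ λ` with `g, μ, ψ, λ` free of `θ`. Being superconformal amounts to `D x_ξ = (D θ_ξ) θ_ξ`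
(with `λ` invertible), that is, to `μ = λ ψ` and `λ² = ∂g - (∂ψ) ψ`. An even element with nonzero
body is determined by its square and its body. So a superconformal map is fixed by its restriction
`(g, ψ)` to `θ = 0` and the body of `λ` (`eqOn_of_thetaFree_eq`), and every smooth section `(g, ψ)`
lifting the points of a chart extends to such a map (`ofSection`, `D_ofSection`).

It remains to find smooth sections `s_α` of points with Grassmann coordinates that satisfy `s_β =
ϑ_{αβ}(s_α)`. In the smooth category nothing obstructs this. The sections `(x, 0)` agree up to terms
of degree 1. Given sections agreeing up to degree `k`, transport all of them to the chart `α` and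
average them with a partition of unity. The maps `ϑ_{αβ}` act affinely on points that agree up to
degree `k`, with an error of degree `k + 1` (`ev_affine`), so the averages agree up to degree `k +
1` (`IsCompatible.exists_succ`). The algebra is nilpotent, so finitely many steps give exact
agreement.

The form. A vector field is determined by its values on two coordinate functions whose superjacobian
is invertible. Hence `φ = a ∂_x + b ∂_θ` is defined by `φ(u^±) = ∂u^±/∂x̃`, a two by two system
whose matrix has body the identity. The chain rule gives `(∂/∂x̃ - φ) u^* = u^* ∂/∂x̃`
(`EqModXi.dxt_pull_sub`). The local forms glue because `ϑ_{αβ}` is holomorphic: both candidates on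
an overlap agree on the functions `ρ^* u_β^±`. For superconformal `u`, the field `[φ, D] - c D`
kills `u^±` for a suitable `c`, hence vanishes (`EqModXi.exists_bracket_beltrami`).

The groundwork consists of the chain rule for Taylor evaluation (`exists_hasFDerivAt_ev`), its
multiplicativity (`ev_mul_of_parity`) and its compatibility with composition
(`IsHolomorphic.ev_pull`). -/

noncomputable section

/-! ### Algebra of Grassmann numbers: signs, parity, degree filtration, inverses and square roots.
-/

namespace Grassmann

variable {m : ℕ}

theorem neg_apply (a : Grassmann m) (K : Finset (Fin m)) : (-a) K = -a K := rfl

theorem sub_apply (a b : Grassmann m) (K : Finset (Fin m)) : (a - b) K = a K - b K := rfl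

theorem real_smul_apply (c : ℝ) (a : Grassmann m) (K : Finset (Fin m)) :
    (c • a) K = (c : ℂ) * a K :=
  Complex.real_smul

theorem real_smul_eq (c : ℝ) (a : Grassmann m) : c • a = (c : ℂ) • a := by
  ext K; rw [real_smul_apply, smul_apply]

theorem sum_apply {κ : Type*} (s : Finset κ) (f : κ → Grassmann m) (K : Finset (Fin m)) :
    (∑ i ∈ s, f i) K = ∑ i ∈ s, f i K :=
  Finset.sum_apply K s f

theorem algebraMap_apply' (c : ℂ) (K : Finset (Fin m)) :
    (algebraMap ℂ (Grassmann m) c) K = if K = ∅ then c else 0 := by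
  rw [Algebra.algebraMap_eq_smul_one, smul_apply, one_apply]; split_ifs <;> simp

/-! ### Supercommutativity -/

theorem sgn_mul_self (I J : Finset (Fin m)) : sgn I J * sgn I J = 1 := by
  simp only [sgn, ← Finset.prod_mul_distrib]
  refine Finset.prod_eq_one fun i _ => Finset.prod_eq_one fun j _ => ?_
  split_ifs <;> norm_num

/-- For disjoint sets each pair `(i, j)` is inverted in exactly one of the two orders, so every pair
contributes one factor `-1`. -/
theorem sgn_mul_sgn_swap {I J : Finset (Fin m)} (h : Disjoint I J) :
    sgn I J * sgn J I = (-1) ^ (I.card * J.card) := by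
  have e : sgn J I = ∏ i ∈ I, ∏ j ∈ J, if i < j then (-1 : ℂ) else 1 := by
    rw [sgn, Finset.prod_comm]
  rw [e, sgn]
  simp only [← Finset.prod_mul_distrib]
  rw [Finset.prod_congr rfl (g := fun _ => (-1 : ℂ) ^ J.card)]
  · rw [Finset.prod_const, ← pow_mul, mul_comm]
  · intro i hi
    rw [← Finset.prod_const]
    refine Finset.prod_congr rfl fun j hj => ?_
    have hne : i ≠ j := fun hij => Finset.disjoint_left.1 h hi (hij ▸ hj)
    rcases lt_or_gt_of_ne hne with hl | hl
    · simp [hl, not_lt_of_gt hl]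
    · simp [hl, not_lt_of_gt hl]

theorem sgn_swap {I J : Finset (Fin m)} (h : Disjoint I J) :
    sgn J I = (-1) ^ (I.card * J.card) * sgn I J := by
  rw [← sgn_mul_sgn_swap h, mul_right_comm, sgn_mul_self, one_mul]

/-- Reindexing by complements in `K` lines up the terms of `b * a` with those of `a * b`;
supercommutativity is then read off term by term. -/
theorem mul_apply_swap (a b : Grassmann m) (K : Finset (Fin m)) :
    (b * a) K = ∑ I ∈ K.powerset,
      (-1) ^ (I.card * (K \ I).card) * (sgn I (K \ I) * a I * b (K \ I)) := by
  rw [mul_apply]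
  refine Finset.sum_bij' (fun I _ => K \ I) (fun I _ => K \ I) ?_ ?_ ?_ ?_ ?_
  · intro I _; simp
  · intro I _; simp
  · intro I hI; exact Finset.sdiff_sdiff_eq_self (Finset.mem_powerset.1 hI)
  · intro I hI; exact Finset.sdiff_sdiff_eq_self (Finset.mem_powerset.1 hI)
  · intro I hI
    rw [Finset.sdiff_sdiff_eq_self (Finset.mem_powerset.1 hI), sgn_swap Finset.sdiff_disjoint]
    ring

theorem IsEven.mul_comm {a : Grassmann m} (ha : a.IsEven) (b : Grassmann m) : a * b = b * a := by
  ext K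
  rw [mul_apply_swap a b, mul_apply]
  refine Finset.sum_congr rfl fun I _ => ?_
  rcases Nat.even_or_odd I.card with h | h
  · rw [(h.mul_right _).neg_one_pow, _root_.one_mul]
  · rw [ha I h]; ring

theorem IsOdd.mul_eq_neg {a b : Grassmann m} (ha : a.IsOdd) (hb : b.IsOdd) :
    a * b = -(b * a) := by
  ext K
  rw [neg_apply, mul_apply_swap a b, mul_apply, ← Finset.sum_neg_distrib]
  refine Finset.sum_congr rfl fun I _ => ?_
  rcases Nat.even_or_odd I.card with h | h
  · rw [ha I h]; ring
  rcases Nat.even_or_odd (K \ I).card with h' | h'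
  · rw [hb _ h']; ring
  · rw [(h.mul h').neg_one_pow]; ring

theorem IsOdd.mul_self {a : Grassmann m} (ha : a.IsOdd) : a * a = 0 := by
  have h := ha.mul_eq_neg ha
  have h2 : (2 : ℂ) • (a * a) = 0 := by
    rw [two_smul]; nth_rewrite 1 [h]; simp
  exact (smul_eq_zero.1 h2).resolve_left two_ne_zero

/-! ### Parity -/

theorem isEven_algebraMap (c : ℂ) : (algebraMap ℂ (Grassmann m) c).IsEven := fun I hI => by
  rw [algebraMap_apply', if_neg]; rintro rfl; simp at hI

theorem isEven_one : (1 : Grassmann m).IsEven := by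
  simpa using isEven_algebraMap (m := m) 1

theorem isOdd_zero : (0 : Grassmann m).IsOdd := fun _ _ => rfl

theorem IsEven.add {a b : Grassmann m} (ha : a.IsEven) (hb : b.IsEven) : (a + b).IsEven :=
  fun I hI => by rw [add_apply, ha I hI, hb I hI, add_zero]

theorem IsOdd.add {a b : Grassmann m} (ha : a.IsOdd) (hb : b.IsOdd) : (a + b).IsOdd :=
  fun I hI => by rw [add_apply, ha I hI, hb I hI, add_zero]

theorem IsEven.sub {a b : Grassmann m} (ha : a.IsEven) (hb : b.IsEven) : (a - b).IsEven :=
  fun I hI => by rw [sub_apply, ha I hI, hb I hI, sub_zero]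

theorem IsOdd.sub {a b : Grassmann m} (ha : a.IsOdd) (hb : b.IsOdd) : (a - b).IsOdd :=
  fun I hI => by rw [sub_apply, ha I hI, hb I hI, sub_zero]

theorem IsEven.smul {a : Grassmann m} (c : ℂ) (ha : a.IsEven) : (c • a).IsEven :=
  fun I hI => by rw [smul_apply, ha I hI, mul_zero]

theorem IsOdd.smul {a : Grassmann m} (c : ℂ) (ha : a.IsOdd) : (c • a).IsOdd :=
  fun I hI => by rw [smul_apply, ha I hI, mul_zero]

theorem IsEven.sum {κ : Type*} {s : Finset κ} {f : κ → Grassmann m}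
    (h : ∀ i ∈ s, (f i).IsEven) : (∑ i ∈ s, f i).IsEven :=
  fun I hI => by rw [sum_apply]; exact Finset.sum_eq_zero fun i hi => h i hi I hI

theorem IsOdd.sum {κ : Type*} {s : Finset κ} {f : κ → Grassmann m}
    (h : ∀ i ∈ s, (f i).IsOdd) : (∑ i ∈ s, f i).IsOdd :=
  fun I hI => by rw [sum_apply]; exact Finset.sum_eq_zero fun i hi => h i hi I hI

theorem card_sdiff_add_card_of_mem_powerset {I K : Finset (Fin m)} (h : I ∈ K.powerset) :
    (K \ I).card + I.card = K.card :=
  Finset.card_sdiff_add_card_eq_card (Finset.mem_powerset.1 h)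

theorem IsEven.mul {a b : Grassmann m} (ha : a.IsEven) (hb : b.IsEven) : (a * b).IsEven := by
  intro K hK
  rw [mul_apply]
  refine Finset.sum_eq_zero fun I hI => ?_
  have hc := card_sdiff_add_card_of_mem_powerset hI
  rcases Nat.even_or_odd I.card with h | h
  · rw [hb (K \ I) (by rw [← hc] at hK; grind), mul_zero]
  · simp [ha I h]

theorem IsOdd.mul {a b : Grassmann m} (ha : a.IsOdd) (hb : b.IsOdd) : (a * b).IsEven := by
  intro K hK
  rw [mul_apply]
  refine Finset.sum_eq_zero fun I hI => ?_
  have hc := card_sdiff_add_card_of_mem_powerset hI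
  rcases Nat.even_or_odd I.card with h | h
  · simp [ha I h]
  · rw [hb (K \ I) (by rw [← hc] at hK; grind), mul_zero]

theorem IsEven.mul_isOdd {a b : Grassmann m} (ha : a.IsEven) (hb : b.IsOdd) :
    (a * b).IsOdd := by
  intro K hK
  rw [mul_apply]
  refine Finset.sum_eq_zero fun I hI => ?_
  have hc := card_sdiff_add_card_of_mem_powerset hI
  rcases Nat.even_or_odd I.card with h | h
  · rw [hb (K \ I) (by rw [← hc] at hK; grind), mul_zero]
  · simp [ha I h]

theorem IsOdd.mul_isEven {a b : Grassmann m} (ha : a.IsOdd) (hb : b.IsEven) :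
    (a * b).IsOdd := by
  rw [← hb.mul_comm]; exact hb.mul_isOdd ha

theorem IsEven.pow {a : Grassmann m} (ha : a.IsEven) (k : ℕ) : (a ^ k).IsEven := by
  induction k with
  | zero => simpa using isEven_one
  | succ k ih => rw [pow_succ]; exact ih.mul ha

/-! ### The filtration by degree -/

/-- The elements all of whose terms are products of at least `j` generators. -/
def fil (m j : ℕ) : Submodule ℂ (Grassmann m) where
  carrier := {a | ∀ I, I.card < j → a I = 0}
  add_mem' ha hb I hI := by rw [add_apply, ha I hI, hb I hI, add_zero]
  zero_mem' _ _ := rfl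
  smul_mem' c a ha I hI := by rw [smul_apply, ha I hI, mul_zero]

theorem fil_anti {i j : ℕ} (h : i ≤ j) : fil m j ≤ fil m i :=
  fun _ ha I hI => ha I (hI.trans_le h)

theorem mem_fil_zero (a : Grassmann m) : a ∈ fil m 0 := fun _ hI => absurd hI (Nat.not_lt_zero _)

theorem mem_fil_one {a : Grassmann m} : a ∈ fil m 1 ↔ a.body = 0 := by
  refine ⟨fun h => h ∅ (by simp), fun h I hI => ?_⟩
  have : I = ∅ := Finset.card_eq_zero.1 (by omega)
  rw [this]; exact h

theorem mul_mem_fil {i j : ℕ} {a b : Grassmann m} (ha : a ∈ fil m i) (hb : b ∈ fil m j) :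
    a * b ∈ fil m (i + j) := by
  intro K hK
  rw [mul_apply]
  refine Finset.sum_eq_zero fun I hI => ?_
  have hc := card_sdiff_add_card_of_mem_powerset hI
  rcases lt_or_ge I.card i with h | h
  · rw [ha I h, mul_zero, zero_mul]
  · rw [hb (K \ I) (by omega), mul_zero]

theorem mul_mem_fil_left {i : ℕ} {a : Grassmann m} (b : Grassmann m) (ha : a ∈ fil m i) :
    a * b ∈ fil m i := mul_mem_fil ha (mem_fil_zero b)

theorem mul_mem_fil_right {i : ℕ} {a : Grassmann m} (b : Grassmann m) (ha : a ∈ fil m i) :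
    b * a ∈ fil m i := by simpa using mul_mem_fil (mem_fil_zero b) ha

theorem pow_mem_fil {i : ℕ} {a : Grassmann m} (ha : a ∈ fil m i) (k : ℕ) :
    a ^ k ∈ fil m (k * i) := by
  induction k with
  | zero => rw [Nat.zero_mul]; exact mem_fil_zero _
  | succ k ih => rw [pow_succ, Nat.succ_mul]; exact mul_mem_fil ih ha

theorem eq_zero_of_mem_fil {j : ℕ} (hj : m < j) {a : Grassmann m} (ha : a ∈ fil m j) : a = 0 := by
  ext I
  exact ha I (lt_of_le_of_lt (by simpa using I.card_le_univ) hj)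

/-- An even element has no part of degree one. This makes powers vanish twice as fast, which is what
allows Taylor sums to be shifted without a boundary term. -/
theorem IsEven.mem_fil_two {a : Grassmann m} (ha : a.IsEven) (h : a.body = 0) :
    a ∈ fil m 2 := by
  intro I hI
  rcases Nat.even_or_odd I.card with h' | h'
  · have : I = ∅ := Finset.card_eq_zero.1 (by grind)
    rw [this]; exact h
  · exact ha I h'

theorem IsOdd.mem_fil_one {a : Grassmann m} (ha : a.IsOdd) : a ∈ fil m 1 :=
  Grassmann.mem_fil_one.2 (ha ∅ (by simp))

/-! ### The body and invertible elements -/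

theorem body_add (a b : Grassmann m) : (a + b).body = a.body + b.body := rfl
theorem body_sub (a b : Grassmann m) : (a - b).body = a.body - b.body := rfl
theorem body_zero : (0 : Grassmann m).body = 0 := rfl
theorem body_smul (c : ℂ) (a : Grassmann m) : (c • a).body = c * a.body := rfl

theorem body_algebraMap (c : ℂ) : (algebraMap ℂ (Grassmann m) c).body = c := by
  rw [body, algebraMap_apply', if_pos rfl]

theorem body_one : (1 : Grassmann m).body = 1 := rfl

theorem body_mul (a b : Grassmann m) : (a * b).body = a.body * b.body := by
  rw [body, mul_apply]; simp [sgn, body]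

theorem IsOdd.body_eq_zero {a : Grassmann m} (ha : a.IsOdd) : a.body = 0 := ha ∅ (by simp)

theorem pow_eq_zero_of_body {a : Grassmann m} (ha : a.body = 0) {k : ℕ} (hk : m < k) :
    a ^ k = 0 :=
  eq_zero_of_mem_fil (by omega) (pow_mem_fil (mem_fil_one.2 ha) k)

theorem isUnit_of_body_ne_zero {a : Grassmann m} (ha : a.body ≠ 0) : IsUnit a := by
  have h1 : IsNilpotent (a - algebraMap ℂ _ a.body) :=
    ⟨m + 1, pow_eq_zero_of_body (by rw [body_sub, body_algebraMap, sub_self]) (by omega)⟩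
  have h2 : IsUnit (algebraMap ℂ (Grassmann m) a.body) := (isUnit_iff_ne_zero.2 ha).map _
  have := h1.isUnit_add_left_of_commute h2 ((isEven_algebraMap _).mul_comm _).symm
  simpa using this

/-- The inverse of an element with body `1`, as a geometric sum. -/
def geomInv (a : Grassmann m) : Grassmann m := ∑ k ∈ Finset.range (m + 1), (1 - a) ^ k

theorem mul_geomInv {a : Grassmann m} (ha : a.body = 1) : a * geomInv a = 1 := by
  have h := mul_neg_geom_sum (1 - a) (m + 1)
  rwa [pow_eq_zero_of_body (by rw [body_sub, body_one, ha, sub_self]) (by omega),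
    sub_sub_cancel, sub_zero] at h

theorem geomInv_mul {a : Grassmann m} (ha : a.body = 1) : geomInv a * a = 1 := by
  have h := geom_sum_mul_neg (1 - a) (m + 1)
  rwa [pow_eq_zero_of_body (by rw [body_sub, body_one, ha, sub_self]) (by omega),
    sub_sub_cancel, sub_zero] at h

theorem IsEven.geomInv {a : Grassmann m} (ha : a.IsEven) : (geomInv a).IsEven :=
  IsEven.sum fun k _ => (isEven_one.sub ha).pow k

/-- Successive approximations of the square root of an element with body `1`. -/
def sqrtAux (a : Grassmann m) : ℕ → Grassmann m
  | 0 => 1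
  | k + 1 => sqrtAux a k + (1 / 2 : ℂ) • (a - sqrtAux a k * sqrtAux a k)

/-- The square root with body `1` of an even element with body `1`. -/
def sqrt (a : Grassmann m) : Grassmann m := sqrtAux a m

theorem IsEven.sqrtAux {a : Grassmann m} (ha : a.IsEven) (k : ℕ) : (sqrtAux a k).IsEven := by
  induction k with
  | zero => exact isEven_one
  | succ k ih => exact ih.add ((ha.sub (ih.mul ih)).smul _)

theorem body_sqrtAux {a : Grassmann m} (ha : a.body = 1) (k : ℕ) : (sqrtAux a k).body = 1 := by
  induction k with
  | zero => rfl
  | succ k ih => simp [Grassmann.sqrtAux, body_add, body_smul, body_sub, body_mul, ih, ha]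

theorem sqrtAux_error {a : Grassmann m} (ha : a.body = 1) (k : ℕ) :
    a - sqrtAux a k * sqrtAux a k ∈ fil m (k + 1) := by
  induction k with
  | zero => exact mem_fil_one.2 (by simp [body_sub, ha, Grassmann.sqrtAux, body_one])
  | succ k ih =>
    set l := sqrtAux a k with hl
    set e := a - l * l with he
    have hl1 : (1 - l) ∈ fil m 1 :=
      mem_fil_one.2 (by rw [body_sub, body_one, hl, body_sqrtAux ha, sub_self])
    -- Newton's step with the derivative frozen at `2`: the linear part of the error survives only
    -- multiplied by `1 - l`, which has body zero, and the rest is quadratic in `e`. So the error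
    -- gains a degree.
    have key : a - sqrtAux a (k + 1) * sqrtAux a (k + 1) =
        (1 / 2 : ℂ) • (e * (1 - l)) + (1 / 2 : ℂ) • ((1 - l) * e) - (1 / 4 : ℂ) • (e * e) := by
      have : a = e + l * l := by rw [he]; abel
      rw [Grassmann.sqrtAux, ← hl, ← he]
      nth_rewrite 1 [this]
      simp only [mul_add, add_mul, mul_sub, sub_mul, smul_mul_assoc, mul_smul_comm,
        _root_.mul_one, _root_.one_mul]
      module
    rw [key]
    have h1 := mul_mem_fil ih hl1
    have h2 := mul_mem_fil hl1 ih
    have h3 := fil_anti (m := m) (by omega : k + 1 + 1 ≤ (k + 1) + (k + 1)) (mul_mem_fil ih ih)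
    rw [add_comm 1] at h2
    exact sub_mem (add_mem (Submodule.smul_mem _ _ h1) (Submodule.smul_mem _ _ h2))
      (Submodule.smul_mem _ _ h3)

theorem sqrt_mul_self {a : Grassmann m} (ha : a.body = 1) : sqrt a * sqrt a = a :=
  (sub_eq_zero.1 (eq_zero_of_mem_fil (by omega) (sqrtAux_error ha m))).symm

/-- In `(a - b)(a + b) = 0` the second factor is invertible, since its body is twice that of `a`.
This uniqueness of square roots is what makes superconformal extensions rigid. -/
theorem IsEven.eq_of_mul_self_eq {a b : Grassmann m} (ha : a.IsEven)
    (h : a * a = b * b) (hb : a.body = b.body) (h0 : a.body ≠ 0) : a = b := by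
  have hu : IsUnit (a + b) := isUnit_of_body_ne_zero <| by
    rw [body_add, ← hb, ← two_mul]; exact mul_ne_zero two_ne_zero h0
  have : (a - b) * (a + b) = 0 := by
    rw [sub_mul, mul_add, mul_add, h, ha.mul_comm b]; abel
  exact sub_eq_zero.1 (hu.mul_left_eq_zero.1 this)

end Grassmann
end
-- Splitting off `θ`, and the ideal generated by the parameters.
noncomputable section

open SuperFun

namespace Grassmann

instance (m : ℕ) : FiniteDimensional ℂ (Grassmann m) :=
  inferInstanceAs (FiniteDimensional ℂ (Finset (Fin m) → ℂ))

instance (m : ℕ) : FiniteDimensional ℝ (Grassmann m) :=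
  inferInstanceAs (FiniteDimensional ℝ (Finset (Fin m) → ℂ))

variable {n : ℕ}

/-- The part `A` in the decomposition `a = A + θ B` with `A`, `B` free of `θ`. -/
def tf : Grassmann (n + 1) →L[ℂ] Grassmann (n + 1) :=
  LinearMap.toContinuousLinearMap
    { toFun := fun a I => if 0 ∈ I then 0 else a I
      map_add' := fun a b => by
        ext I
        change (if 0 ∈ I then (0 : ℂ) else _ + _) = (if 0 ∈ I then 0 else _) + (if 0 ∈ I then 0 else _)
        split_ifs <;> simp
      map_smul' := fun c a => by
        ext I
        change (if 0 ∈ I then 0 else c * _) = c * (if 0 ∈ I then 0 else _)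
        split_ifs <;> simp }

/-- The part `B` in the decomposition `a = A + θ B` with `A`, `B` free of `θ`. -/
def dth : Grassmann (n + 1) →L[ℂ] Grassmann (n + 1) :=
  LinearMap.toContinuousLinearMap
    { toFun := fun a I => if 0 ∈ I then 0 else a (insert 0 I)
      map_add' := fun a b => by
        ext I
        change (if 0 ∈ I then (0 : ℂ) else _ + _) = (if 0 ∈ I then 0 else _) + (if 0 ∈ I then 0 else _)
        split_ifs <;> simp
      map_smul' := fun c a => by
        ext I
        change (if 0 ∈ I then 0 else c * _) = c * (if 0 ∈ I then 0 else _)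
        split_ifs <;> simp }

theorem tf_apply (a : Grassmann (n + 1)) (I : Finset (Fin (n + 1))) :
    tf a I = if 0 ∈ I then 0 else a I := rfl

theorem dth_apply (a : Grassmann (n + 1)) (I : Finset (Fin (n + 1))) :
    dth a I = if 0 ∈ I then 0 else a (insert 0 I) := rfl

@[simp] theorem tf_tf (a : Grassmann (n + 1)) : tf (tf a) = tf a := by
  ext I; simp only [tf_apply]; split_ifs <;> rfl

@[simp] theorem tf_dth (a : Grassmann (n + 1)) : tf (dth a) = dth a := by
  ext I; simp only [tf_apply, dth_apply]; split_ifs <;> rfl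

@[simp] theorem dth_tf (a : Grassmann (n + 1)) : dth (tf a) = 0 := by
  ext I; simp only [tf_apply, dth_apply]; simp [zero_apply]

@[simp] theorem dth_dth (a : Grassmann (n + 1)) : dth (dth a) = 0 := by
  ext I; simp only [dth_apply]; simp [zero_apply]

theorem sgn_singleton_zero (J : Finset (Fin (n + 1))) : sgn {0} J = 1 := by
  simp [sgn]

theorem theta_mul_apply (a : Grassmann (n + 1)) (K : Finset (Fin (n + 1))) :
    (theta n * a) K = if 0 ∈ K then a (K.erase 0) else 0 := by
  rw [mul_apply]
  split_ifs with h
  · rw [Finset.sum_eq_single {0}]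
    · rw [sgn_singleton_zero, Finset.sdiff_singleton_eq_erase]; simp [theta, gen]
    · intro I _ hI; simp [theta, gen, hI]
    · intro h'; simp [h] at h'
  · refine Finset.sum_eq_zero fun I hI => ?_
    have : I ≠ {0} := by
      rintro rfl; exact h (Finset.mem_powerset.1 hI (by simp))
    simp [theta, gen, this]

theorem tf_add_theta_mul_dth (a : Grassmann (n + 1)) : tf a + theta n * dth a = a := by
  ext I
  rw [add_apply, theta_mul_apply, tf_apply, dth_apply]
  split_ifs with h h'
  · simp at h'
  · simp [Finset.insert_erase h]
  · simp

@[simp] theorem dth_theta_mul (a : Grassmann (n + 1)) : dth (theta n * a) = tf a := by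
  ext I
  rw [dth_apply, theta_mul_apply, tf_apply]
  split_ifs with h h'
  · rfl
  · rw [Finset.erase_insert h]
  · simp at h'

@[simp] theorem tf_theta_mul (a : Grassmann (n + 1)) : tf (theta n * a) = 0 := by
  ext I
  rw [tf_apply, theta_mul_apply]
  split_ifs <;> rfl

@[simp] theorem tf_mul (a b : Grassmann (n + 1)) : tf (a * b) = tf a * tf b := by
  ext K
  rw [tf_apply, mul_apply, mul_apply]
  split_ifs with h
  · symm
    refine Finset.sum_eq_zero fun I _ => ?_
    rw [tf_apply, tf_apply]
    by_cases hI : 0 ∈ I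
    · simp [hI]
    · simp [h, hI]
  · refine Finset.sum_congr rfl fun I hI => ?_
    have h1 : 0 ∉ I := fun h' => h (Finset.mem_powerset.1 hI h')
    have h2 : 0 ∉ K \ I := fun h' => h (Finset.sdiff_subset h')
    rw [tf_apply, tf_apply, if_neg h1, if_neg h2]

@[simp] theorem tf_algebraMap (c : ℂ) : tf (algebraMap ℂ (Grassmann (n + 1)) c) =
    algebraMap ℂ _ c := by
  ext I; rw [tf_apply, algebraMap_apply']; split_ifs with h h' <;> simp_all

@[simp] theorem tf_one : tf (1 : Grassmann (n + 1)) = 1 := by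
  simpa using tf_algebraMap (n := n) 1

@[simp] theorem tf_pow (a : Grassmann (n + 1)) (k : ℕ) : tf (a ^ k) = tf a ^ k := by
  induction k with
  | zero => simp
  | succ k ih => rw [pow_succ, pow_succ, tf_mul, ih]

@[simp] theorem dth_algebraMap (c : ℂ) : dth (algebraMap ℂ (Grassmann (n + 1)) c) = 0 := by
  rw [← tf_algebraMap, dth_tf]

@[simp] theorem dth_one : dth (1 : Grassmann (n + 1)) = 0 := by
  simpa using dth_algebraMap (n := n) 1

@[simp] theorem dth_theta : dth (theta n) = 1 := by
  simpa using dth_theta_mul (1 : Grassmann (n + 1))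

@[simp] theorem tf_theta : tf (theta n) = 0 := by
  simpa using tf_theta_mul (1 : Grassmann (n + 1))

theorem isOdd_theta : (theta n).IsOdd := by
  intro I hI
  rw [theta, gen, if_neg]; rintro rfl; simp at hI

theorem IsEven.tf {a : Grassmann (n + 1)} (ha : a.IsEven) : (tf a).IsEven := fun I hI => by
  rw [tf_apply, ha I hI, ite_self]

theorem IsOdd.tf {a : Grassmann (n + 1)} (ha : a.IsOdd) : (tf a).IsOdd := fun I hI => by
  rw [tf_apply, ha I hI, ite_self]

theorem IsEven.dth {a : Grassmann (n + 1)} (ha : a.IsEven) : (dth a).IsOdd := fun I hI => by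
  rw [dth_apply]
  split_ifs with h
  · rfl
  · exact ha _ (by rw [Finset.card_insert_of_notMem h]; exact hI.add_one)

theorem IsOdd.dth {a : Grassmann (n + 1)} (ha : a.IsOdd) : (dth a).IsEven := fun I hI => by
  rw [dth_apply]
  split_ifs with h
  · rfl
  · exact ha _ (by rw [Finset.card_insert_of_notMem h]; exact hI.add_one)

theorem dth_add_theta_mul {A B : Grassmann (n + 1)} (hA : tf A = A) (hB : tf B = B) :
    dth (A + theta n * B) = B := by
  rw [map_add, dth_theta_mul, hB, ← hA, dth_tf, zero_add]

theorem IsEven.dth_mul {a : Grassmann (n + 1)} (ha : a.IsEven) (b : Grassmann (n + 1)) :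
    Grassmann.dth (a * b) = Grassmann.dth a * b + a * Grassmann.dth b := by
  have hc : Grassmann.dth a * theta n = -(theta n * Grassmann.dth a) :=
    ha.dth.mul_eq_neg isOdd_theta
  have hA : Grassmann.tf a * theta n = theta n * Grassmann.tf a := ha.tf.mul_comm _
  -- The normal form `A + θ B` of the product; moving `θ` to the left past the odd factor `dth a`
  -- produces the signs.
  have key : a * b = Grassmann.tf a * Grassmann.tf b +
      theta n * (Grassmann.dth a * Grassmann.tf b + Grassmann.tf a * Grassmann.dth b) := by
    conv_lhs => rw [← tf_add_theta_mul_dth a, ← tf_add_theta_mul_dth b]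
    have h0 : theta n * Grassmann.dth a * (theta n * Grassmann.dth b) = 0 := by
      rw [mul_assoc, ← mul_assoc (Grassmann.dth a), hc, neg_mul, mul_neg, ← mul_assoc, ← mul_assoc,
        isOdd_theta.mul_self]; simp
    rw [add_mul, mul_add, mul_add, h0, ← mul_assoc (Grassmann.tf a), hA]
    noncomm_ring
  rw [key, dth_add_theta_mul (by simp) (by simp)]
  conv_rhs => rw [← tf_add_theta_mul_dth a, ← tf_add_theta_mul_dth b]
  simp only [map_add, dth_theta_mul, dth_tf, zero_add, tf_dth]
  rw [mul_add, add_mul, ← mul_assoc (Grassmann.dth a), hc]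
  noncomm_ring

theorem IsOdd.dth_mul {a : Grassmann (n + 1)} (ha : a.IsOdd) (b : Grassmann (n + 1)) :
    Grassmann.dth (a * b) = Grassmann.dth a * b - a * Grassmann.dth b := by
  have hc : Grassmann.dth a * theta n = theta n * Grassmann.dth a := ha.dth.mul_comm _
  have hA : Grassmann.tf a * theta n = -(theta n * Grassmann.tf a) :=
    ha.tf.mul_eq_neg isOdd_theta
  have key : a * b = Grassmann.tf a * Grassmann.tf b +
      theta n * (Grassmann.dth a * Grassmann.tf b - Grassmann.tf a * Grassmann.dth b) := by
    conv_lhs => rw [← tf_add_theta_mul_dth a, ← tf_add_theta_mul_dth b]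
    have h0 : theta n * Grassmann.dth a * (theta n * Grassmann.dth b) = 0 := by
      rw [mul_assoc, ← mul_assoc (Grassmann.dth a), hc, ← mul_assoc, ← mul_assoc,
        isOdd_theta.mul_self]; simp
    rw [add_mul, mul_add, mul_add, h0, ← mul_assoc (Grassmann.tf a), hA]
    noncomm_ring
  rw [key, dth_add_theta_mul (by simp) (by simp)]
  conv_rhs => rw [← tf_add_theta_mul_dth a, ← tf_add_theta_mul_dth b]
  simp only [map_add, dth_theta_mul, dth_tf, zero_add, tf_dth]
  rw [mul_add, add_mul, ← mul_assoc (Grassmann.dth a), hc]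
  noncomm_ring

theorem IsEven.dth_pow {a : Grassmann (n + 1)} (ha : a.IsEven) (k : ℕ) :
    Grassmann.dth (a ^ k) = (k : ℂ) • (Grassmann.dth a * a ^ (k - 1)) := by
  induction k with
  | zero => simp
  | succ k ih =>
    rw [pow_succ, (ha.pow k).dth_mul, ih, (ha.pow k).mul_comm]
    rcases k with _ | k
    · simp
    · simp only [Nat.add_sub_cancel, smul_mul_assoc, mul_assoc, ← pow_succ]
      push_cast
      module

theorem body_tf (a : Grassmann (n + 1)) : (tf a).body = a.body := by
  rw [body, tf_apply, if_neg (by simp)]; rfl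

/-! ### The ideal of the parameters -/

/-- The basis element `e_I`. -/
def basisElt {m : ℕ} (I : Finset (Fin m)) : Grassmann m := fun J => if J = I then 1 else 0

theorem gen_mul_basisElt {m : ℕ} {i : Fin m} {I : Finset (Fin m)} (hi : i ∈ I) :
    gen i * basisElt (I.erase i) = sgn {i} (I.erase i) • basisElt I := by
  ext K
  rw [mul_apply, smul_apply, basisElt]
  by_cases hK : K = I
  · subst hK
    rw [Finset.sum_eq_single {i}]
    · simp [gen, basisElt, Finset.sdiff_singleton_eq_erase]
    · intro J _ hJ; simp [gen, hJ]
    · intro h; simp [hi] at h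
  · rw [if_neg hK, mul_zero]
    refine Finset.sum_eq_zero fun J hJ => ?_
    by_cases hJi : J = {i}
    · subst hJi
      have hiK : i ∈ K := Finset.mem_powerset.1 hJ (by simp)
      have : K.erase i ≠ I.erase i := fun h => hK <| by
        rw [← Finset.insert_erase hiK, h, Finset.insert_erase hi]
      simp [basisElt, Finset.sdiff_singleton_eq_erase, this]
    · simp [gen, hJi]

theorem mul_apply_singleton {m : ℕ} (a b : Grassmann m) (i : Fin m) :
    (a * b) {i} = a ∅ * b {i} + a {i} * b ∅ := by
  have : ({i} : Finset (Fin m)).powerset = {∅, {i}} := by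
    ext J; simp [Finset.subset_singleton_iff]
  rw [mul_apply, this, Finset.sum_pair (by simp)]
  simp [sgn]

theorem eq_sum_basisElt {m : ℕ} (a : Grassmann m) : a = ∑ I, a I • basisElt I := by
  ext J
  rw [sum_apply, Finset.sum_eq_single J]
  · simp [smul_apply, basisElt]
  · intro I _ hI; simp [smul_apply, basisElt, hI.symm]
  · simp

end Grassmann

namespace SuperFun
open Grassmann

variable {n : ℕ}

/-- The quotient by the parameters is the exterior algebra on `θ` alone, with basis `1, θ`, so only
these two coefficients are seen. -/
theorem modXi_iff {a b : Grassmann (n + 1)} : ModXi a b ↔ a ∅ = b ∅ ∧ a {0} = b {0} := by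
  rw [← sub_eq_zero, ← sub_eq_zero (a := a {0}), ← Grassmann.sub_apply, ← Grassmann.sub_apply, ModXi]
  generalize a - b = d
  constructor
  · intro h
    let J : TwoSidedIdeal (Grassmann (n + 1)) := TwoSidedIdeal.mk' {d | d ∅ = 0 ∧ d {0} = 0}
      ⟨rfl, rfl⟩ (fun h h' => ⟨by rw [Grassmann.add_apply, h.1, h'.1, add_zero],
        by rw [Grassmann.add_apply, h.2, h'.2, add_zero]⟩)
      (fun h => ⟨by rw [neg_apply, h.1, neg_zero], by rw [neg_apply, h.2, neg_zero]⟩)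
      (fun h => ⟨by simp [mul_apply, h.1],
        by rw [mul_apply_singleton, h.1, h.2]; ring⟩)
      (fun h => ⟨by simp [mul_apply, h.1],
        by rw [mul_apply_singleton, h.1, h.2]; ring⟩)
    have hJ : TwoSidedIdeal.span (Set.range (xi (n := n))) ≤ J := by
      rw [TwoSidedIdeal.span_le]
      rintro _ ⟨i, rfl⟩
      rw [SetLike.mem_coe, TwoSidedIdeal.mem_mk']
      refine ⟨?_, ?_⟩
      · rw [xi, gen, if_neg (by simp)]
      · rw [xi, gen, if_neg]
        rw [Finset.singleton_inj]; exact (Fin.succ_ne_zero i).symm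
    have h' := hJ h
    rwa [TwoSidedIdeal.mem_mk'] at h'
  · rintro ⟨h0, h1⟩
    rw [eq_sum_basisElt d]
    refine sum_mem fun I _ => ?_
    -- A basis element containing some `ξ_i` is a multiple of it; the only others are `1` and `θ`.
    by_cases hI : ∃ i : Fin n, i.succ ∈ I
    · obtain ⟨i, hi⟩ := hI
      have e : d I • basisElt I =
          (xi i) * ((d I * sgn {i.succ} (I.erase i.succ)) • basisElt (I.erase i.succ)) := by
        rw [xi, mul_smul_comm, gen_mul_basisElt hi, smul_smul, mul_assoc, sgn_mul_self, mul_one]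
      rw [e]
      exact TwoSidedIdeal.mul_mem_right _ _ _ (TwoSidedIdeal.subset_span ⟨i, rfl⟩)
    · have : I = ∅ ∨ I = {0} := by
        rw [← Finset.subset_singleton_iff]
        intro j hj
        rcases Fin.eq_zero_or_eq_succ j with rfl | ⟨i, rfl⟩
        · simp
        · exact absurd ⟨i, hj⟩ hI
      rcases this with rfl | rfl
      · rw [h0, zero_smul]; exact zero_mem _
      · rw [h1, zero_smul]; exact zero_mem _

end SuperFun
end
-- Calculus of Grassmann-valued functions and Wirtinger derivatives.
noncomputable section

open SuperFun

namespace Grassmann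

variable {m n : ℕ}

/-- Multiplication as a continuous real bilinear map. -/
def mulL (m : ℕ) : Grassmann m →L[ℝ] Grassmann m →L[ℝ] Grassmann m :=
  LinearMap.toContinuousBilinearMap <| LinearMap.mk₂ ℝ (fun a b => a * b) add_mul
    (fun c a b => by simp only [real_smul_eq, smul_mul_assoc]) mul_add
    (fun c a b => by simp only [real_smul_eq, mul_smul_comm])

theorem mulL_apply (a b : Grassmann m) : mulL m a b = a * b := rfl

/-- The body as a continuous complex linear map. -/
def bodyL (m : ℕ) : Grassmann m →L[ℂ] ℂ :=
  LinearMap.toContinuousLinearMap { toFun := body, map_add' := body_add, map_smul' := body_smul }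

theorem bodyL_apply (a : Grassmann m) : bodyL m a = a.body := rfl

section Calculus

variable {E : Type*} [NormedAddCommGroup E] [NormedSpace ℝ E]

theorem hasFDerivAt_mul {f g : E → Grassmann m} {f' g' : E →L[ℝ] Grassmann m} {x : E}
    (hf : HasFDerivAt f f' x) (hg : HasFDerivAt g g' x) :
    HasFDerivAt (fun y => f y * g y) (mulL m (f x) ∘L g' + (mulL m).flip (g x) ∘L f') x := by
  exact (mulL m).hasFDerivAt_of_bilinear hf hg

theorem differentiableAt_mul {f g : E → Grassmann m} {x : E}
    (hf : DifferentiableAt ℝ f x) (hg : DifferentiableAt ℝ g x) :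
    DifferentiableAt ℝ (fun y => f y * g y) x :=
  (hasFDerivAt_mul hf.hasFDerivAt hg.hasFDerivAt).differentiableAt

theorem contDiffOn_mul {f g : E → Grassmann m} {s : Set E} (hf : ContDiffOn ℝ ∞ f s)
    (hg : ContDiffOn ℝ ∞ g s) : ContDiffOn ℝ ∞ (fun y => f y * g y) s :=
  ((mulL m).isBoundedBilinearMap.contDiff).comp_contDiffOn (hf.prodMk hg)

theorem contDiffOn_pow {f : E → Grassmann m} {s : Set E} (hf : ContDiffOn ℝ ∞ f s) (k : ℕ) :
    ContDiffOn ℝ ∞ (fun y => f y ^ k) s := by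
  induction k with
  | zero => simpa using contDiffOn_const
  | succ k ih => simp only [pow_succ]; exact contDiffOn_mul ih hf

theorem contDiffOn_clm {F : Type*} [NormedAddCommGroup F] [NormedSpace ℂ F]
    {f : E → Grassmann m} {s : Set E} (L : Grassmann m →L[ℂ] F)
    (hf : ContDiffOn ℝ ∞ f s) : ContDiffOn ℝ ∞ (fun y => L (f y)) s :=
  (L.restrictScalars ℝ).contDiff.comp_contDiffOn hf

theorem contDiffOn_smul {f : E → Grassmann m} {s : Set E} (c : ℂ)
    (hf : ContDiffOn ℝ ∞ f s) : ContDiffOn ℝ ∞ (fun y => c • f y) s :=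
  contDiffOn_clm (c • ContinuousLinearMap.id ℂ (Grassmann m)) hf

theorem contDiffOn_geomInv {f : E → Grassmann m} {s : Set E} (hf : ContDiffOn ℝ ∞ f s) :
    ContDiffOn ℝ ∞ (fun y => geomInv (f y)) s :=
  ContDiffOn.sum fun k _ => contDiffOn_pow (contDiffOn_const.sub hf) k

theorem contDiffOn_sqrt {f : E → Grassmann m} {s : Set E} (hf : ContDiffOn ℝ ∞ f s) :
    ContDiffOn ℝ ∞ (fun y => sqrt (f y)) s := by
  suffices ∀ k, ContDiffOn ℝ ∞ (fun y => sqrtAux (f y) k) s from this m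
  intro k
  induction k with
  | zero => exact contDiffOn_const
  | succ k ih => exact ih.add (contDiffOn_smul _ (hf.sub (contDiffOn_mul ih ih)))

/-- Term by term vanishing of a family of curves that solve a nilpotent linear system. -/
theorem eq_zero_of_hasDerivAt {κ : Type*} {Δ Δ' : κ → ℝ → Grassmann m}
    (h0 : ∀ i, Δ i 0 = 0) (hd : ∀ i t, HasDerivAt (Δ i) (Δ' i t) t)
    (h : ∀ k, (∀ i t, Δ i t ∈ fil m k) → ∀ i t, Δ' i t ∈ fil m (k + 1)) (i : κ) (t : ℝ) :
    Δ i t = 0 := by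
  suffices H : ∀ k i t, Δ i t ∈ fil m k from eq_zero_of_mem_fil (Nat.lt_succ_self m) (H _ i t)
  intro k
  induction k with
  | zero => exact fun i t => mem_fil_zero _
  | succ k ih =>
    -- A coefficient of degree at most `k` has zero derivative by the previous stage, hence keeps
    -- its initial value `0`.
    intro i t I hI
    have hD : ∀ t, HasDerivAt (fun t => Δ i t I) 0 t := fun t => by
      have := hasDerivAt_pi.1 (hd i t) I
      rwa [h k ih i t I hI] at this
    have hc := is_const_of_deriv_eq_zero (fun t => (hD t).differentiableAt) (fun t => (hD t).deriv)
      t 0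
    exact hc.trans (by rw [h0]; rfl)

end Calculus

end Grassmann

namespace SuperFun

open Grassmann

variable {n : ℕ} {F H : SuperFun n} {U V : Set ℂ} {z : ℂ}

theorem SmoothOn.differentiableAt (hF : SmoothOn F V) (hV : IsOpen V) (hz : z ∈ V) :
    DifferentiableAt ℝ F z :=
  ((hF z hz).contDiffAt (hV.mem_nhds hz)).differentiableAt (by simp)

theorem SmoothOn.mul (hF : SmoothOn F V) (hH : SmoothOn H V) :
    SmoothOn (fun y => F y * H y) V := contDiffOn_mul hF hH

theorem SmoothOn.add (hF : SmoothOn F V) (hH : SmoothOn H V) :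
    SmoothOn (fun y => F y + H y) V := ContDiffOn.add hF hH

theorem SmoothOn.sub (hF : SmoothOn F V) (hH : SmoothOn H V) :
    SmoothOn (fun y => F y - H y) V := ContDiffOn.sub hF hH

theorem SmoothOn.smul (c : ℂ) (hF : SmoothOn F V) : SmoothOn (fun y => c • F y) V :=
  contDiffOn_smul c hF

theorem smoothOn_const (a : Grassmann (n + 1)) : SmoothOn (fun _ => a) V := contDiffOn_const

theorem smoothOn_algebraMap : SmoothOn (fun y => algebraMap ℂ (Grassmann (n + 1)) y) V := by
  have : ContDiff ℝ ∞ (((ContinuousLinearMap.id ℂ ℂ).smulRight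
    (1 : Grassmann (n + 1))).restrictScalars ℝ) := ContinuousLinearMap.contDiff _
  refine this.contDiffOn.congr fun y _ => ?_
  simp [Algebra.algebraMap_eq_smul_one]

theorem SmoothOn.thetaFree (hF : SmoothOn F V) : SmoothOn (thetaFree F) V :=
  contDiffOn_clm tf hF

theorem SmoothOn.dtheta (hF : SmoothOn F V) : SmoothOn (dtheta F) V :=
  contDiffOn_clm dth hF

theorem SmoothOn.mono (hF : SmoothOn F V) (h : U ⊆ V) : SmoothOn F U := ContDiffOn.mono hF h

theorem SmoothOn.fderiv_apply (hF : SmoothOn F V) (hV : IsOpen V) (w : ℂ) :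
    SmoothOn (fun z => fderiv ℝ F z w) V :=
  (hF.fderiv_of_isOpen hV (by simp)).clm_apply contDiffOn_const

theorem SmoothOn.dx (hF : SmoothOn F V) (hV : IsOpen V) : SmoothOn (dx F) V :=
  contDiffOn_smul _ ((hF.fderiv_apply hV 1).sub ((hF.fderiv_apply hV Complex.I).smul _))

theorem SmoothOn.dxt (hF : SmoothOn F V) (hV : IsOpen V) : SmoothOn (dxt F) V :=
  contDiffOn_smul _ ((hF.fderiv_apply hV 1).add ((hF.fderiv_apply hV Complex.I).smul _))

theorem SmoothOn.iterate_dx (hF : SmoothOn F V) (hV : IsOpen V) (k : ℕ) :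
    SmoothOn (SuperFun.dx^[k] F) V := by
  induction k with
  | zero => exact hF
  | succ k ih => rw [Function.iterate_succ_apply']; exact ih.dx hV

theorem SmoothOn.D (hF : SmoothOn F V) (hV : IsOpen V) : SmoothOn (D F) V :=
  hF.dtheta.add ((smoothOn_const _).mul (hF.dx hV))

/-! ### Wirtinger derivatives -/

theorem thetaFree_apply (F : SuperFun n) (z : ℂ) : SuperFun.thetaFree F z = tf (F z) := rfl

theorem dtheta_apply (F : SuperFun n) (z : ℂ) : SuperFun.dtheta F z = dth (F z) := rfl

theorem dx_eq {L : ℂ →L[ℝ] Grassmann (n + 1)} (h : HasFDerivAt F L z) :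
    dx F z = (1 / 2 : ℂ) • (L 1 - Complex.I • L Complex.I) := by
  rw [SuperFun.dx, h.fderiv]

theorem dxt_eq {L : ℂ →L[ℝ] Grassmann (n + 1)} (h : HasFDerivAt F L z) :
    dxt F z = (1 / 2 : ℂ) • (L 1 + Complex.I • L Complex.I) := by
  rw [SuperFun.dxt, h.fderiv]

theorem fderiv_eq (F : SuperFun n) (z w : ℂ) :
    fderiv ℝ F z w = w • dx F z + (starRingEnd ℂ) w • dxt F z := by
  have hw : w = w.re • (1 : ℂ) + w.im • Complex.I := by
    simp [Complex.real_smul, Complex.re_add_im]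
  have hc : (starRingEnd ℂ) w = (w.re : ℂ) - (w.im : ℂ) * Complex.I := by
    apply Complex.ext <;> simp
  conv_lhs => rw [hw, map_add, map_smul, map_smul, real_smul_eq, real_smul_eq]
  rw [hc]
  nth_rewrite 3 [← Complex.re_add_im w]
  simp only [dx, dxt]
  generalize fderiv ℝ F z 1 = a
  generalize fderiv ℝ F z Complex.I = b
  have hI : (Complex.I : ℂ) * Complex.I = -1 := Complex.I_mul_I
  -- `module` does not know `I² = -1`; the relation is inserted by hand so that the rest is a
  -- polynomial identity in `I`.
  have e : (w.im : ℂ) • b = (-(w.im * (Complex.I * Complex.I)) : ℂ) • b := by rw [hI]; simp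
  rw [e]
  module

theorem dx_congr (h : F =ᶠ[nhds z] H) : dx F z = dx H z := by
  rw [dx, dx, h.fderiv_eq]

theorem dxt_congr (h : F =ᶠ[nhds z] H) : dxt F z = dxt H z := by
  rw [dxt, dxt, h.fderiv_eq]

theorem dx_eqOn (hV : IsOpen V) (h : Set.EqOn F H V) : Set.EqOn (dx F) (dx H) V :=
  fun _ hz => dx_congr (h.eventuallyEq_of_mem (hV.mem_nhds hz))

theorem dxt_eqOn (hV : IsOpen V) (h : Set.EqOn F H V) : Set.EqOn (dxt F) (dxt H) V :=
  fun _ hz => dxt_congr (h.eventuallyEq_of_mem (hV.mem_nhds hz))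

theorem iterate_dx_eqOn (hV : IsOpen V) (h : Set.EqOn F H V) (k : ℕ) :
    Set.EqOn (dx^[k] F) (dx^[k] H) V := by
  induction k with
  | zero => exact h
  | succ k ih => rw [Function.iterate_succ_apply', Function.iterate_succ_apply']; exact dx_eqOn hV ih

theorem D_eqOn (hV : IsOpen V) (h : Set.EqOn F H V) : Set.EqOn (D F) (D H) V := fun z hz => by
  rw [D, D, dx_eqOn hV h hz, dtheta_apply, dtheta_apply, h hz]

theorem dx_mul (hF : DifferentiableAt ℝ F z) (hH : DifferentiableAt ℝ H z) :
    dx (fun y => F y * H y) z = dx F z * H z + F z * dx H z := by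
  rw [dx_eq (hasFDerivAt_mul hF.hasFDerivAt hH.hasFDerivAt), dx, dx]
  simp only [_root_.add_apply, ContinuousLinearMap.comp_apply,
    ContinuousLinearMap.flip_apply, mulL_apply, smul_mul_assoc, mul_smul_comm, mul_sub, sub_mul]
  module

theorem dxt_mul (hF : DifferentiableAt ℝ F z) (hH : DifferentiableAt ℝ H z) :
    dxt (fun y => F y * H y) z = dxt F z * H z + F z * dxt H z := by
  rw [dxt_eq (hasFDerivAt_mul hF.hasFDerivAt hH.hasFDerivAt), dxt, dxt]
  simp only [_root_.add_apply, ContinuousLinearMap.comp_apply,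
    ContinuousLinearMap.flip_apply, mulL_apply, smul_mul_assoc, mul_smul_comm, mul_add, add_mul]
  module

theorem dx_add (hF : DifferentiableAt ℝ F z) (hH : DifferentiableAt ℝ H z) :
    dx (fun y => F y + H y) z = dx F z + dx H z := by
  have h : HasFDerivAt (fun y => F y + H y) _ z := hF.hasFDerivAt.add hH.hasFDerivAt
  rw [dx_eq h, dx, dx]
  simp only [_root_.add_apply]
  module

theorem dxt_add (hF : DifferentiableAt ℝ F z) (hH : DifferentiableAt ℝ H z) :
    dxt (fun y => F y + H y) z = dxt F z + dxt H z := by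
  have h : HasFDerivAt (fun y => F y + H y) _ z := hF.hasFDerivAt.add hH.hasFDerivAt
  rw [dxt_eq h, dxt, dxt]
  simp only [_root_.add_apply]
  module

theorem dx_const (a : Grassmann (n + 1)) (z : ℂ) : dx (fun _ => a) z = 0 := by
  simp [dx]

theorem dxt_const (a : Grassmann (n + 1)) (z : ℂ) : dxt (fun _ => a) z = 0 := by
  simp [dxt]

theorem dx_clm (L : Grassmann (n + 1) →L[ℂ] Grassmann (n + 1)) (hF : DifferentiableAt ℝ F z) :
    dx (fun y => L (F y)) z = L (dx F z) := by
  have h : HasFDerivAt (fun y => L (F y)) _ z :=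
    ((L.restrictScalars ℝ).hasFDerivAt).comp z hF.hasFDerivAt
  rw [dx_eq h, dx]
  simp

theorem dxt_clm (L : Grassmann (n + 1) →L[ℂ] Grassmann (n + 1)) (hF : DifferentiableAt ℝ F z) :
    dxt (fun y => L (F y)) z = L (dxt F z) := by
  have h : HasFDerivAt (fun y => L (F y)) _ z :=
    ((L.restrictScalars ℝ).hasFDerivAt).comp z hF.hasFDerivAt
  rw [dxt_eq h, dxt]
  simp

theorem dx_dtheta (hF : DifferentiableAt ℝ F z) : dx (dtheta F) z = dth (dx F z) := dx_clm dth hF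

theorem dx_thetaFree (hF : DifferentiableAt ℝ F z) : dx (thetaFree F) z = tf (dx F z) :=
  dx_clm tf hF

theorem dxt_dtheta (hF : DifferentiableAt ℝ F z) : dxt (dtheta F) z = dth (dxt F z) :=
  dxt_clm dth hF

theorem dxt_thetaFree (hF : DifferentiableAt ℝ F z) : dxt (thetaFree F) z = tf (dxt F z) :=
  dxt_clm tf hF

theorem dx_dxt (hF : SmoothOn F V) (hV : IsOpen V) (hz : z ∈ V) : dx (dxt F) z = dxt (dx F) z := by
  have hs : IsSymmSndFDerivAt ℝ F z :=
    ((hF z hz).contDiffAt (hV.mem_nhds hz)).isSymmSndFDerivAt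
      (by rw [minSmoothness_of_isRCLikeNormedField]; exact WithTop.coe_le_coe.2 (le_top : (2 : ℕ∞) ≤ ⊤))
  have hd : DifferentiableAt ℝ (fderiv ℝ F) z :=
    ((hF.fderiv_of_isOpen hV (m := ∞) (by simp)).contDiffAt (hV.mem_nhds hz)).differentiableAt
      (by simp)
  have h1 : ∀ w, HasFDerivAt (fun y => fderiv ℝ F y w)
      ((ContinuousLinearMap.apply ℝ _ w) ∘L (fderiv ℝ (fderiv ℝ F) z)) z := fun w =>
    (ContinuousLinearMap.apply ℝ (Grassmann (n + 1)) w).hasFDerivAt.comp z hd.hasFDerivAt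
  have hsm : ∀ (c : ℂ) {f : ℂ → Grassmann (n + 1)} {f' : ℂ →L[ℝ] Grassmann (n + 1)},
      HasFDerivAt f f' z → HasFDerivAt (fun y => c • f y) (c • f') z :=
    fun c _ _ h => h.const_smul c
  have ha : HasFDerivAt (dxt F) _ z := hsm _ ((h1 1).add (hsm Complex.I (h1 Complex.I)))
  have hb : HasFDerivAt (dx F) _ z := hsm _ ((h1 1).sub (hsm Complex.I (h1 Complex.I)))
  rw [dx_eq ha, dxt_eq hb]
  simp only [_root_.smul_apply, _root_.add_apply,
    _root_.sub_apply, ContinuousLinearMap.comp_apply, ContinuousLinearMap.apply_apply]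
  rw [hs.eq Complex.I 1]
  module

theorem dxt_eq_zero (hF : DifferentiableAt ℂ F z) : dxt F z = 0 := by
  rw [dxt, hF.fderiv_restrictScalars ℝ]
  have : fderiv ℂ F z Complex.I = Complex.I • fderiv ℂ F z 1 := by
    rw [← map_smul, smul_eq_mul, mul_one]
  simp only [ContinuousLinearMap.coe_restrictScalars', this, smul_smul, Complex.I_mul_I]
  simp

theorem dx_eq_deriv (hF : DifferentiableAt ℂ F z) : dx F z = deriv F z := by
  rw [dx, hF.fderiv_restrictScalars ℝ]
  have : fderiv ℂ F z Complex.I = Complex.I • fderiv ℂ F z 1 := by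
    rw [← map_smul, smul_eq_mul, mul_one]
  simp only [ContinuousLinearMap.coe_restrictScalars', this, smul_smul, Complex.I_mul_I,
    ← fderiv_apply_one_eq_deriv]
  module

end SuperFun
end
-- Evaluation at points with Grassmann coordinates, and its chain rule.
noncomputable section

open SuperFun

namespace SuperFun

open Grassmann

variable {n : ℕ} {F H : SuperFun n} {U V : Set ℂ} {z : ℂ}

/-! ### Parity of derivatives -/

theorem dx_apply_eq_zero (hV : IsOpen V) (hF : SmoothOn F V) {I : Finset (Fin (n + 1))} {c : ℂ}
    (h : ∀ y ∈ V, F y I = c) (hz : z ∈ V) : dx F z I = 0 := by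
  -- The coefficient at `I`, stored as a multiple of `1` so that it is an endomorphism and commutes
  -- with `dx` by `dx_clm`.
  let L : Grassmann (n + 1) →L[ℂ] Grassmann (n + 1) := LinearMap.toContinuousLinearMap
    { toFun := fun a => a I • 1
      map_add' := fun a b => by rw [Grassmann.add_apply, add_smul]
      map_smul' := fun c a => by rw [Grassmann.smul_apply, mul_smul]; rfl }
  have h1 : L (dx F z) = 0 := by
    rw [← dx_clm L (hF.differentiableAt hV hz),
      dx_eqOn hV (H := fun _ => c • 1) (fun y hy => by rw [← h y hy]; rfl) hz, dx_const]
  have h2 : (dx F z I • (1 : Grassmann (n + 1))).body = 0 := by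
    rw [show dx F z I • (1 : Grassmann (n + 1)) = 0 from h1]; rfl
  rwa [body_smul, body_one, mul_one] at h2

theorem dxt_apply_eq_zero (hV : IsOpen V) (hF : SmoothOn F V) {I : Finset (Fin (n + 1))} {c : ℂ}
    (h : ∀ y ∈ V, F y I = c) (hz : z ∈ V) : dxt F z I = 0 := by
  let L : Grassmann (n + 1) →L[ℂ] Grassmann (n + 1) := LinearMap.toContinuousLinearMap
    { toFun := fun a => a I • 1
      map_add' := fun a b => by rw [Grassmann.add_apply, add_smul]
      map_smul' := fun c a => by rw [Grassmann.smul_apply, mul_smul]; rfl }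
  have h1 : L (dxt F z) = 0 := by
    rw [← dxt_clm L (hF.differentiableAt hV hz),
      dxt_eqOn hV (H := fun _ => c • 1) (fun y hy => by rw [← h y hy]; rfl) hz, dxt_const]
  have h2 : (dxt F z I • (1 : Grassmann (n + 1))).body = 0 := by
    rw [show dxt F z I • (1 : Grassmann (n + 1)) = 0 from h1]; rfl
  rwa [body_smul, body_one, mul_one] at h2

theorem isEven_dx (hV : IsOpen V) (hF : SmoothOn F V) (h : ∀ y ∈ V, (F y).IsEven) :
    ∀ z ∈ V, (dx F z).IsEven :=
  fun _ hz I hI => dx_apply_eq_zero hV hF (fun y hy => h y hy I hI) hz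

theorem isOdd_dx (hV : IsOpen V) (hF : SmoothOn F V) (h : ∀ y ∈ V, (F y).IsOdd) :
    ∀ z ∈ V, (dx F z).IsOdd :=
  fun _ hz I hI => dx_apply_eq_zero hV hF (fun y hy => h y hy I hI) hz

theorem isEven_dxt (hV : IsOpen V) (hF : SmoothOn F V) (h : ∀ y ∈ V, (F y).IsEven) :
    ∀ z ∈ V, (dxt F z).IsEven :=
  fun _ hz I hI => dxt_apply_eq_zero hV hF (fun y hy => h y hy I hI) hz

theorem isOdd_dxt (hV : IsOpen V) (hF : SmoothOn F V) (h : ∀ y ∈ V, (F y).IsOdd) :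
    ∀ z ∈ V, (dxt F z).IsOdd :=
  fun _ hz I hI => dxt_apply_eq_zero hV hF (fun y hy => h y hy I hI) hz

theorem isEven_iterate_dx (hV : IsOpen V) (hF : SmoothOn F V) (h : ∀ y ∈ V, (F y).IsEven)
    (k : ℕ) : ∀ z ∈ V, (dx^[k] F z).IsEven := by
  induction k with
  | zero => exact h
  | succ k ih =>
    rw [Function.iterate_succ_apply']; exact isEven_dx hV (hF.iterate_dx hV k) ih

theorem isOdd_iterate_dx (hV : IsOpen V) (hF : SmoothOn F V) (h : ∀ y ∈ V, (F y).IsOdd)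
    (k : ℕ) : ∀ z ∈ V, (dx^[k] F z).IsOdd := by
  induction k with
  | zero => exact h
  | succ k ih =>
    rw [Function.iterate_succ_apply']; exact isOdd_dx hV (hF.iterate_dx hV k) ih

/-! ### Evaluation of a superfunction at a point with Grassmann coordinates -/

/-- The nilpotent part. -/
def nil (g : Grassmann (n + 1)) : Grassmann (n + 1) := g - algebraMap ℂ _ g.body

/-- The truncated exponential series `∑ N ^ k X_k / k!`. -/
def tay (N : Grassmann (n + 1)) (X : ℕ → Grassmann (n + 1)) : Grassmann (n + 1) :=
  ∑ k ∈ Finset.range (n + 2), ((k.factorial : ℂ)⁻¹) • (N ^ k * X k)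

/-- The value of the superfunction `F` at `y = g`, `η = ψ`. -/
def ev (F : SuperFun n) (g ψ : Grassmann (n + 1)) : Grassmann (n + 1) :=
  tay (nil g) fun k => (dx^[k] (thetaFree F)) g.body + ψ * (dx^[k] (dtheta F)) g.body

theorem pull_apply (u : SuperMap n) (F : SuperFun n) (x : ℂ) :
    u.pull F x = ev F (u.even x) (u.odd x) := rfl

theorem body_nil (g : Grassmann (n + 1)) : (nil g).body = 0 := by
  rw [nil, body_sub, body_algebraMap, sub_self]

theorem isEven_nil {g : Grassmann (n + 1)} (hg : g.IsEven) : (nil g).IsEven :=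
  hg.sub (isEven_algebraMap _)

/-- The power has degree at least `2(n + 1)`, more than the `n + 1` generators available. For a
non-even element one more factor would be needed. -/
theorem nil_pow {g : Grassmann (n + 1)} (hg : g.IsEven) : nil g ^ (n + 1) = 0 :=
  eq_zero_of_mem_fil (by omega) (pow_mem_fil ((isEven_nil hg).mem_fil_two (body_nil g)) (n + 1))

/-- Differentiating the exponential series in `N` shifts the coefficients. The truncated series
loses its top term, which carries `N ^ (n + 1)` and is zero. -/
theorem tay_shift {N : Grassmann (n + 1)} (hN : N ^ (n + 1) = 0) (X : ℕ → Grassmann (n + 1)) :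
    ∑ k ∈ Finset.range (n + 2), ((k.factorial : ℂ)⁻¹) • ((k : ℂ) • (N ^ (k - 1) * X k)) =
      tay N fun k => X (k + 1) := by
  rw [tay, Finset.sum_range_succ', Finset.sum_range_succ _ (n + 1), hN]
  simp only [Nat.cast_zero, zero_smul, smul_zero, add_zero, zero_mul]
  refine Finset.sum_congr rfl fun k _ => ?_
  rw [smul_smul, Nat.add_sub_cancel, Nat.factorial_succ]
  congr 1
  push_cast
  have : (k + 1 : ℂ) ≠ 0 := by exact_mod_cast Nat.succ_ne_zero k
  field_simp

theorem tay_add (N : Grassmann (n + 1)) (X Y : ℕ → Grassmann (n + 1)) :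
    tay N (fun k => X k + Y k) = tay N X + tay N Y := by
  simp only [tay, mul_add, smul_add, Finset.sum_add_distrib]

theorem iterate_dx_thetaFree_dx (hV : IsOpen V) (hF : SmoothOn F V) (k : ℕ) (hz : z ∈ V) :
    dx^[k] (thetaFree (dx F)) z = dx^[k + 1] (thetaFree F) z := by
  rw [Function.iterate_succ_apply]
  exact iterate_dx_eqOn hV (fun y hy => (dx_thetaFree (hF.differentiableAt hV hy)).symm) k hz

theorem iterate_dx_dtheta_dx (hV : IsOpen V) (hF : SmoothOn F V) (k : ℕ) (hz : z ∈ V) :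
    dx^[k] (dtheta (dx F)) z = dx^[k + 1] (dtheta F) z := by
  rw [Function.iterate_succ_apply]
  exact iterate_dx_eqOn hV (fun y hy => (dx_dtheta (hF.differentiableAt hV hy)).symm) k hz

theorem iterate_dx_dxt (hV : IsOpen V) (hF : SmoothOn F V) (k : ℕ) :
    Set.EqOn (dx^[k] (dxt F)) (dxt (dx^[k] F)) V := by
  induction k with
  | zero => exact fun _ _ => rfl
  | succ k ih =>
    intro z hz
    rw [Function.iterate_succ_apply', Function.iterate_succ_apply', dx_eqOn hV ih hz,
      dx_dxt (hF.iterate_dx hV k) hV hz]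

theorem iterate_dx_thetaFree_dxt (hV : IsOpen V) (hF : SmoothOn F V) (k : ℕ) (hz : z ∈ V) :
    dx^[k] (thetaFree (dxt F)) z = dxt (dx^[k] (thetaFree F)) z := by
  rw [iterate_dx_eqOn hV (F := thetaFree (dxt F)) (H := dxt (thetaFree F))
      (fun y hy => (dxt_thetaFree (hF.differentiableAt hV hy)).symm) k hz,
    iterate_dx_dxt hV hF.thetaFree k hz]

theorem iterate_dx_dtheta_dxt (hV : IsOpen V) (hF : SmoothOn F V) (k : ℕ) (hz : z ∈ V) :
    dx^[k] (dtheta (dxt F)) z = dxt (dx^[k] (dtheta F)) z := by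
  rw [iterate_dx_eqOn hV (F := dtheta (dxt F)) (H := dxt (dtheta F))
      (fun y hy => (dxt_dtheta (hF.differentiableAt hV hy)).symm) k hz,
    iterate_dx_dxt hV hF.dtheta k hz]

theorem thetaFree_dtheta (F : SuperFun n) : thetaFree (dtheta F) = dtheta F :=
  funext fun z => tf_dth (F z)

theorem dtheta_dtheta (F : SuperFun n) : dtheta (dtheta F) = fun _ => 0 :=
  funext fun z => dth_dth (F z)

theorem iterate_dx_zero (k : ℕ) : dx^[k] (fun _ => (0 : Grassmann (n + 1))) = fun _ => 0 := by
  induction k with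
  | zero => rfl
  | succ k ih => rw [Function.iterate_succ_apply', ih]; exact funext fun z => dx_const 0 z

theorem ev_dtheta (F : SuperFun n) (g ψ : Grassmann (n + 1)) :
    ev (dtheta F) g ψ = tay (nil g) fun k => (dx^[k] (dtheta F)) g.body := by
  simp only [ev, thetaFree_dtheta, dtheta_dtheta, iterate_dx_zero, mul_zero, add_zero]

/-- Without nilpotent part only the zeroth Taylor term remains. This supplies the initial values in
the differential equation arguments along rays. -/
theorem ev_algebraMap (F : SuperFun n) (c : ℂ) (ψ : Grassmann (n + 1)) :
    ev F (algebraMap ℂ _ c) ψ = tf (F c) + ψ * dth (F c) := by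
  have : nil (algebraMap ℂ (Grassmann (n + 1)) c) = 0 := by rw [nil, body_algebraMap, sub_self]
  rw [ev, this, tay, Finset.sum_range_succ', body_algebraMap]
  simp [thetaFree_apply, dtheta_apply]

theorem ev_congr (hV : IsOpen V) (h : Set.EqOn F H V) {g : Grassmann (n + 1)} (hg : g.body ∈ V)
    (ψ : Grassmann (n + 1)) : ev F g ψ = ev H g ψ := by
  simp only [ev]
  congr 1
  funext k
  rw [iterate_dx_eqOn hV (fun y hy => ?_) k hg (F := thetaFree F) (H := thetaFree H),
    iterate_dx_eqOn hV (fun y hy => ?_) k hg (F := dtheta F) (H := dtheta H)]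
  · rw [dtheta_apply, dtheta_apply, h hy]
  · rw [thetaFree_apply, thetaFree_apply, h hy]

theorem iterate_dx_add (hV : IsOpen V) (hF : SmoothOn F V) (hH : SmoothOn H V) (k : ℕ) :
    Set.EqOn (dx^[k] fun y => F y + H y) (fun y => dx^[k] F y + dx^[k] H y) V := by
  induction k with
  | zero => exact fun _ _ => rfl
  | succ k ih =>
    intro z hz
    simp only [Function.iterate_succ_apply']
    rw [dx_eqOn hV ih hz, dx_add ((hF.iterate_dx hV k).differentiableAt hV hz)
      ((hH.iterate_dx hV k).differentiableAt hV hz)]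

theorem ev_add (hV : IsOpen V) (hF : SmoothOn F V) (hH : SmoothOn H V) {g : Grassmann (n + 1)}
    (hg : g.body ∈ V) (ψ : Grassmann (n + 1)) :
    ev (fun y => F y + H y) g ψ = ev F g ψ + ev H g ψ := by
  simp only [ev]
  rw [← tay_add]
  congr 1
  funext k
  rw [iterate_dx_eqOn hV (F := thetaFree fun y => F y + H y)
      (H := fun y => thetaFree F y + thetaFree H y)
      (fun y _ => map_add tf (F y) (H y)) k hg,
    iterate_dx_eqOn hV (F := dtheta fun y => F y + H y) (H := fun y => dtheta F y + dtheta H y)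
      (fun y _ => map_add dth (F y) (H y)) k hg,
    iterate_dx_add hV hF.thetaFree hH.thetaFree k hg,
    iterate_dx_add hV hF.dtheta hH.dtheta k hg, mul_add]
  exact add_add_add_comm _ _ _ _

theorem tf_iterate_dx (hV : IsOpen V) (hF : SmoothOn F V) (h : ∀ y ∈ V, tf (F y) = F y) (k : ℕ)
    (hz : z ∈ V) : tf (dx^[k] F z) = dx^[k] F z := by
  induction k generalizing z with
  | zero => exact h z hz
  | succ k ih =>
    rw [Function.iterate_succ_apply', ← dx_thetaFree ((hF.iterate_dx hV k).differentiableAt hV hz)]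
    exact dx_eqOn hV (fun y hy => ih hy) hz

theorem tf_nil (g : Grassmann (n + 1)) : tf (nil g) = nil (tf g) := by
  rw [nil, nil, map_sub, tf_algebraMap, body_tf]

theorem tf_ev (hV : IsOpen V) (hF : SmoothOn F V) {g : Grassmann (n + 1)} (hg : g.body ∈ V)
    (ψ : Grassmann (n + 1)) : tf (ev F g ψ) = ev F (tf g) (tf ψ) := by
  rw [ev, ev, tay, tay, map_sum]
  refine Finset.sum_congr rfl fun k _ => ?_
  rw [map_smul, tf_mul, tf_pow, tf_nil, map_add, tf_mul, body_tf,
    tf_iterate_dx hV hF.thetaFree (fun y _ => tf_tf _) k hg,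
    tf_iterate_dx hV hF.dtheta (fun y _ => tf_dth _) k hg]

theorem body_ev (F : SuperFun n) (g : Grassmann (n + 1)) {ψ : Grassmann (n + 1)} (hψ : ψ.body = 0) :
    (ev F g ψ).body = (F g.body).body := by
  have : ev F g ψ - tf (F g.body) ∈ fil (n + 1) 1 := by
    rw [ev, tay, Finset.sum_range_succ', pow_zero, one_mul, Nat.factorial_zero, Nat.cast_one,
      inv_one, one_smul, Function.iterate_zero_apply, Function.iterate_zero_apply, thetaFree_apply,
      add_sub_assoc, add_sub_cancel_left]
    refine add_mem (sum_mem fun k _ => Submodule.smul_mem _ _ ?_)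
      (mul_mem_fil_left _ (mem_fil_one.2 hψ))
    rw [pow_succ', mul_assoc]
    exact mul_mem_fil_left _ (mem_fil_one.2 (body_nil g))
  have h := mem_fil_one.1 this
  rw [body_sub, body_tf, sub_eq_zero] at h
  exact h

theorem isEven_ev (hV : IsOpen V) (hF : SmoothOn F V) (h : ∀ y ∈ V, (F y).IsEven)
    {g ψ : Grassmann (n + 1)} (hg : g.body ∈ V) (hge : g.IsEven) (hψ : ψ.IsOdd) :
    (ev F g ψ).IsEven := by
  rw [ev, tay]
  exact IsEven.sum fun k _ => (((isEven_nil hge).pow k).mul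
    ((isEven_iterate_dx hV hF.thetaFree (fun y hy => (h y hy).tf) k _ hg).add
      (hψ.mul (isOdd_iterate_dx hV hF.dtheta (fun y hy => (h y hy).dth) k _ hg)))).smul _

theorem isOdd_ev (hV : IsOpen V) (hF : SmoothOn F V) (h : ∀ y ∈ V, (F y).IsOdd)
    {g ψ : Grassmann (n + 1)} (hg : g.body ∈ V) (hge : g.IsEven) (hψ : ψ.IsOdd) :
    (ev F g ψ).IsOdd := by
  rw [ev, tay]
  exact IsOdd.sum fun k _ => (((isEven_nil hge).pow k).mul_isOdd
    ((isOdd_iterate_dx hV hF.thetaFree (fun y hy => (h y hy).tf) k _ hg).add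
      (hψ.mul_isEven (isEven_iterate_dx hV hF.dtheta (fun y hy => (h y hy).dth) k _ hg)))).smul _

/-! ### Smoothness and the chain rule -/

theorem contDiffOn_ev (hV : IsOpen V) (hF : SmoothOn F V) :
    ContDiffOn ℝ ∞ (fun p : Grassmann (n + 1) × Grassmann (n + 1) => ev F p.1 p.2)
      {p | p.1.body ∈ V} := by
  have hb : ContDiffOn ℝ ∞ (fun p : Grassmann (n + 1) × Grassmann (n + 1) => p.1.body)
      {p | p.1.body ∈ V} := contDiffOn_clm (bodyL (n + 1)) contDiff_fst.contDiffOn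
  have hN : ContDiffOn ℝ ∞ (fun p : Grassmann (n + 1) × Grassmann (n + 1) => nil p.1)
      {p | p.1.body ∈ V} :=
    contDiff_fst.contDiffOn.sub ((smoothOn_algebraMap (V := Set.univ)).comp hb fun _ _ => trivial)
  simp only [ev, tay]
  refine ContDiffOn.sum fun k _ => contDiffOn_smul _ (contDiffOn_mul (contDiffOn_pow hN k) ?_)
  exact ((hF.thetaFree.iterate_dx hV k).comp hb fun _ h => h).add
    (contDiffOn_mul contDiff_snd.contDiffOn ((hF.dtheta.iterate_dx hV k).comp hb fun _ h => h))

section Chain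

variable {E : Type*} [NormedAddCommGroup E] [NormedSpace ℝ E]

theorem hasFDerivAt_pow_of_isEven {f : E → Grassmann (n + 1)} {f' : E →L[ℝ] Grassmann (n + 1)}
    {x : E} (hf : HasFDerivAt f f' x) (he : (f x).IsEven) (k : ℕ) :
    HasFDerivAt (fun y => f y ^ k)
      ((k : ℂ) • ((mulL (n + 1)).flip (f x ^ (k - 1)) ∘L f')) x := by
  induction k with
  | zero => simpa using hasFDerivAt_const (1 : Grassmann (n + 1)) x
  | succ k ih =>
    simp only [pow_succ]
    refine (hasFDerivAt_mul ih hf).congr_fderiv ?_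
    ext1 v
    simp only [_root_.add_apply, _root_.smul_apply, ContinuousLinearMap.comp_apply,
      ContinuousLinearMap.flip_apply, mulL_apply, Nat.add_sub_cancel]
    rw [(he.pow k).mul_comm]
    rcases k with _ | k
    · simp
    · simp only [Nat.add_sub_cancel, smul_mul_assoc, mul_assoc, ← pow_succ]
      push_cast
      module

/-- The chain rule in all coordinates. Only the body of `g` enters the conjugate coordinate, so the
`x̃`-derivative is multiplied by a complex number and not by a Grassmann number. -/
theorem exists_hasFDerivAt_ev (hV : IsOpen V) (hF : SmoothOn F V) {g ψ : E → Grassmann (n + 1)}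
    {g' ψ' : E →L[ℝ] Grassmann (n + 1)} {x : E} (hg : HasFDerivAt g g' x)
    (hψ : HasFDerivAt ψ ψ' x) (he : (g x).IsEven) (hx : (g x).body ∈ V) :
    ∃ L : E →L[ℝ] Grassmann (n + 1), HasFDerivAt (fun y => ev F (g y) (ψ y)) L x ∧
      ∀ v, L v = g' v * ev (dx F) (g x) (ψ x) +
        (starRingEnd ℂ) (g' v).body • ev (dxt F) (g x) (ψ x) +
        ψ' v * ev (dtheta F) (g x) (ψ x) := by
  set c := (g x).body with hc
  have hb : HasFDerivAt (fun y => (g y).body) ((bodyL (n + 1)).restrictScalars ℝ ∘L g') x :=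
    ((bodyL (n + 1)).restrictScalars ℝ).hasFDerivAt.comp x hg
  have hN : HasFDerivAt (fun y => nil (g y)) (g' -
      ((ContinuousLinearMap.id ℂ ℂ).smulRight (1 : Grassmann (n + 1))).restrictScalars ℝ ∘L
        ((bodyL (n + 1)).restrictScalars ℝ ∘L g')) x := by
    have := hg.sub ((((ContinuousLinearMap.id ℂ ℂ).smulRight
      (1 : Grassmann (n + 1))).restrictScalars ℝ).hasFDerivAt.comp x hb)
    refine this.congr_of_eventuallyEq (Filter.Eventually.of_forall fun y => ?_)
    simp [nil, Algebra.algebraMap_eq_smul_one]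
  have hcomp : ∀ {K : SuperFun n}, SmoothOn K V → HasFDerivAt (fun y => K ((g y).body))
      (fderiv ℝ K c ∘L ((bodyL (n + 1)).restrictScalars ℝ ∘L g')) x := fun hK =>
    (hK.differentiableAt hV hx).hasFDerivAt.comp x hb
  have hX : ∀ k : ℕ, HasFDerivAt (fun y => dx^[k] (thetaFree F) (g y).body +
      ψ y * dx^[k] (dtheta F) (g y).body) _ x := fun k =>
    (hcomp (hF.thetaFree.iterate_dx hV k)).add (hasFDerivAt_mul hψ
      (hcomp (hF.dtheta.iterate_dx hV k)))
  have hterm : ∀ k : ℕ, HasFDerivAt (fun y => ((k.factorial : ℂ)⁻¹) • (nil (g y) ^ k *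
      (dx^[k] (thetaFree F) (g y).body + ψ y * dx^[k] (dtheta F) (g y).body))) _ x := fun k =>
    (hasFDerivAt_mul (hasFDerivAt_pow_of_isEven hN (isEven_nil he) k) (hX k)).const_smul
        ((k.factorial : ℂ)⁻¹)
  simp only [ev, tay]
  refine ⟨_, HasFDerivAt.fun_sum fun k _ => hterm k, fun v => ?_⟩
  simp only [← tay.eq_1, ← ev.eq_1]
  set N := nil (g x) with hNdef
  have hNe : N.IsEven := isEven_nil he
  have hgv : g' v - (g' v).body • (1 : Grassmann (n + 1)) =
    (g' - ((ContinuousLinearMap.id ℂ ℂ).smulRight (1 : Grassmann (n + 1))).restrictScalars ℝ ∘L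
        ((bodyL (n + 1)).restrictScalars ℝ ∘L g')) v := by
    simp [bodyL_apply]
  rw [_root_.sum_apply]
  simp only [_root_.add_apply, _root_.smul_apply, ContinuousLinearMap.comp_apply,
    ContinuousLinearMap.flip_apply, mulL_apply, ContinuousLinearMap.coe_restrictScalars',
    bodyL_apply, ← hgv, fderiv_eq, ← hc]
  rw [ev_dtheta]
  simp only [ev, ← hc, ← hNdef]
  simp only [iterate_dx_thetaFree_dx hV hF _ hx, iterate_dx_dtheta_dx hV hF _ hx,
    iterate_dx_thetaFree_dxt hV hF _ hx, iterate_dx_dtheta_dxt hV hF _ hx,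
    ← Function.iterate_succ_apply' dx]
  generalize g' v = p
  generalize ψ' v = q
  generalize ψ x = s
  -- The increment of `g` splits in two: its nilpotent part differentiates the powers of `N`, its
  -- body moves the point where the Taylor coefficients are taken. After the shift both give the
  -- same series and recombine.
  have hp : p * tay N (fun k => dx^[k + 1] (thetaFree F) c + s * dx^[k + 1] (dtheta F) c) =
      (p - p.body • 1) * ∑ k ∈ Finset.range (n + 2), ((k.factorial : ℂ)⁻¹) •
        ((k : ℂ) • (N ^ (k - 1) * (dx^[k] (thetaFree F) c + s * dx^[k] (dtheta F) c))) +
      p.body • tay N (fun k => dx^[k + 1] (thetaFree F) c + s * dx^[k + 1] (dtheta F) c) := by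
    rw [tay_shift (nil_pow he) (fun k => dx^[k] (thetaFree F) c + s * dx^[k] (dtheta F) c),
      sub_mul, smul_mul_assoc, one_mul, sub_add_cancel]
  rw [hp, tay, tay, tay, Finset.mul_sum, Finset.mul_sum, Finset.smul_sum, Finset.smul_sum,
    ← Finset.sum_add_distrib, ← Finset.sum_add_distrib, ← Finset.sum_add_distrib]
  refine Finset.sum_congr rfl fun k _ => ?_
  have hq : q * (N ^ k * dx^[k] (dtheta F) c) = N ^ k * (q * dx^[k] (dtheta F) c) := by
    rw [← mul_assoc, ← (hNe.pow k).mul_comm, mul_assoc]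
  simp only [mul_smul_comm, smul_mul_assoc, hq, mul_add, mul_assoc, smul_add]
  module

end Chain

end SuperFun
end
-- Multiplicativity of evaluation, chain rules for pullbacks, compatibility with composition.
noncomputable section

open SuperFun

namespace SuperFun

open Grassmann

variable {n : ℕ} {F H : SuperFun n} {U V : Set ℂ} {z : ℂ}

/-- Along a path with constant body the conjugate coordinate does not move, so the `x̃`-term drops
out. -/
theorem hasDerivAt_ev (hV : IsOpen V) (hF : SmoothOn F V) {g ψ : ℝ → Grassmann (n + 1)}
    {g' ψ' : Grassmann (n + 1)} {t : ℝ} (hg : HasDerivAt g g' t)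
    (hψ : HasDerivAt ψ ψ' t) (he : (g t).IsEven) (hx : (g t).body ∈ V) (hb : g'.body = 0) :
    HasDerivAt (fun y => ev F (g y) (ψ y))
      (g' * ev (dx F) (g t) (ψ t) + ψ' * ev (dtheta F) (g t) (ψ t)) t := by
  obtain ⟨L, hL, h⟩ := exists_hasFDerivAt_ev hV hF hg.hasFDerivAt hψ.hasFDerivAt he hx
  have := hL.hasDerivAt
  rw [h] at this
  simpa [hb] using this

/-- The straight path from the body of `g` to `g`. -/
def ray (g : Grassmann (n + 1)) (t : ℝ) : Grassmann (n + 1) :=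
  algebraMap ℂ _ g.body + t • nil g

theorem ray_one (g : Grassmann (n + 1)) : ray g 1 = g := by
  rw [ray, one_smul, nil, add_sub_cancel]

theorem ray_zero (g : Grassmann (n + 1)) : ray g 0 = algebraMap ℂ _ g.body := by
  rw [ray, zero_smul, add_zero]

theorem body_ray (g : Grassmann (n + 1)) (t : ℝ) : (ray g t).body = g.body := by
  rw [ray, real_smul_eq, body_add, body_algebraMap, body_smul, body_nil, mul_zero, add_zero]

theorem isEven_ray {g : Grassmann (n + 1)} (hg : g.IsEven) (t : ℝ) : (ray g t).IsEven := by
  rw [ray, real_smul_eq]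
  exact (isEven_algebraMap _).add ((isEven_nil hg).smul _)

theorem isOdd_real_smul {ψ : Grassmann (n + 1)} (hψ : ψ.IsOdd) (t : ℝ) : (t • ψ).IsOdd := by
  rw [real_smul_eq]; exact hψ.smul _

theorem hasDerivAt_ray (g : Grassmann (n + 1)) (t : ℝ) : HasDerivAt (ray g) (nil g) t := by
  have := ((hasDerivAt_id t).smul_const (nil g)).const_add
    (algebraMap ℂ (Grassmann (n + 1)) g.body)
  rw [one_smul] at this
  exact this

theorem hasDerivAt_smul_self (ψ : Grassmann (n + 1)) (t : ℝ) :
    HasDerivAt (fun t : ℝ => t • ψ) ψ t := by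
  have := (hasDerivAt_id t).smul_const ψ
  rw [one_smul] at this
  exact this

theorem hasDerivAt_ev_ray (hV : IsOpen V) (hF : SmoothOn F V) {g : Grassmann (n + 1)}
    (hg : g.IsEven) (hb : g.body ∈ V) (ψ : Grassmann (n + 1)) (t : ℝ) :
    HasDerivAt (fun t => ev F (ray g t) (t • ψ))
      (nil g * ev (dx F) (ray g t) (t • ψ) + ψ * ev (dtheta F) (ray g t) (t • ψ)) t :=
  hasDerivAt_ev hV hF (hasDerivAt_ray g t) (hasDerivAt_smul_self ψ t) (isEven_ray hg t)
    (by rwa [body_ray]) (body_nil g)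

theorem hasDerivAt_gmul {m : ℕ} {f g : ℝ → Grassmann m} {f' g' : Grassmann m} {t : ℝ}
    (hf : HasDerivAt f f' t) (hg : HasDerivAt g g' t) :
    HasDerivAt (fun t => f t * g t) (f' * g t + f t * g') t := by
  have := (hasFDerivAt_mul hf.hasFDerivAt hg.hasFDerivAt).hasDerivAt
  simpa [mulL_apply, add_comm] using this

/-- Follow the defect of multiplicativity along the ray from the body to the point. Its derivative
is a combination of defects of the same kind with nilpotent coefficients, so it vanishes degree by
degree. -/
theorem ev_mul_of_parity (hV : IsOpen V) (hF : SmoothOn F V) (hH : SmoothOn H V)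
    (hp : (∀ y ∈ V, (F y).IsEven) ∨ (∀ y ∈ V, (F y).IsOdd))
    {g ψ : Grassmann (n + 1)} (hg : g.IsEven) (hψ : ψ.IsOdd) (hb : g.body ∈ V) :
    ev (fun y => F y * H y) g ψ = ev F g ψ * ev H g ψ := by
  -- All pairs must be treated at once: the system relates a pair to those obtained by
  -- differentiating either factor, and `∂/∂θ` switches the parity of the first one.
  let κ := {p : SuperFun n × SuperFun n // SmoothOn p.1 V ∧ SmoothOn p.2 V ∧
    ((∀ y ∈ V, (p.1 y).IsEven) ∨ (∀ y ∈ V, (p.1 y).IsOdd))}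
  let e : SuperFun n → ℝ → Grassmann (n + 1) := fun F t => ev F (ray g t) (t • ψ)
  let Δ : κ → ℝ → Grassmann (n + 1) := fun p t =>
    e (fun y => p.1.1 y * p.1.2 y) t - e p.1.1 t * e p.1.2 t
  let e' : SuperFun n → ℝ → Grassmann (n + 1) := fun F t => nil g * e (dx F) t + ψ * e (dtheta F) t
  let Δ' : κ → ℝ → Grassmann (n + 1) := fun p t =>
    e' (fun y => p.1.1 y * p.1.2 y) t - (e' p.1.1 t * e p.1.2 t + e p.1.1 t * e' p.1.2 t)
  have he' : ∀ {F : SuperFun n} (t : ℝ), SmoothOn F V → HasDerivAt (e F) (e' F t) t :=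
    fun t hF => hasDerivAt_ev_ray hV hF hg hb ψ t
  have key : ∀ p t, Δ p t = 0 := by
    refine eq_zero_of_hasDerivAt (Δ' := Δ') ?_ ?_ ?_
    · rintro ⟨⟨F, H⟩, hF, hH, hp⟩
      -- At the start of the ray evaluation is the `θ`-free part at the body, which is
      -- multiplicative.
      simp only [Δ, e, ray_zero, zero_smul, ev_algebraMap, tf_mul, zero_mul, add_zero, sub_self]
    · rintro ⟨⟨F, H⟩, hF, hH, hp⟩ t
      exact (he' t (hF.mul hH)).sub (hasDerivAt_gmul (he' t hF) (he' t hH))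
    · rintro k hk ⟨⟨F, H⟩, hF, hH, hp⟩ t
      have hbt : (ray g t).body ∈ V := by rwa [body_ray]
      have hge := isEven_ray hg t
      have hψt := isOdd_real_smul hψ t
      have hx : e (dx fun y => F y * H y) t =
          e (fun y => dx F y * H y) t + e (fun y => F y * dx H y) t := by
        simp only [e]
        rw [← ev_add hV ((hF.dx hV).mul hH) (hF.mul (hH.dx hV)) hbt]
        exact ev_congr hV (fun y hy => dx_mul (hF.differentiableAt hV hy)
          (hH.differentiableAt hV hy)) hbt _
      have hNc : ∀ a, a * nil g = nil g * a := fun a => ((isEven_nil hg).mul_comm a).symm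
      have hN1 : nil g ∈ fil (n + 1) 1 := mem_fil_one.2 (body_nil g)
      have hψ1 : ψ ∈ fil (n + 1) 1 := hψ.mem_fil_one
      rcases hp with hp | hp
      · have h1 := hk ⟨⟨dx F, H⟩, hF.dx hV, hH, Or.inl (isEven_dx hV hF hp)⟩ t
        have h2 := hk ⟨⟨F, dx H⟩, hF, hH.dx hV, Or.inl hp⟩ t
        have h3 := hk ⟨⟨dtheta F, H⟩, hF.dtheta, hH, Or.inr fun y hy => (hp y hy).dth⟩ t
        have h4 := hk ⟨⟨F, dtheta H⟩, hF, hH.dtheta, Or.inl hp⟩ t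
        have hth : e (dtheta fun y => F y * H y) t =
            e (fun y => dtheta F y * H y) t + e (fun y => F y * dtheta H y) t := by
          simp only [e]
          rw [← ev_add hV (hF.dtheta.mul hH) (hF.mul hH.dtheta) hbt]
          exact ev_congr hV (fun y hy => (hp y hy).dth_mul _) hbt _
        have hc : e F t * ψ = ψ * e F t := (isEven_ev hV hF hp hbt hge hψt).mul_comm ψ
        have : Δ' ⟨⟨F, H⟩, hF, hH, Or.inl hp⟩ t = nil g * (Δ ⟨⟨dx F, H⟩, hF.dx hV, hH,
            Or.inl (isEven_dx hV hF hp)⟩ t + Δ ⟨⟨F, dx H⟩, hF, hH.dx hV, Or.inl hp⟩ t) +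
            ψ * (Δ ⟨⟨dtheta F, H⟩, hF.dtheta, hH, Or.inr fun y hy => (hp y hy).dth⟩ t +
              Δ ⟨⟨F, dtheta H⟩, hF, hH.dtheta, Or.inl hp⟩ t) := by
          simp only [Δ', Δ, e', hx, hth]
          simp only [mul_add, add_mul, mul_sub, ← mul_assoc, hNc, hc]
          abel
        rw [this, add_comm k]
        exact add_mem (mul_mem_fil hN1 (add_mem h1 h2)) (mul_mem_fil hψ1 (add_mem h3 h4))
      · have h1 := hk ⟨⟨dx F, H⟩, hF.dx hV, hH, Or.inr (isOdd_dx hV hF hp)⟩ t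
        have h2 := hk ⟨⟨F, dx H⟩, hF, hH.dx hV, Or.inr hp⟩ t
        have h3 := hk ⟨⟨dtheta F, H⟩, hF.dtheta, hH, Or.inl fun y hy => (hp y hy).dth⟩ t
        have h4 := hk ⟨⟨F, dtheta H⟩, hF, hH.dtheta, Or.inr hp⟩ t
        have hth : e (fun y => dtheta F y * H y) t = e (dtheta fun y => F y * H y) t +
            e (fun y => F y * dtheta H y) t := by
          simp only [e]
          rw [← ev_add hV (hF.mul hH).dtheta (hF.mul hH.dtheta) hbt]
          refine ev_congr hV (fun y hy => ?_) hbt _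
          simp only [dtheta_apply, (hp y hy).dth_mul, sub_add_cancel]
        have hc : e F t * ψ = -(ψ * e F t) := (isOdd_ev hV hF hp hbt hge hψt).mul_eq_neg hψ
        have : Δ' ⟨⟨F, H⟩, hF, hH, Or.inr hp⟩ t = nil g * (Δ ⟨⟨dx F, H⟩, hF.dx hV, hH,
            Or.inr (isOdd_dx hV hF hp)⟩ t + Δ ⟨⟨F, dx H⟩, hF, hH.dx hV, Or.inr hp⟩ t) +
            ψ * (Δ ⟨⟨dtheta F, H⟩, hF.dtheta, hH, Or.inl fun y hy => (hp y hy).dth⟩ t -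
              Δ ⟨⟨F, dtheta H⟩, hF, hH.dtheta, Or.inr hp⟩ t) := by
          simp only [Δ', Δ, e', hx, hth]
          simp only [mul_add, add_mul, mul_sub, ← mul_assoc, hNc, hc, neg_mul]
          abel
        rw [this, add_comm k]
        exact add_mem (mul_mem_fil hN1 (add_mem h1 h2)) (mul_mem_fil hψ1 (sub_mem h3 h4))
  have := sub_eq_zero.1 (key ⟨⟨F, H⟩, hF, hH, hp⟩ 1)
  simpa only [e, ray_one, one_smul] using this

end SuperFun

namespace SuperMap

open Grassmann

variable {n : ℕ} {F : SuperFun n} {U V : Set ℂ} {z : ℂ} {u : SuperMap n}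

/-! ### Chain rules for pullbacks -/

theorem IsSmooth.smoothOn_pull (hu : u.IsSmooth U V) (hV : IsOpen V) (hF : SmoothOn F V) :
    SmoothOn (u.pull F) U := by
  have h : ContDiffOn ℝ ∞ (fun x => (u.even x, u.odd x)) U :=
    ContDiffOn.prodMk hu.smooth_even hu.smooth_odd
  have hm : Set.MapsTo (fun x => (u.even x, u.odd x)) U {p | p.1.body ∈ V} :=
    fun _ hx => hu.mapsTo hx
  exact ContDiffOn.congr ((contDiffOn_ev hV hF).comp h hm) fun _ _ => rfl

theorem IsSmooth.mono (hu : u.IsSmooth U V) {U' : Set ℂ} (h : U' ⊆ U) {V' : Set ℂ}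
    (h' : Set.MapsTo u.base U' V') : u.IsSmooth U' V' :=
  ⟨hu.smooth_even.mono h, hu.smooth_odd.mono h, fun x hx => hu.isEven x (h hx),
    fun x hx => hu.isOdd x (h hx), h'⟩

theorem IsSmooth.dx_pull (hu : u.IsSmooth U V) (hU : IsOpen U) (hV : IsOpen V)
    (hF : SmoothOn F V) (hz : z ∈ U) :
    dx (u.pull F) z = dx u.even z * u.pull (dx F) z +
      (starRingEnd ℂ) (dxt u.even z).body • u.pull (dxt F) z +
      dx u.odd z * u.pull (dtheta F) z := by
  obtain ⟨L, hL, h⟩ := exists_hasFDerivAt_ev hV hF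
    (hu.smooth_even.differentiableAt hU hz).hasFDerivAt
    (hu.smooth_odd.differentiableAt hU hz).hasFDerivAt (hu.isEven z hz) (hu.mapsTo hz)
  have hL' : HasFDerivAt (u.pull F) L z := hL
  rw [dx_eq hL', h, h, dx, dxt, dx]
  simp only [← pull_apply, body_smul, body_add, map_mul, map_add, map_one, map_div₀, map_ofNat,
    Complex.conj_I, smul_add, smul_smul, smul_mul_assoc, sub_mul, smul_sub]
  module

theorem IsSmooth.dxt_pull (hu : u.IsSmooth U V) (hU : IsOpen U) (hV : IsOpen V)
    (hF : SmoothOn F V) (hz : z ∈ U) :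
    dxt (u.pull F) z = dxt u.even z * u.pull (dx F) z +
      (starRingEnd ℂ) (dx u.even z).body • u.pull (dxt F) z +
      dxt u.odd z * u.pull (dtheta F) z := by
  obtain ⟨L, hL, h⟩ := exists_hasFDerivAt_ev hV hF
    (hu.smooth_even.differentiableAt hU hz).hasFDerivAt
    (hu.smooth_odd.differentiableAt hU hz).hasFDerivAt (hu.isEven z hz) (hu.mapsTo hz)
  have hL' : HasFDerivAt (u.pull F) L z := hL
  rw [dxt_eq hL', h, h, dx, dxt, dxt]
  simp only [← pull_apply, body_smul, body_sub, map_mul, map_sub, map_one, map_div₀,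
    map_ofNat, Complex.conj_I, smul_add, smul_smul, smul_mul_assoc, add_mul]
  module

theorem dtheta_pull (hV : IsOpen V) (hF : SmoothOn F V) (he : (u.even z).IsEven)
    (ho : (u.odd z).IsOdd) (hz : u.base z ∈ V) :
    dtheta (u.pull F) z = dth (u.even z) * u.pull (dx F) z +
      dth (u.odd z) * u.pull (dtheta F) z := by
  have hz' : (u.even z).body ∈ V := hz
  rw [dtheta_apply, pull_apply, pull_apply, pull_apply, ev_dtheta]
  generalize u.even z = g at *
  generalize u.odd z = ψ at *
  simp only [ev, iterate_dx_thetaFree_dx hV hF _ hz', iterate_dx_dtheta_dx hV hF _ hz']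
  rw [← tay_shift (nil_pow he)
    (fun k => dx^[k] (thetaFree F) g.body + ψ * dx^[k] (dtheta F) g.body), tay, tay, map_sum,
    Finset.mul_sum, Finset.mul_sum, ← Finset.sum_add_distrib]
  refine Finset.sum_congr rfl fun k _ => ?_
  have hN := isEven_nil he
  have hdN : dth (nil g) = dth g := by rw [nil, map_sub, dth_algebraMap, sub_zero]
  have h0 : ∀ {K : SuperFun n}, SmoothOn K V → (∀ y ∈ V, tf (K y) = K y) →
      dth (dx^[k] K g.body) = 0 := fun hK h => by
    rw [← tf_iterate_dx hV hK h k hz', dth_tf]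
  rw [map_smul, (hN.pow k).dth_mul, hN.dth_pow, hdN, map_add, ho.dth_mul,
    h0 hF.thetaFree (fun y _ => tf_tf _), h0 hF.dtheta (fun y _ => tf_dth _), mul_zero, sub_zero,
    zero_add, ← mul_assoc _ (dth ψ), (hN.pow k).mul_comm]
  simp only [smul_mul_assoc, mul_smul_comm, mul_assoc, smul_add]

/-- When the reduced map is holomorphic at the point, no `x̃`-derivative of `F` appears and `D` acts
through the two components of `u` only. -/
theorem IsSmooth.D_pull (hu : u.IsSmooth U V) (hU : IsOpen U) (hV : IsOpen V)
    (hF : SmoothOn F V) (hz : z ∈ U) (hb : (dxt u.even z).body = 0) :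
    D (u.pull F) z = D u.even z * u.pull (dx F) z + D u.odd z * u.pull (dtheta F) z := by
  rw [D, D, D, hu.dx_pull hU hV hF hz, dtheta_pull hV hF (hu.isEven z hz) (hu.isOdd z hz)
    (hu.mapsTo hz), hb, dtheta_apply, dtheta_apply]
  simp only [map_zero, zero_smul, add_zero]
  noncomm_ring

theorem IsSmooth.pull_mul (hu : u.IsSmooth U V) (hV : IsOpen V) (hF : SmoothOn F V)
    {H : SuperFun n} (hH : SmoothOn H V)
    (hp : (∀ y ∈ V, (F y).IsEven) ∨ (∀ y ∈ V, (F y).IsOdd)) (hz : z ∈ U) :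
    u.pull (fun y => F y * H y) z = u.pull F z * u.pull H z :=
  ev_mul_of_parity hV hF hH hp (hu.isEven z hz) (hu.isOdd z hz) (hu.mapsTo hz)

theorem IsSmooth.pull_add (hu : u.IsSmooth U V) (hV : IsOpen V) (hF : SmoothOn F V)
    {H : SuperFun n} (hH : SmoothOn H V) (hz : z ∈ U) :
    u.pull (fun y => F y + H y) z = u.pull F z + u.pull H z :=
  ev_add hV hF hH (hu.mapsTo hz) _

theorem IsHolomorphic.dxt_even (hu : u.IsHolomorphic U V) (hU : IsOpen U) (hz : z ∈ U) :
    dxt u.even z = 0 :=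
  dxt_eq_zero ((hu.holomorphic_even z hz).differentiableAt (hU.mem_nhds hz))

theorem IsHolomorphic.dxt_odd (hu : u.IsHolomorphic U V) (hU : IsOpen U) (hz : z ∈ U) :
    dxt u.odd z = 0 :=
  dxt_eq_zero ((hu.holomorphic_odd z hz).differentiableAt (hU.mem_nhds hz))

/-- The evaluation of a pullback along a holomorphic map. -/
theorem IsHolomorphic.ev_pull (hu : u.IsHolomorphic U V) (hU : IsOpen U) (hV : IsOpen V)
    (hF : SmoothOn F V) {g ψ : Grassmann (n + 1)} (hg : g.IsEven) (hψ : ψ.IsOdd)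
    (hb : g.body ∈ U) : ev (u.pull F) g ψ = ev F (ev u.even g ψ) (ev u.odd g ψ) := by
  have hs : u.IsSmooth U V := hu.toIsSmooth
  let e : SuperFun n → ℝ → Grassmann (n + 1) := fun F t => ev F (ray g t) (t • ψ)
  let e' : SuperFun n → ℝ → Grassmann (n + 1) := fun F t => nil g * e (dx F) t + ψ * e (dtheta F) t
  let c : SuperFun n → ℝ → Grassmann (n + 1) := fun F t => ev F (e u.even t) (e u.odd t)
  let Δ : {F : SuperFun n // SmoothOn F V} → ℝ → Grassmann (n + 1) := fun F t =>
    e (u.pull F.1) t - c F.1 t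
  -- The defect for `F` is driven by the defects for `∂F/∂x` and `∂F/∂θ`, with coefficients of body
  -- zero. Holomorphy of `u` removes the term with `∂F/∂x̃`.
  let Δ' : {F : SuperFun n // SmoothOn F V} → ℝ → Grassmann (n + 1) := fun F t =>
    e' u.even t * Δ ⟨dx F.1, F.2.dx hV⟩ t + e' u.odd t * Δ ⟨dtheta F.1, F.2.dtheta⟩ t
  have hbt : ∀ t, (ray g t).body ∈ U := fun t => by rwa [body_ray]
  have he' : ∀ {F : SuperFun n} (t : ℝ), SmoothOn F U → HasDerivAt (e F) (e' F t) t :=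
    fun t hF => hasDerivAt_ev_ray hU hF hg hb ψ t
  have hN1 : nil g ∈ fil (n + 1) 1 := mem_fil_one.2 (body_nil g)
  have hψ1 : ψ ∈ fil (n + 1) 1 := hψ.mem_fil_one
  have he1 : ∀ F t, e' F t ∈ fil (n + 1) 1 := fun F t =>
    add_mem (mul_mem_fil_left _ hN1) (mul_mem_fil_left _ hψ1)
  have hmul : ∀ {F H : SuperFun n} (t : ℝ), SmoothOn F U → SmoothOn H U →
      ((∀ y ∈ U, (F y).IsEven) ∨ (∀ y ∈ U, (F y).IsOdd)) →
      e (fun y => F y * H y) t = e F t * e H t := fun t hF hH hp =>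
    ev_mul_of_parity hU hF hH hp (isEven_ray hg t) (isOdd_real_smul hψ t) (hbt t)
  have key : ∀ F t, Δ F t = 0 := by
    refine eq_zero_of_hasDerivAt (Δ' := Δ') ?_ ?_ ?_
    · rintro ⟨F, hF⟩
      simp only [Δ, c, e, ray_zero, zero_smul, ev_algebraMap, zero_mul, add_zero]
      rw [pull_apply, tf_ev hV hF (hs.mapsTo hb), sub_self]
    · rintro ⟨F, hF⟩ t
      have hFx := hs.smoothOn_pull hV (hF.dx hV)
      have hFt := hs.smoothOn_pull hV hF.dtheta
      have h1 := he' t (hs.smoothOn_pull hV hF)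
      have h2 := hasDerivAt_ev hV hF (he' t hs.smooth_even) (he' t hs.smooth_odd)
        (isEven_ev hU hs.smooth_even hs.isEven (hbt t) (isEven_ray hg t) (isOdd_real_smul hψ t))
        (by
          simp only [e]
          rw [body_ev _ _ (isOdd_real_smul hψ t).body_eq_zero, body_ray]; exact hs.mapsTo hb)
        (mem_fil_one.1 (he1 _ t))
      refine (h1.sub h2).congr_deriv ?_
      have hx : e (dx (u.pull F)) t = e (dx u.even) t * e (u.pull (dx F)) t +
          e (dx u.odd) t * e (u.pull (dtheta F)) t := by
        rw [← hmul t (hs.smooth_even.dx hU) hFx (Or.inl (isEven_dx hU hs.smooth_even hs.isEven)),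
          ← hmul t (hs.smooth_odd.dx hU) hFt (Or.inr (isOdd_dx hU hs.smooth_odd hs.isOdd))]
        simp only [e]
        rw [← ev_add hU ((hs.smooth_even.dx hU).mul hFx) ((hs.smooth_odd.dx hU).mul hFt) (hbt t)]
        refine ev_congr hU (fun y hy => ?_) (hbt t) _
        rw [hs.dx_pull hU hV hF hy, hu.dxt_even hU hy]
        simp [body_zero]
      have hth : e (dtheta (u.pull F)) t = e (dtheta u.even) t * e (u.pull (dx F)) t +
          e (dtheta u.odd) t * e (u.pull (dtheta F)) t := by
        rw [← hmul t hs.smooth_even.dtheta hFx (Or.inr fun y hy => (hs.isEven y hy).dth),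
          ← hmul t hs.smooth_odd.dtheta hFt (Or.inl fun y hy => (hs.isOdd y hy).dth)]
        simp only [e]
        rw [← ev_add hU (hs.smooth_even.dtheta.mul hFx) (hs.smooth_odd.dtheta.mul hFt) (hbt t)]
        refine ev_congr hU (fun y hy => ?_) (hbt t) _
        rw [dtheta_pull hV hF (hs.isEven y hy) (hs.isOdd y hy) (hs.mapsTo hy)]
        rfl
      simp only [Δ', Δ, e', c, hx, hth]
      simp only [mul_add, add_mul, mul_sub, ← mul_assoc]
      abel
    · rintro k hk ⟨F, hF⟩ t
      rw [add_comm k]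
      exact add_mem (mul_mem_fil (he1 _ t) (hk _ t)) (mul_mem_fil (he1 _ t) (hk _ t))
  have := sub_eq_zero.1 (key ⟨F, hF⟩ 1)
  simpa only [e, c, ray_one, one_smul] using this

end SuperMap
end
-- Transition maps, superconformal maps and vector fields in charts.
noncomputable section

open SuperFun

/-! ## Geometry of the charts -/

namespace SuperRiemannSurface

open Grassmann

variable {ι C : Type*} [TopologicalSpace C] [ChartedSpace ℂ C] (S : SuperRiemannSurface ι C)

theorem isOpen_dom (α : ι) : IsOpen (S.dom α) := (S.chart α).open_target

theorem isOpen_overlap (α β : ι) : IsOpen (S.overlap α β) :=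
  ((S.chart α).symm.trans (S.chart β)).open_source

theorem mem_overlap {α β : ι} {x : ℂ} : x ∈ S.overlap α β ↔
    x ∈ S.dom α ∧ (S.chart α).symm x ∈ (S.chart β).source := by
  simp [overlap, dom]

theorem overlap_subset (α β : ι) : S.overlap α β ⊆ S.dom α := fun _ hx => (S.mem_overlap.1 hx).1

theorem trans_apply (α β : ι) (x : ℂ) : S.trans α β x = S.chart β ((S.chart α).symm x) := rfl

theorem trans_mem {α β : ι} {x : ℂ} (hx : x ∈ S.overlap α β) : S.trans α β x ∈ S.overlap β α := by
  have h := S.mem_overlap.1 hx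
  rw [mem_overlap, trans_apply, dom]
  refine ⟨(S.chart β).map_source h.2, ?_⟩
  rw [(S.chart β).left_inv h.2]
  exact (S.chart α).map_target h.1

theorem differentiableOn_trans [IsManifold 𝓘(ℂ) ω C] (α β : ι) :
    DifferentiableOn ℂ (S.trans α β) (S.overlap α β) := by
  have h := (contDiffGroupoid ω 𝓘(ℂ)).compatible_of_mem_maximalAtlas (S.chart_mem α)
    (S.chart_mem β)
  rw [contDiffGroupoid, mem_groupoid_of_pregroupoid] at h
  have h1 : ContDiffOn ℂ ω (S.trans α β) (S.overlap α β) := by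
    simpa [contDiffPregroupoid, trans, overlap] using h.1
  exact h1.differentiableOn (by simp)

variable {n : ℕ}

theorem rho_base (α β : ι) (x : ℂ) : (S.rho n α β).base x = S.trans α β x :=
  body_algebraMap _

theorem rho_isHolomorphic [IsManifold 𝓘(ℂ) ω C] (α β : ι) :
    (S.rho n α β).IsHolomorphic (S.overlap α β) (S.overlap β α) := by
  have hO := S.isOpen_overlap α β
  have h1 : DifferentiableOn ℂ (S.rho n α β).even (S.overlap α β) := by
    have : DifferentiableOn ℂ (fun x => S.trans α β x • (1 : Grassmann (n + 1)))
      (S.overlap α β) := (S.differentiableOn_trans α β).smul_const _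
    refine this.congr fun x _ => ?_
    exact Algebra.algebraMap_eq_smul_one _
  have h2 : DifferentiableOn ℂ (S.rho n α β).odd (S.overlap α β) :=
    (S.zeta_holomorphic α β).smul_const _
  have hr : ∀ {f : SuperFun n}, DifferentiableOn ℂ f (S.overlap α β) →
      SmoothOn f (S.overlap α β) := fun hf => (hf.contDiffOn hO).restrict_scalars ℝ
  exact ⟨⟨hr h1, hr h2, fun x _ => isEven_algebraMap _, fun x _ => isOdd_theta.smul _,
    fun x hx => by rw [rho_base]; exact S.trans_mem hx⟩, h1, h2⟩

theorem dx_rho_even [IsManifold 𝓘(ℂ) ω C] {α β : ι} {x : ℂ} (hx : x ∈ S.overlap α β) :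
    dx (S.rho n α β).even x = algebraMap ℂ _ (deriv (S.trans α β) x) := by
  have hd := (S.differentiableOn_trans α β x hx).differentiableAt
    ((S.isOpen_overlap α β).mem_nhds hx)
  rw [dx_eq_deriv (((S.rho_isHolomorphic α β).holomorphic_even x hx).differentiableAt
    ((S.isOpen_overlap α β).mem_nhds hx)), Algebra.algebraMap_eq_smul_one]
  have : HasDerivAt (fun y => S.trans α β y • (1 : Grassmann (n + 1)))
    (deriv (S.trans α β) x • 1) x := hd.hasDerivAt.smul_const _
  rw [← this.deriv]
  rfl

end SuperRiemannSurface

namespace SuperFun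

open Grassmann

variable {n : ℕ} {F : SuperFun n} {V : Set ℂ} {z : ℂ}

/-! ### Coordinate functions -/

theorem iterate_dx_const (a : Grassmann (n + 1)) (k : ℕ) :
    dx^[k + 1] (fun _ => a) = fun _ => (0 : Grassmann (n + 1)) := by
  rw [Function.iterate_succ_apply, funext (dx_const a), iterate_dx_zero]

theorem ev_const (a g ψ : Grassmann (n + 1)) : ev (fun _ => a) g ψ = tf a + ψ * dth a := by
  have h1 : thetaFree (fun _ => a) = fun _ => tf a := rfl
  have h2 : dtheta (fun _ => a) = fun _ => dth a := rfl
  rw [ev, tay, Finset.sum_range_succ', h1, h2]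
  simp only [iterate_dx_const]
  simp

theorem ev_theta (g ψ : Grassmann (n + 1)) : ev (fun _ => theta n) g ψ = ψ := by
  rw [ev_const]; simp

theorem dx_algebraMap (z : ℂ) : dx (fun y => algebraMap ℂ (Grassmann (n + 1)) y) z = 1 := by
  have h : HasDerivAt (fun y : ℂ => algebraMap ℂ (Grassmann (n + 1)) y) 1 z := by
    have : HasDerivAt (fun y : ℂ => y • (1 : Grassmann (n + 1))) ((1 : ℂ) • 1) z :=
      (hasDerivAt_id z).smul_const _
    rw [one_smul] at this
    exact this.congr_of_eventuallyEq
      (Filter.Eventually.of_forall fun y => Algebra.algebraMap_eq_smul_one y)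
  rw [dx_eq_deriv h.differentiableAt, h.deriv]

theorem dxt_algebraMap (z : ℂ) : dxt (fun y => algebraMap ℂ (Grassmann (n + 1)) y) z = 0 := by
  have h : DifferentiableAt ℂ (fun y : ℂ => algebraMap ℂ (Grassmann (n + 1)) y) z := by
    have : DifferentiableAt ℂ (fun y : ℂ => y • (1 : Grassmann (n + 1))) z :=
      differentiableAt_id.smul_const _
    exact this.congr_of_eventuallyEq
      (Filter.Eventually.of_forall fun y => Algebra.algebraMap_eq_smul_one y)
  exact dxt_eq_zero h

theorem ev_coord (g ψ : Grassmann (n + 1)) : ev (fun y => algebraMap ℂ _ y) g ψ = g := by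
  have h1 : thetaFree (fun y => algebraMap ℂ (Grassmann (n + 1)) y) = fun y => algebraMap ℂ _ y :=
    funext fun y => tf_algebraMap y
  have h2 : dtheta (fun y => algebraMap ℂ (Grassmann (n + 1)) y) = fun _ => 0 :=
    funext fun y => dth_algebraMap y
  have h3 : ∀ k, dx^[k + 1 + 1] (fun y => algebraMap ℂ (Grassmann (n + 1)) y) = fun _ => 0 := by
    intro k
    rw [Function.iterate_succ_apply, funext dx_algebraMap, iterate_dx_const]
  rw [ev, tay, Finset.sum_range_succ', Finset.sum_range_succ', h1, h2]
  simp only [h3, iterate_dx_zero]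
  simp [dx_algebraMap, nil]

theorem D_theta (z : ℂ) : D (fun _ => theta n) z = 1 := by
  rw [D, dx_const, dtheta_apply, dth_theta, mul_zero, add_zero]

theorem D_coord (z : ℂ) : D (fun y => algebraMap ℂ (Grassmann (n + 1)) y) z = theta n := by
  rw [D, dx_algebraMap, dtheta_apply, dth_algebraMap, zero_add, mul_one]

theorem isEven_D (hV : IsOpen V) (hF : SmoothOn F V) (h : ∀ y ∈ V, (F y).IsOdd) :
    ∀ z ∈ V, (D F z).IsEven := fun z hz =>
  (h z hz).dth.add (isOdd_theta.mul (isOdd_dx hV hF h z hz))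

theorem D_dxt (hV : IsOpen V) (hF : SmoothOn F V) (hz : z ∈ V) : D (dxt F) z = dxt (D F) z := by
  have hd := hF.differentiableAt hV hz
  have hdx := (hF.dx hV).differentiableAt hV hz
  have e : dxt (D F) z = dxt (dtheta F) z + dxt (fun y => theta n * dx F y) z :=
    dxt_add (hF.dtheta.differentiableAt hV hz)
      (((smoothOn_const _).mul (hF.dx hV)).differentiableAt hV hz)
  rw [e, dxt_mul (differentiableAt_const _) hdx, dxt_const, zero_mul, zero_add, dxt_dtheta hd, D,
    dx_dxt hF hV hz]
  rfl

end SuperFun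

namespace SuperMap

open Grassmann

variable {n : ℕ} {U V : Set ℂ} {u : SuperMap n} {F : SuperFun n}

/-! ### Superconformal maps -/

/-- Test the definition on the coordinates: `D θ = 1` forces the factor to be `h = D u.odd`, and `D
x = θ` then gives the equation. -/
theorem IsSuperconformal.D_even (h : u.IsSuperconformal U V) :
    ∀ x ∈ U, D u.even x = D u.odd x * u.odd x := by
  obtain ⟨h, _, _, hF⟩ := h
  have e1 : u.pull (fun _ => theta n) = u.odd := funext fun x => ev_theta _ _
  have e2 : u.pull (fun y => algebraMap ℂ _ y) = u.even := funext fun x => ev_coord _ _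
  have e3 : u.pull (fun _ => 1) = fun _ => 1 := funext fun x => by
    rw [pull_apply, ev_const]; simp
  intro x hx
  have h1 := hF _ (smoothOn_const (theta n)) hx
  have h2 := hF _ smoothOn_algebraMap hx
  simp only [e1, e2, funext D_theta, funext D_coord, e3, mul_one] at h1 h2
  rw [h2, h1]

theorem IsSmooth.pull_D (hu : u.IsSmooth U V) (hV : IsOpen V) (hF : SmoothOn F V) {x : ℂ}
    (hx : x ∈ U) : u.pull (D F) x = u.pull (dtheta F) x + u.odd x * u.pull (dx F) x := by
  have e : D F = fun y => dtheta F y + theta n * dx F y := rfl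
  rw [e, hu.pull_add hV hF.dtheta ((smoothOn_const _).mul (hF.dx hV)) hx,
    hu.pull_mul hV (smoothOn_const _) (hF.dx hV) (Or.inr fun _ _ => isOdd_theta) hx]
  congr 2
  exact ev_theta _ _

theorem IsSmooth.D_pull_of_D_even (hu : u.IsSmooth U V) (hU : IsOpen U) (hV : IsOpen V) {x : ℂ}
    (hx : x ∈ U) (hb : (dxt u.even x).body = 0) (hD : D u.even x = D u.odd x * u.odd x)
    (hF : SmoothOn F V) : D (u.pull F) x = D u.odd x * u.pull (D F) x := by
  rw [hu.D_pull hU hV hF hx hb, hD, hu.pull_D hV hF hx, mul_add, ← mul_assoc]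
  exact add_comm _ _

/-- Converse of `IsSuperconformal.D_even`, with factor `D u.odd`, whose body is that of `∂u.odd/∂θ`.
-/
theorem IsSmooth.isSuperconformal (hu : u.IsSmooth U V) (hU : IsOpen U) (hV : IsOpen V)
    (hb : ∀ x ∈ U, (dxt u.even x).body = 0) (hD : ∀ x ∈ U, D u.even x = D u.odd x * u.odd x)
    (h0 : ∀ x ∈ U, (dth (u.odd x)).body ≠ 0) : u.IsSuperconformal U V := by
  refine ⟨D u.odd, hu.smooth_odd.D hU, fun x hx => ?_, fun F hF x hx =>
    hu.D_pull_of_D_even hU hV hx (hb x hx) (hD x hx) hF⟩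
  rw [D, body_add, body_mul, isOdd_theta.body_eq_zero, zero_mul, add_zero]
  exact h0 x hx

/-! ### Vector fields -/

/-- A vector field acts on pulled back functions through its values on the two components of `u`.
Equalities of fields thereby reduce to linear algebra with the superjacobian. -/
theorem IsSmooth.field_pull (hu : u.IsSmooth U V) (hU : IsOpen U) (hV : IsOpen V)
    (hF : SmoothOn F V) {x : ℂ} (hx : x ∈ U) (hb : (dxt u.even x).body = 0)
    (a b : Grassmann (n + 1)) :
    a * dx (u.pull F) x + b * dtheta (u.pull F) x =
      (a * dx u.even x + b * dtheta u.even x) * u.pull (dx F) x +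
      (a * dx u.odd x + b * dtheta u.odd x) * u.pull (dtheta F) x := by
  rw [hu.dx_pull hU hV hF hx, dtheta_pull hV hF (hu.isEven x hx) (hu.isOdd x hx) (hu.mapsTo hx),
    hb, map_zero, zero_smul, add_zero, dtheta_apply, dtheta_apply]
  noncomm_ring

end SuperMap

namespace Grassmann

variable {m : ℕ}

/-- A superjacobian with body the identity matrix acts injectively on rows. -/
theorem row_eq_zero {P R Q T r s : Grassmann m} (hP : P.body = 1) (hQ : Q.body = 0)
    (hT : T.body = 1) (h1 : r * P + s * R = 0) (h2 : r * Q + s * T = 0) : r = 0 ∧ s = 0 := by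
  have hs : s = -(r * Q * geomInv T) := by
    rw [eq_neg_iff_add_eq_zero, add_comm]
    calc r * Q * geomInv T + s = (r * Q + s * T) * geomInv T := by
          rw [add_mul, mul_assoc s, mul_geomInv hT, mul_one]
      _ = 0 := by rw [h2, zero_mul]
  -- The Schur complement of `T`. The entries do not commute, so elimination replaces determinants.
  have hS : (P - Q * geomInv T * R).body = 1 := by
    rw [body_sub, body_mul, body_mul, hQ, hP]; ring
  have hr : r * (P - Q * geomInv T * R) = 0 := by
    rw [← h1, hs]; noncomm_ring
  have hr0 : r = 0 := by
    rw [← mul_one r, ← mul_geomInv hS, ← mul_assoc, hr, zero_mul]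
  exact ⟨hr0, by rw [hs, hr0]; simp⟩

/-- The first entry of the solution `(a, b)` of `a P + b R = p`, `a Q + b T = q`. -/
def solveFst (P R Q T p q : Grassmann m) : Grassmann m :=
  (p - q * geomInv T * R) * geomInv (P - Q * geomInv T * R)

/-- The second entry of the solution `(a, b)` of `a P + b R = p`, `a Q + b T = q`. -/
def solveSnd (P R Q T p q : Grassmann m) : Grassmann m :=
  (q - solveFst P R Q T p q * Q) * geomInv T

theorem solve_snd {P R Q T p q : Grassmann m} (hT : T.body = 1) :
    solveFst P R Q T p q * Q + solveSnd P R Q T p q * T = q := by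
  rw [solveSnd, mul_assoc _ _ T, geomInv_mul hT, mul_one, add_sub_cancel]

theorem solve_fst {P R Q T p q : Grassmann m} (hP : P.body = 1) (hQ : Q.body = 0) :
    solveFst P R Q T p q * P + solveSnd P R Q T p q * R = p := by
  have hS : (P - Q * geomInv T * R).body = 1 := by
    rw [body_sub, body_mul, body_mul, hQ, hP]; ring
  calc solveFst P R Q T p q * P + solveSnd P R Q T p q * R
      = solveFst P R Q T p q * (P - Q * geomInv T * R) + q * geomInv T * R := by
        rw [solveSnd]; noncomm_ring
    _ = p := by rw [solveFst, mul_assoc, geomInv_mul hS, mul_one, sub_add_cancel]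

end Grassmann
end
-- The vector form of an identification: construction, gluing, superconformality.
noncomputable section

open SuperFun

namespace SuperMap

open Grassmann

variable {n : ℕ} {W : Set ℂ} {u : SuperMap n} {x : ℂ}

/-! ### Maps that are the identity modulo the parameters -/

theorem EqModXi.even_empty (hc : u.EqModXi (ident n) W) (hx : x ∈ W) : u.even x ∅ = x := by
  rw [(modXi_iff.1 (hc x hx).1).1]; exact body_algebraMap x

theorem EqModXi.base_eq (hc : u.EqModXi (ident n) W) (hx : x ∈ W) : u.base x = x :=
  hc.even_empty hx

theorem EqModXi.even_zero (hc : u.EqModXi (ident n) W) (hx : x ∈ W) : u.even x {0} = 0 := by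
  rw [(modXi_iff.1 (hc x hx).1).2]
  change algebraMap ℂ (Grassmann (n + 1)) x {0} = 0
  rw [algebraMap_apply', if_neg (by simp)]

theorem EqModXi.odd_empty (hc : u.EqModXi (ident n) W) (hx : x ∈ W) : u.odd x ∅ = 0 := by
  rw [(modXi_iff.1 (hc x hx).2).1]
  exact (isOdd_theta (n := n)).body_eq_zero

theorem EqModXi.odd_zero (hc : u.EqModXi (ident n) W) (hx : x ∈ W) : u.odd x {0} = 1 := by
  rw [(modXi_iff.1 (hc x hx).2).2]
  simp [ident, theta, gen]

theorem EqModXi.sub_coord_apply (hc : u.EqModXi (ident n) W) {I : Finset (Fin (n + 1))}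
    (hI : I = ∅ ∨ I = {0}) : ∀ y ∈ W, (u.even y - algebraMap ℂ _ y) I = 0 := by
  intro y hy
  rw [Grassmann.sub_apply, sub_eq_zero]
  rcases hI with rfl | rfl
  · rw [hc.even_empty hy, algebraMap_apply', if_pos rfl]
  · rw [hc.even_zero hy, algebraMap_apply', if_neg (by simp)]

theorem EqModXi.dx_even_apply (hc : u.EqModXi (ident n) W) (hW : IsOpen W)
    (hu : SmoothOn u.even W) (hx : x ∈ W) {I : Finset (Fin (n + 1))} (hI : I = ∅ ∨ I = {0}) :
    dx u.even x I = (1 : Grassmann (n + 1)) I := by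
  have h1 := dx_apply_eq_zero hW (hu.sub smoothOn_algebraMap) (hc.sub_coord_apply hI) hx
  have h2 : dx u.even x = dx (fun y => u.even y - algebraMap ℂ _ y) x +
      dx (fun y => algebraMap ℂ _ y) x := by
    rw [← dx_add ((hu.sub smoothOn_algebraMap).differentiableAt hW hx)
      (smoothOn_algebraMap.differentiableAt hW hx)]
    simp only [sub_add_cancel]
  rw [h2, Grassmann.add_apply, h1, dx_algebraMap, zero_add]

theorem EqModXi.dxt_even_apply (hc : u.EqModXi (ident n) W) (hW : IsOpen W)
    (hu : SmoothOn u.even W) (hx : x ∈ W) {I : Finset (Fin (n + 1))} (hI : I = ∅ ∨ I = {0}) :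
    dxt u.even x I = 0 := by
  have h1 := dxt_apply_eq_zero hW (hu.sub smoothOn_algebraMap) (hc.sub_coord_apply hI) hx
  have h2 : dxt u.even x = dxt (fun y => u.even y - algebraMap ℂ _ y) x +
      dxt (fun y => algebraMap ℂ _ y) x := by
    rw [← dxt_add ((hu.sub smoothOn_algebraMap).differentiableAt hW hx)
      (smoothOn_algebraMap.differentiableAt hW hx)]
    simp only [sub_add_cancel]
  rw [h2, Grassmann.add_apply, h1, dxt_algebraMap, zero_add, Grassmann.zero_apply]

theorem EqModXi.body_dx_even (hc : u.EqModXi (ident n) W) (hW : IsOpen W)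
    (hu : SmoothOn u.even W) (hx : x ∈ W) : (dx u.even x).body = 1 :=
  hc.dx_even_apply hW hu hx (Or.inl rfl)

theorem EqModXi.body_dxt_even (hc : u.EqModXi (ident n) W) (hW : IsOpen W)
    (hu : SmoothOn u.even W) (hx : x ∈ W) : (dxt u.even x).body = 0 :=
  hc.dxt_even_apply hW hu hx (Or.inl rfl)

theorem EqModXi.body_dx_odd (hc : u.EqModXi (ident n) W) (hW : IsOpen W)
    (hu : SmoothOn u.odd W) (hx : x ∈ W) : (dx u.odd x).body = 0 :=
  dx_apply_eq_zero hW hu (fun _ hy => hc.odd_empty hy) hx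

theorem EqModXi.body_dtheta_odd (hc : u.EqModXi (ident n) W) (hx : x ∈ W) :
    (dtheta u.odd x).body = 1 := by
  rw [body, dtheta_apply, dth_apply, if_neg (by simp)]
  exact hc.odd_zero hx

theorem EqModXi.body_D_odd (hc : u.EqModXi (ident n) W) (hx : x ∈ W) : (D u.odd x).body = 1 := by
  rw [D, body_add, body_mul, isOdd_theta.body_eq_zero, hc.body_dtheta_odd hx]; ring

/-- The coefficient of `∂/∂x` of the form that measures the failure of `u` to be holomorphic. -/
def beltramiFst (u : SuperMap n) : SuperFun n := fun x =>
  solveFst (dx u.even x) (dtheta u.even x) (dx u.odd x) (dtheta u.odd x) (dxt u.even x)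
    (dxt u.odd x)

/-- The coefficient of `∂/∂θ` of the form that measures the failure of `u` to be holomorphic. -/
def beltramiSnd (u : SuperMap n) : SuperFun n := fun x =>
  solveSnd (dx u.even x) (dtheta u.even x) (dx u.odd x) (dtheta u.odd x) (dxt u.even x)
    (dxt u.odd x)

theorem IsSmooth.smoothOn_beltramiFst {V : Set ℂ} (hu : u.IsSmooth W V) (hW : IsOpen W) :
    SmoothOn u.beltramiFst W := by
  have hT : SmoothOn (fun y => geomInv (dtheta u.odd y)) W :=
    contDiffOn_geomInv hu.smooth_odd.dtheta
  refine (((hu.smooth_even.dxt hW).sub (((hu.smooth_odd.dxt hW).mul hT).mul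
    hu.smooth_even.dtheta))).mul ?_
  exact contDiffOn_geomInv ((hu.smooth_even.dx hW).sub
    (((hu.smooth_odd.dx hW).mul hT).mul hu.smooth_even.dtheta))

theorem IsSmooth.smoothOn_beltramiSnd {V : Set ℂ} (hu : u.IsSmooth W V) (hW : IsOpen W) :
    SmoothOn u.beltramiSnd W := by
  have hT : SmoothOn (fun y => geomInv (dtheta u.odd y)) W :=
    contDiffOn_geomInv hu.smooth_odd.dtheta
  exact ((hu.smooth_odd.dxt hW).sub
    ((hu.smoothOn_beltramiFst hW).mul (hu.smooth_odd.dx hW))).mul hT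

theorem IsSmooth.isEven_beltramiFst {V : Set ℂ} (hu : u.IsSmooth W V) (hW : IsOpen W) :
    ∀ x ∈ W, (u.beltramiFst x).IsEven := by
  intro x hx
  have hT : (geomInv (dtheta u.odd x)).IsEven := (hu.isOdd x hx).dth.geomInv
  have hR : (dtheta u.even x).IsOdd := (hu.isEven x hx).dth
  refine ((isEven_dxt hW hu.smooth_even hu.isEven x hx).sub
    (((isOdd_dxt hW hu.smooth_odd hu.isOdd x hx).mul_isEven hT).mul hR)).mul ?_
  exact ((isEven_dx hW hu.smooth_even hu.isEven x hx).sub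
    (((isOdd_dx hW hu.smooth_odd hu.isOdd x hx).mul_isEven hT).mul hR)).geomInv

theorem IsSmooth.isOdd_beltramiSnd {V : Set ℂ} (hu : u.IsSmooth W V) (hW : IsOpen W) :
    ∀ x ∈ W, (u.beltramiSnd x).IsOdd := by
  intro x hx
  have hT : (geomInv (dtheta u.odd x)).IsEven := (hu.isOdd x hx).dth.geomInv
  exact ((isOdd_dxt hW hu.smooth_odd hu.isOdd x hx).sub
    ((hu.isEven_beltramiFst hW x hx).mul_isOdd
      (isOdd_dx hW hu.smooth_odd hu.isOdd x hx))).mul_isEven hT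

/-- Modulo the parameters `u` is the identity, which does not depend on `x̃`. So the right-hand
sides of the linear system lie in the ideal, and with them its solution. -/
theorem EqModXi.beltrami_modXi {V : Set ℂ} (hc : u.EqModXi (ident n) W) (hu : u.IsSmooth W V)
    (hW : IsOpen W) (hx : x ∈ W) : ModXi (u.beltramiFst x) 0 ∧ ModXi (u.beltramiSnd x) 0 := by
  have h1 : ModXi (dxt u.even x) 0 := modXi_iff.2
    ⟨hc.dxt_even_apply hW hu.smooth_even hx (Or.inl rfl),
      hc.dxt_even_apply hW hu.smooth_even hx (Or.inr rfl)⟩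
  have h2 : ModXi (dxt u.odd x) 0 := modXi_iff.2
    ⟨dxt_apply_eq_zero hW hu.smooth_odd (fun _ hy => hc.odd_empty hy) hx,
      dxt_apply_eq_zero hW hu.smooth_odd (fun _ hy => hc.odd_zero hy) hx⟩
  rw [ModXi, sub_zero] at h1 h2
  rw [ModXi, ModXi, sub_zero, sub_zero]
  have ha : u.beltramiFst x ∈ TwoSidedIdeal.span (Set.range (xi (n := n))) :=
    TwoSidedIdeal.mul_mem_right _ _ _ (sub_mem h1 (TwoSidedIdeal.mul_mem_right _ _ _
      (TwoSidedIdeal.mul_mem_right _ _ _ h2)))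
  exact ⟨ha, TwoSidedIdeal.mul_mem_right _ _ _ (sub_mem h2 (TwoSidedIdeal.mul_mem_right _ _ _ ha))⟩

theorem EqModXi.beltrami_even {V : Set ℂ} (hc : u.EqModXi (ident n) W) (hu : u.IsSmooth W V)
    (hW : IsOpen W) (hx : x ∈ W) :
    u.beltramiFst x * dx u.even x + u.beltramiSnd x * dtheta u.even x = dxt u.even x :=
  solve_fst (hc.body_dx_even hW hu.smooth_even hx) (hc.body_dx_odd hW hu.smooth_odd hx)

theorem EqModXi.beltrami_odd (hc : u.EqModXi (ident n) W) (hx : x ∈ W) :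
    u.beltramiFst x * dx u.odd x + u.beltramiSnd x * dtheta u.odd x = dxt u.odd x :=
  solve_snd (hc.body_dtheta_odd hx)

/-- The transported Dolbeault operator in a chart. -/
theorem EqModXi.dxt_pull_sub {F : SuperFun n} (hc : u.EqModXi (ident n) W) {V : Set ℂ}
    (hu : u.IsSmooth W V) (hW : IsOpen W) (hF : SmoothOn F W) (hx : x ∈ W) :
    dxt (u.pull F) x - (u.beltramiFst x * dx (u.pull F) x +
      u.beltramiSnd x * dtheta (u.pull F) x) = u.pull (dxt F) x := by
  have hu' : u.IsSmooth W W := hu.mono le_rfl fun y hy => by rwa [hc.base_eq hy]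
  rw [hu'.field_pull hW hW hF hx (hc.body_dxt_even hW hu.smooth_even hx),
    hc.beltrami_even hu hW hx, hc.beltrami_odd hx, hu'.dxt_pull hW hW hF hx,
    hc.body_dx_even hW hu.smooth_even hx, map_one, one_smul]
  abel

/-- The parities of `a` and `b` make the second derivatives of `F` cancel, so the bracket is again a
vector field, with coefficients `b - D a` and `-D b`. -/
theorem bracket_D {a b F : SuperFun n} (hW : IsOpen W) (ha : SmoothOn a W) (hb : SmoothOn b W)
    (hF : SmoothOn F W) (hae : ∀ y ∈ W, (a y).IsEven) (hbo : ∀ y ∈ W, (b y).IsOdd) (hx : x ∈ W) :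
    (a x * dx (D F) x + b x * dtheta (D F) x) - D (fun y => a y * dx F y + b y * dtheta F y) x =
      (b x - D a x) * dx F x + -D b x * dtheta F x := by
  have da := ha.differentiableAt hW hx
  have db := hb.differentiableAt hW hx
  have dF := hF.differentiableAt hW hx
  have dFx := (hF.dx hW).differentiableAt hW hx
  have dFt := hF.dtheta.differentiableAt hW hx
  have e1 : dx (D F) x = dth (dx F x) + theta n * dx (dx F) x := by
    have : dx (D F) x = dx (dtheta F) x + dx (fun y => theta n * dx F y) x :=
      dx_add dFt (((smoothOn_const _).mul (hF.dx hW)).differentiableAt hW hx)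
    rw [this, dx_mul (differentiableAt_const _) dFx, dx_const, zero_mul, zero_add, dx_dtheta dF]
  have e2 : dtheta (D F) x = dx F x - theta n * dth (dx F x) := by
    rw [dtheta_apply, D, dtheta_apply, map_add, dth_dth, dth_theta_mul, zero_add]
    exact eq_sub_of_add_eq (tf_add_theta_mul_dth _)
  have e3 : dx (fun y => a y * dx F y + b y * dtheta F y) x =
      (dx a x * dx F x + a x * dx (dx F) x) + (dx b x * dtheta F x + b x * dth (dx F x)) := by
    rw [dx_add (differentiableAt_mul da dFx) (differentiableAt_mul db dFt), dx_mul da dFx,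
      dx_mul db dFt, dx_dtheta dF]
  have e4 : dtheta (fun y => a y * dx F y + b y * dtheta F y) x =
      dth (a x) * dx F x + a x * dth (dx F x) + dth (b x) * dtheta F x := by
    rw [dtheta_apply, map_add, (hae x hx).dth_mul, (hbo x hx).dth_mul, dtheta_apply, dth_dth,
      mul_zero, sub_zero]
  have e5 : a x * theta n = theta n * a x := (hae x hx).mul_comm _
  have e6 : b x * theta n = -(theta n * b x) := (hbo x hx).mul_eq_neg isOdd_theta
  rw [e1, e2, D, e3, e4, D, D, dtheta_apply, dtheta_apply, dtheta_apply]
  simp only [mul_add, add_mul, mul_sub, sub_mul, ← mul_assoc, e5, e6, neg_mul, neg_add]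
  abel

/-- Put `P = ∂/∂x̃ - φ` and `h = D u.odd`. Since `D` commutes with `∂/∂x̃` and `P` kills both
components of `u`, the bracket takes `u.odd` to `-P h` and `u.even` to `-(P h) u.odd`. These are the
values of `c D` for `c = -(P h) / h`, and a field is determined by them. -/
theorem EqModXi.exists_bracket_beltrami (hc : u.EqModXi (ident n) W) {V : Set ℂ}
    (hu : u.IsSmooth W V) (hW : IsOpen W) (hs : ∀ x ∈ W, D u.even x = D u.odd x * u.odd x) :
    ∃ c : SuperFun n, SmoothOn c W ∧ ∀ F : SuperFun n, SmoothOn F W → ∀ x ∈ W,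
      (u.beltramiFst x * dx (D F) x + u.beltramiSnd x * dtheta (D F) x) -
        D (fun y => u.beltramiFst y * dx F y + u.beltramiSnd y * dtheta F y) x = c x * D F x := by
  set a := u.beltramiFst with ha
  set b := u.beltramiSnd with hb
  have sa : SmoothOn a W := hu.smoothOn_beltramiFst hW
  have sb : SmoothOn b W := hu.smoothOn_beltramiSnd hW
  have pa := hu.isEven_beltramiFst hW
  have pb := hu.isOdd_beltramiSnd hW
  set h := D u.odd with hh
  have sh : SmoothOn h W := hu.smooth_odd.D hW
  have ph : ∀ y ∈ W, (h y).IsEven := isEven_D hW hu.smooth_odd hu.isOdd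
  let Ph : SuperFun n := fun y => dxt h y - (a y * dx h y + b y * dtheta h y)
  have sPh : SmoothOn Ph W :=
    (sh.dxt hW).sub ((sa.mul (sh.dx hW)).add (sb.mul sh.dtheta))
  refine ⟨fun y => (0 - Ph y) * geomInv (h y), ((smoothOn_const 0).sub sPh).mul
    (contDiffOn_geomInv sh), fun F hF x hx => ?_⟩
  set c := (0 - Ph x) * geomInv (h x) with hcdef
  have hch : c * h x = -Ph x := by
    rw [hcdef, mul_assoc, geomInv_mul (hc.body_D_odd hx), mul_one, zero_sub]
  rw [bracket_D hW sa sb hF pa pb hx]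
  have b1 := bracket_D hW sa sb hu.smooth_odd pa pb hx
  have b2 := bracket_D hW sa sb hu.smooth_even pa pb hx
  rw [D_eqOn hW (fun y hy => hc.beltrami_odd hy) hx, D_dxt hW hu.smooth_odd hx] at b1
  rw [D_eqOn hW (fun y hy => hc.beltrami_even hu hW hy) hx, D_dxt hW hu.smooth_even hx,
    dx_eqOn hW hs hx, dxt_eqOn hW hs hx, dtheta_apply, hs x hx, (ph x hx).dth_mul,
    dx_mul (sh.differentiableAt hW hx) (hu.smooth_odd.differentiableAt hW hx),
    dxt_mul (sh.differentiableAt hW hx) (hu.smooth_odd.differentiableAt hW hx),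
    ← hc.beltrami_odd hx] at b2
  have hah : a x * h x = h x * a x := (pa x hx).mul_comm _
  have hbh : b x * h x = h x * b x := ((ph x hx).mul_comm _).symm
  have r1 : (b x - D a x) * dx u.odd x + -D b x * dtheta u.odd x = c * h x := by
    rw [← b1, hch]; simp only [Ph]; abel
  have r2 : (b x - D a x) * dx u.even x + -D b x * dtheta u.even x = c * h x * u.odd x := by
    rw [← b2, hch]
    simp only [Ph, mul_add, neg_sub, sub_mul, add_mul, ← mul_assoc, hah, hbh, ← ha, ← hb,
      dtheta_apply]
    abel
  -- `r` and `s` are the coefficients of `[φ, D] - c D`; recall that `c D = c θ ∂_x + c ∂_θ`.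
  obtain ⟨q1, q2⟩ := row_eq_zero (r := b x - D a x - c * theta n) (s := -D b x - c)
    (hc.body_dx_even hW hu.smooth_even hx) (hc.body_dx_odd hW hu.smooth_odd hx)
    (hc.body_dtheta_odd hx) (R := dtheta u.even x)
    (by
      have : c * h x * u.odd x = c * D u.even x := by rw [hs x hx, mul_assoc]
      rw [sub_mul (b x - D a x), sub_mul (-D b x), sub_add_sub_comm, r2, this,
        show D u.even x = dtheta u.even x + theta n * dx u.even x from rfl, mul_add, ← mul_assoc]
      abel)
    (by
      rw [sub_mul (b x - D a x), sub_mul (-D b x), sub_add_sub_comm, r1,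
        show h x = dtheta u.odd x + theta n * dx u.odd x from rfl, mul_add, ← mul_assoc]
      abel)
  change _ = c * (dtheta F x + theta n * dx F x)
  rw [sub_eq_zero.1 q1, sub_eq_zero.1 q2, mul_add, ← mul_assoc]
  exact add_comm _ _

end SuperMap

namespace SmoothIdentification

open Grassmann

variable {ι C : Type*} [TopologicalSpace C] [ChartedSpace ℂ C] [IsManifold 𝓘(ℂ) ω C]
  {S : SuperRiemannSurface ι C} {n : ℕ} {X : Deformation S n}

/-- Used with `w` a component of `u_β` and `v` the same component of `ϑ_{αβ}`. As `v` is
holomorphic, the form of the chart `α` acts on `u_α^* v = ρ^* w` as `∂/∂x̃`; the form of the chart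
`β` does so on `w`, and `ρ` rescales `∂/∂x̃` by the conjugate of `f_{αβ}'`. -/
theorem field_pull_rho (Φ : SmoothIdentification X) {α β : ι} {w v : SuperFun n}
    (hv : SmoothOn v (S.overlap α β)) (hv' : ∀ y ∈ S.overlap α β, dxt v y = 0)
    (h : Set.EqOn ((S.rho n α β).pull w) ((Φ.map α).pull v) (S.overlap α β))
    (hw : SmoothOn w (S.dom β))
    (hβ : ∀ y ∈ S.dom β, (Φ.map β).beltramiFst y * dx w y +
      (Φ.map β).beltramiSnd y * dtheta w y = dxt w y) {x : ℂ} (hx : x ∈ S.overlap α β) :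
    (Φ.map α).beltramiFst x * dx ((S.rho n α β).pull w) x +
      (Φ.map α).beltramiSnd x * dtheta ((S.rho n α β).pull w) x =
    (starRingEnd ℂ) (deriv (S.trans α β) x) • ((S.rho n α β).pull (Φ.map β).beltramiFst x *
      (S.rho n α β).pull (dx w) x + (S.rho n α β).pull (Φ.map β).beltramiSnd x *
      (S.rho n α β).pull (dtheta w) x) := by
  have hO := S.isOpen_overlap α β
  have hO' := S.isOpen_overlap β α
  have hsub := S.overlap_subset α β
  have hsub' := S.overlap_subset β α
  have hr := S.rho_isHolomorphic (n := n) α β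
  have hrs := hr.toIsSmooth
  have hcα : (Φ.map α).EqModXi (SuperMap.ident n) (S.overlap α β) :=
    fun y hy => Φ.central α y (hsub hy)
  have hsα : (Φ.map α).IsSmooth (S.overlap α β) (S.overlap α β) :=
    (Φ.smooth α).mono hsub fun y hy => by rwa [hcα.base_eq hy]
  have k1 := hcα.dxt_pull_sub hsα hO hv hx
  have k2 : (Φ.map α).pull (dxt v) x = 0 := by
    rw [pull_apply, ev_congr hO (H := fun _ => 0) hv' (hsα.mapsTo hx), ev_const]; simp
  rw [k2, sub_eq_zero] at k1
  have sw : SmoothOn w (S.overlap β α) := hw.mono hsub'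
  have sa : SmoothOn (Φ.map β).beltramiFst (S.overlap β α) :=
    ((Φ.smooth β).smoothOn_beltramiFst (S.isOpen_dom β)).mono hsub'
  have sb : SmoothOn (Φ.map β).beltramiSnd (S.overlap β α) :=
    ((Φ.smooth β).smoothOn_beltramiSnd (S.isOpen_dom β)).mono hsub'
  rw [dx_eqOn hO h hx, dtheta_apply, h hx, ← dtheta_apply, ← k1, ← dxt_eqOn hO h hx,
    hrs.dxt_pull hO hO' sw hx, hr.dxt_even hO hx, hr.dxt_odd hO hx, S.dx_rho_even hx,
    body_algebraMap, zero_mul, zero_mul, zero_add, add_zero]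
  congr 1
  rw [← hrs.pull_mul hO' sa (sw.dx hO') (Or.inl fun y hy =>
      (Φ.smooth β).isEven_beltramiFst (S.isOpen_dom β) y (hsub' hy)) hx,
    ← hrs.pull_mul hO' sb sw.dtheta (Or.inr fun y hy =>
      (Φ.smooth β).isOdd_beltramiSnd (S.isOpen_dom β) y (hsub' hy)) hx,
    ← hrs.pull_add hO' (sa.mul (sw.dx hO')) (sb.mul sw.dtheta) hx]
  exact ev_congr hO' (fun y hy => (hβ y (hsub' hy)).symm) (hrs.mapsTo hx) _

/-- The Beltrami form of an identification. -/
def form (Φ : SmoothIdentification X) : VectorForm S n where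
  a α := (Φ.map α).beltramiFst
  b α := (Φ.map α).beltramiSnd
  smooth_a α := (Φ.smooth α).smoothOn_beltramiFst (S.isOpen_dom α)
  smooth_b α := (Φ.smooth α).smoothOn_beltramiSnd (S.isOpen_dom α)
  glue α β F hF x hx := by
    have hO := S.isOpen_overlap α β
    have hO' := S.isOpen_overlap β α
    have hsub' := S.overlap_subset β α
    have hr := S.rho_isHolomorphic (n := n) α β
    have hrs := hr.toIsSmooth
    have hb0 : (dxt (S.rho n α β).even x).body = 0 := by rw [hr.dxt_even hO hx]; rfl
    have sa : SmoothOn (Φ.map β).beltramiFst (S.overlap β α) :=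
      ((Φ.smooth β).smoothOn_beltramiFst (S.isOpen_dom β)).mono hsub'
    have sb : SmoothOn (Φ.map β).beltramiSnd (S.overlap β α) :=
      ((Φ.smooth β).smoothOn_beltramiSnd (S.isOpen_dom β)).mono hsub'
    have hX := X.holomorphic α β
    have he := (Φ.smooth β).smooth_even
    have ho := (Φ.smooth β).smooth_odd
    have g1 := Φ.field_pull_rho hX.smooth_even (fun y hy => hX.dxt_even hO hy) (Φ.glue_even α β)
      he (fun y hy => (Φ.central β).beltrami_even (Φ.smooth β) (S.isOpen_dom β) hy) hx
    have g2 := Φ.field_pull_rho hX.smooth_odd (fun y hy => hX.dxt_odd hO hy) (Φ.glue_odd α β)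
      ho (fun y hy => (Φ.central β).beltrami_odd hy) hx
    rw [hrs.field_pull hO hO' (he.mono hsub') hx hb0, smul_add, ← smul_mul_assoc,
      ← smul_mul_assoc, ← sub_eq_zero, add_sub_add_comm, ← sub_mul, ← sub_mul] at g1
    rw [hrs.field_pull hO hO' (ho.mono hsub') hx hb0, smul_add, ← smul_mul_assoc,
      ← smul_mul_assoc, ← sub_eq_zero, add_sub_add_comm, ← sub_mul, ← sub_mul] at g2
    have hfx : (S.rho n α β).base x ∈ S.dom β := hsub' (hrs.mapsTo hx)
    have hbo : ((S.rho n α β).odd x).body = 0 := (hrs.isOdd x hx).body_eq_zero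
    -- The two fields agree on both components of `u_β` pulled back by `ρ`; the pulled back
    -- superjacobian of `u_β` still has the body required to cancel it.
    obtain ⟨q1, q2⟩ := row_eq_zero
      (by rw [pull_apply, body_ev _ _ hbo]
          exact (Φ.central β).body_dx_even (S.isOpen_dom β) he hfx)
      (by rw [pull_apply, body_ev _ _ hbo]
          exact (Φ.central β).body_dx_odd (S.isOpen_dom β) ho hfx)
      (by rw [pull_apply, body_ev _ _ hbo]
          exact (Φ.central β).body_dtheta_odd hfx) g1 g2
    rw [hrs.field_pull hO hO' hF hx hb0, sub_eq_zero.1 q1, sub_eq_zero.1 q2,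
      hrs.pull_add hO' (sa.mul (hF.dx hO')) (sb.mul hF.dtheta) hx,
      hrs.pull_mul hO' sa (hF.dx hO') (Or.inl fun y hy =>
        (Φ.smooth β).isEven_beltramiFst (S.isOpen_dom β) y (hsub' hy)) hx,
      hrs.pull_mul hO' sb hF.dtheta (Or.inr fun y hy =>
        (Φ.smooth β).isOdd_beltramiSnd (S.isOpen_dom β) y (hsub' hy)) hx, smul_add,
      smul_mul_assoc, smul_mul_assoc]

theorem form_spec (Φ : SmoothIdentification X) : Φ.form.IsEven ∧ Φ.form.VanishesModXi ∧
    (Φ.IsSuperconformal → Φ.form.IsSuperconformal) ∧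
    Φ.IsComplexStructure (perturbedDolbeault Φ.form) := by
  refine ⟨fun α x hx => ⟨(Φ.smooth α).isEven_beltramiFst (S.isOpen_dom α) x hx,
    (Φ.smooth α).isOdd_beltramiSnd (S.isOpen_dom α) x hx⟩,
    fun α x hx => (Φ.central α).beltrami_modXi (Φ.smooth α) (S.isOpen_dom α) hx,
    fun h α => (Φ.central α).exists_bracket_beltrami (Φ.smooth α) (S.isOpen_dom α)
      (h α).D_even, ?_⟩
  intro α V hV hVs F hF x hx
  have hc : (Φ.map α).EqModXi (SuperMap.ident n) V := fun y hy => Φ.central α y (hVs hy)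
  have hs : (Φ.map α).IsSmooth V V :=
    (Φ.smooth α).mono hVs fun y hy => by rwa [hc.base_eq hy]
  exact hc.dxt_pull_sub hs hV hF hx

end SmoothIdentification
end
-- Leading-order affinity of evaluation, and superconformal maps from their values at `θ = 0`.
noncomputable section

open SuperFun

namespace Grassmann

variable {m n : ℕ}

theorem pow_sub_pow_mem_fil {a b : Grassmann m} {k : ℕ} (h : a - b ∈ fil m k) (j : ℕ) :
    a ^ j - b ^ j ∈ fil m k := by
  induction j with
  | zero => simp
  | succ j ih =>
    have e : a ^ (j + 1) - b ^ (j + 1) = a ^ j * (a - b) + (a ^ j - b ^ j) * b := by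
      rw [pow_succ, pow_succ]; noncomm_ring
    rw [e]
    exact add_mem (mul_mem_fil_right _ h) (mul_mem_fil_left _ ih)

/-- From the second power on, every term of the difference has a spare nilpotent factor besides `a -
b`. Hence quadratic and higher Taylor terms do not matter to leading order. -/
theorem pow_sub_pow_mem_fil_succ {a b : Grassmann m} {k : ℕ} (ha : a ∈ fil m 1)
    (hb : b ∈ fil m 1) (h : a - b ∈ fil m k) (j : ℕ) :
    a ^ (j + 2) - b ^ (j + 2) ∈ fil m (k + 1) := by
  have e : a ^ (j + 2) - b ^ (j + 2) =
      a ^ j * (a * (a - b)) + (a ^ (j + 1) - b ^ (j + 1)) * b := by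
    rw [pow_succ, pow_succ, pow_succ b (j + 1)]; noncomm_ring
  rw [e]
  refine add_mem (mul_mem_fil_right _ ?_) (mul_mem_fil (pow_sub_pow_mem_fil h _) hb)
  rw [add_comm]
  exact mul_mem_fil ha h

theorem mul_sub_body_smul_mem_fil {a b : Grassmann m} {k : ℕ} (ha : a ∈ fil m k) :
    a * b - b.body • a ∈ fil m (k + 1) := by
  have e : a * b - b.body • a = a * (b - algebraMap ℂ _ b.body) := by
    rw [mul_sub, Algebra.algebraMap_eq_smul_one, mul_smul_comm, mul_one]
  rw [e]
  exact mul_mem_fil ha (mem_fil_one.2 (by rw [body_sub, body_algebraMap, sub_self]))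

theorem tf_sqrt (a : Grassmann (n + 1)) : tf (sqrt a) = sqrt (tf a) := by
  suffices ∀ k, tf (sqrtAux a k) = sqrtAux (tf a) k from this _
  intro k
  induction k with
  | zero => exact tf_one
  | succ k ih => simp only [sqrtAux, map_add, map_smul, map_sub, tf_mul, ih]

end Grassmann

namespace SuperFun

open Grassmann

variable {n : ℕ}

/-! ### Evaluation is affine to leading order -/

theorem ev_sub_mem_fil (F : SuperFun n) {g g' ψ ψ' : Grassmann (n + 1)} {k : ℕ}
    (hb : g'.body = g.body) (hψ' : ψ'.body = 0)
    (hg : g' - g ∈ fil (n + 1) k) (hd : ψ' - ψ ∈ fil (n + 1) k) :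
    ev F g' ψ' - ev F g ψ - ((dx (thetaFree F) g.body).body • (g' - g) +
      (dtheta F g.body).body • (ψ' - ψ)) ∈ fil (n + 1) (k + 1) := by
  set c := g.body with hc
  have hN : nil g' - nil g = g' - g := by rw [nil, nil, hb]; abel
  have hN1 : nil g ∈ fil (n + 1) 1 := mem_fil_one.2 (body_nil g)
  have hN1' : nil g' ∈ fil (n + 1) 1 := mem_fil_one.2 (body_nil g')
  set X : ℕ → Grassmann (n + 1) := fun k => dx^[k] (thetaFree F) c + ψ * dx^[k] (dtheta F) c with hX
  set X' : ℕ → Grassmann (n + 1) := fun k => dx^[k] (thetaFree F) c + ψ' * dx^[k] (dtheta F) c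
    with hX'
  have hXX : ∀ j, X' j - X j = (ψ' - ψ) * dx^[j] (dtheta F) c := fun j => by
    simp only [hX, hX']; noncomm_ring
  have hXk : ∀ j, X' j - X j ∈ fil (n + 1) k := fun j => by
    rw [hXX]; exact mul_mem_fil_left _ hd
  have hNX : ∀ j, nil g ^ (j + 1) * (X' j.succ - X j.succ) ∈ fil (n + 1) (k + 1) := fun j => by
    rw [pow_succ, mul_assoc, add_comm k]
    exact mul_mem_fil_right _ (mul_mem_fil hN1 (hXk _))
  have e1 : ev F g ψ = tay (nil g) X := rfl
  have e2 : ev F g' ψ' = tay (nil g') X' := by rw [ev, hb]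
  -- The sum over `j` collects the Taylor terms of order at least two; the other two summands are
  -- the errors in replacing the first-order and zeroth-order coefficients by their bodies.
  have key : ev F g' ψ' - ev F g ψ - ((dx (thetaFree F) c).body • (g' - g) +
      (dtheta F c).body • (ψ' - ψ)) =
      ∑ j ∈ Finset.range n, (((j + 2).factorial : ℂ)⁻¹) •
        ((nil g' ^ (j + 2) - nil g ^ (j + 2)) * X' (j + 2) +
          nil g ^ (j + 1 + 1) * (X' (j + 1).succ - X (j + 1).succ)) +
      (((g' - g) * X' 1 - (X' 1).body • (g' - g)) + nil g ^ (0 + 1) * (X' (Nat.succ 0) - X (Nat.succ 0))) +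
      ((ψ' - ψ) * dtheta F c - (dtheta F c).body • (ψ' - ψ)) := by
    have b1 : (X' 1).body = (dx (thetaFree F) c).body := by
      simp only [hX', body_add, body_mul, hψ', zero_mul, add_zero]; rfl
    have h0 : X' 0 - X 0 = (ψ' - ψ) * dtheta F c := hXX 0
    rw [e1, e2, tay, tay, Finset.sum_range_succ', Finset.sum_range_succ', Finset.sum_range_succ',
      Finset.sum_range_succ', b1, ← h0, ← hN]
    have hs : ∑ j ∈ Finset.range n, (((j + 2).factorial : ℂ)⁻¹) •
        ((nil g' ^ (j + 2) - nil g ^ (j + 2)) * X' (j + 2) +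
          nil g ^ (j + 1 + 1) * (X' (j + 1).succ - X (j + 1).succ)) =
        ∑ j ∈ Finset.range n, (((j + 1 + 1).factorial : ℂ)⁻¹) •
          (nil g' ^ (j + 1 + 1) * X' (j + 1 + 1)) -
        ∑ j ∈ Finset.range n, (((j + 1 + 1).factorial : ℂ)⁻¹) •
          (nil g ^ (j + 1 + 1) * X (j + 1 + 1)) := by
      rw [← Finset.sum_sub_distrib]
      refine Finset.sum_congr rfl fun j _ => ?_
      rw [← smul_sub]
      congr 1
      simp only [sub_mul, mul_sub, Nat.succ_eq_add_one]
      abel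
    rw [hs]
    simp only [zero_add, Nat.factorial_one, Nat.factorial_zero, Nat.cast_one, inv_one, one_smul,
      pow_one, pow_zero, one_mul, Nat.succ_eq_add_one, sub_mul, mul_sub]
    abel
  rw [key]
  refine add_mem (add_mem (sum_mem fun j _ => Submodule.smul_mem _ _ (add_mem
    (mul_mem_fil_left _ (pow_sub_pow_mem_fil_succ hN1' hN1 (by rwa [hN]) j)) (hNX _)))
    (add_mem (mul_sub_body_smul_mem_fil hg) (hNX 0))) (mul_sub_body_smul_mem_fil hd)

/-- Compare every point, and the weighted mean, with the base point `(g₀, ψ₀)`. The first-order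
parts cancel because the weights have sum one. -/
theorem ev_affine (F : SuperFun n) {κ : Type*} (t : Finset κ) (w : κ → ℂ) (hw : ∑ i ∈ t, w i = 1)
    {g ψ : κ → Grassmann (n + 1)} {g₀ ψ₀ : Grassmann (n + 1)} {k : ℕ}
    (hb : ∀ i ∈ t, (g i).body = g₀.body) (hψ : ∀ i ∈ t, (ψ i).body = 0)
    (hg : ∀ i ∈ t, g i - g₀ ∈ fil (n + 1) k) (hd : ∀ i ∈ t, ψ i - ψ₀ ∈ fil (n + 1) k) :
    ∑ i ∈ t, w i • ev F (g i) (ψ i) - ev F (∑ i ∈ t, w i • g i) (∑ i ∈ t, w i • ψ i) ∈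
      fil (n + 1) (k + 1) := by
  have hsum : ∀ (f : κ → Grassmann (n + 1)) (a : Grassmann (n + 1)),
      ∑ i ∈ t, w i • f i - a = ∑ i ∈ t, w i • (f i - a) := fun f a => by
    simp only [smul_sub, Finset.sum_sub_distrib, ← Finset.sum_smul, hw, one_smul]
  have hbsum : ∀ f : κ → Grassmann (n + 1),
      (∑ i ∈ t, w i • f i).body = ∑ i ∈ t, w i * (f i).body := fun f => by
    rw [body, Grassmann.sum_apply]; rfl
  have m1 : (∑ i ∈ t, w i • g i).body = g₀.body := by
    rw [hbsum, Finset.sum_congr rfl fun i hi => by rw [hb i hi], ← Finset.sum_mul, hw, one_mul]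
  have m2 : (∑ i ∈ t, w i • ψ i).body = 0 := by
    rw [hbsum]; exact Finset.sum_eq_zero fun i hi => by rw [hψ i hi, mul_zero]
  have m3 : ∑ i ∈ t, w i • g i - g₀ ∈ fil (n + 1) k := by
    rw [hsum]; exact sum_mem fun i hi => Submodule.smul_mem _ _ (hg i hi)
  have m4 : ∑ i ∈ t, w i • ψ i - ψ₀ ∈ fil (n + 1) k := by
    rw [hsum]; exact sum_mem fun i hi => Submodule.smul_mem _ _ (hd i hi)
  have H := ev_sub_mem_fil F m1 m2 m3 m4
  have H' := sum_mem (t := t) fun i hi => Submodule.smul_mem _ (w i)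
    (ev_sub_mem_fil F (hb i hi) (hψ i hi) (hg i hi) (hd i hi))
  have key : ∀ p q : ℂ, ∑ i ∈ t, w i • (ev F (g i) (ψ i) - ev F g₀ ψ₀ -
      (p • (g i - g₀) + q • (ψ i - ψ₀))) = (∑ i ∈ t, w i • ev F (g i) (ψ i) - ev F g₀ ψ₀) -
      (p • (∑ i ∈ t, w i • g i - g₀) + q • (∑ i ∈ t, w i • ψ i - ψ₀)) := fun p q => by
    have he : ∑ i ∈ t, w i • ev F (g i) (ψ i) - ev F g₀ ψ₀ =
      ∑ i ∈ t, w i • (ev F (g i) (ψ i) - ev F g₀ ψ₀) := hsum _ _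
    rw [hsum g g₀, hsum ψ ψ₀, he, Finset.smul_sum, Finset.smul_sum, ← Finset.sum_add_distrib,
      ← Finset.sum_sub_distrib]
    refine Finset.sum_congr rfl fun i _ => ?_
    module
  rw [key] at H'
  have e := sub_mem H' H
  rwa [sub_sub_sub_cancel_right, sub_sub_sub_cancel_right] at e

/-! ### Superconformal maps are determined by their values at `θ = 0` -/

theorem dth_even_eq {W₀ W₁ : SuperFun n} {x : ℂ} (hD : D W₀ x = D W₁ x * W₁ x) :
    dth (W₀ x) = dth (W₁ x) * tf (W₁ x) := by
  have h := congrArg tf hD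
  simpa only [D, map_add, tf_mul, tf_theta_mul, add_zero, dtheta_apply, tf_dth, tf_theta, zero_mul]
    using h

/-- The `θ`-coefficient of the superconformal equation; its `θ`-free part is `dth_even_eq`. Together
they express `λ²` and the `θ`-part of `W₀` through the values at `θ = 0` and `λ`. -/
theorem dth_odd_mul_self {O : Set ℂ} (hO : IsOpen O) {W₀ W₁ : SuperFun n} (h₀ : SmoothOn W₀ O)
    (h₁ : SmoothOn W₁ O) (ho : ∀ y ∈ O, (W₁ y).IsOdd) {x : ℂ} (hx : x ∈ O)
    (hD : D W₀ x = D W₁ x * W₁ x) :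
    dth (W₁ x) * dth (W₁ x) =
      dx (thetaFree W₀) x - dx (thetaFree W₁) x * tf (W₁ x) := by
  have h := congrArg (fun a => tf (dth a)) hD
  simp only [(isEven_D hO h₁ ho x hx).dth_mul] at h
  simp only [D, map_add, tf_mul, dtheta_apply, tf_dth, dth_dth, dth_theta_mul, tf_theta,
    zero_mul, zero_add, add_zero, tf_tf] at h
  rw [dx_thetaFree (h₀.differentiableAt hO hx), dx_thetaFree (h₁.differentiableAt hO hx), h,
    add_sub_cancel_left]

/-- The values at `θ = 0` fix the square of the `θ`-coefficient of the odd component, its body fixes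
the root, and the remaining coefficient follows. -/
theorem eqOn_of_thetaFree_eq {O : Set ℂ} (hO : IsOpen O) {W₀ W₁ Z₀ Z₁ : SuperFun n}
    (hW₀ : SmoothOn W₀ O) (hW₁ : SmoothOn W₁ O) (hZ₀ : SmoothOn Z₀ O) (hZ₁ : SmoothOn Z₁ O)
    (hWo : ∀ y ∈ O, (W₁ y).IsOdd) (hZo : ∀ y ∈ O, (Z₁ y).IsOdd)
    (hWD : ∀ y ∈ O, D W₀ y = D W₁ y * W₁ y) (hZD : ∀ y ∈ O, D Z₀ y = D Z₁ y * Z₁ y)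
    (h₀ : ∀ y ∈ O, tf (W₀ y) = tf (Z₀ y)) (h₁ : ∀ y ∈ O, tf (W₁ y) = tf (Z₁ y))
    (hb : ∀ y ∈ O, (dth (W₁ y)).body = (dth (Z₁ y)).body)
    (hb0 : ∀ y ∈ O, (dth (W₁ y)).body ≠ 0) : Set.EqOn W₀ Z₀ O ∧ Set.EqOn W₁ Z₁ O := by
  have hl : ∀ y ∈ O, dth (W₁ y) = dth (Z₁ y) := fun y hy => by
    refine (hWo y hy).dth.eq_of_mul_self_eq ?_ (hb y hy) (hb0 y hy)
    rw [dth_odd_mul_self hO hW₀ hW₁ hWo hy (hWD y hy),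
      dth_odd_mul_self hO hZ₀ hZ₁ hZo hy (hZD y hy), h₁ y hy,
      dx_eqOn hO (F := thetaFree W₀) (H := thetaFree Z₀) h₀ hy,
      dx_eqOn hO (F := thetaFree W₁) (H := thetaFree Z₁) h₁ hy]
  refine ⟨fun y hy => ?_, fun y hy => ?_⟩
  · rw [← tf_add_theta_mul_dth (W₀ y), ← tf_add_theta_mul_dth (Z₀ y), h₀ y hy,
      dth_even_eq (hWD y hy), dth_even_eq (hZD y hy), hl y hy, h₁ y hy]
  · rw [← tf_add_theta_mul_dth (W₁ y), ← tf_add_theta_mul_dth (Z₁ y), h₁ y hy, hl y hy]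

end SuperFun

namespace SuperFun

open Grassmann

theorem modXi_iff_body {n : ℕ} {a b : Grassmann (n + 1)} :
    ModXi a b ↔ (tf a).body = (tf b).body ∧ (dth a).body = (dth b).body := by
  rw [body_tf, body_tf]
  exact modXi_iff

end SuperFun

namespace SuperMap

open Grassmann

variable {n : ℕ} {U V : Set ℂ} {u : SuperMap n}

/-- Superconformality is stable under composition. Both sides of the gluing condition thus satisfy
the equation to which `eqOn_of_thetaFree_eq` applies. -/
theorem IsSmooth.D_pull_even_eq (hu : u.IsSmooth U V) (hU : IsOpen U) (hV : IsOpen V) {x : ℂ}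
    (hx : x ∈ U) (hb : (dxt u.even x).body = 0) (hD : D u.even x = D u.odd x * u.odd x)
    {W₀ W₁ : SuperFun n} (h₀ : SmoothOn W₀ V) (h₁ : SmoothOn W₁ V) (ho : ∀ y ∈ V, (W₁ y).IsOdd)
    (hWD : ∀ y ∈ V, D W₀ y = D W₁ y * W₁ y) :
    D (u.pull W₀) x = D (u.pull W₁) x * u.pull W₁ x := by
  rw [hu.D_pull_of_D_even hU hV hx hb hD h₀, hu.D_pull_of_D_even hU hV hx hb hD h₁, mul_assoc,
    ← hu.pull_mul hV (h₁.D hV) h₁ (Or.inl (isEven_D hV h₁ ho)) hx]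
  congr 1
  exact ev_congr hV hWD (hu.mapsTo hx) _

/-- The superconformal map that is the identity modulo the parameters and restricts to `(g, ψ)`
at `θ = 0`. -/
def ofSection (g ψ : SuperFun n) : SuperMap n where
  even := fun x => g x + theta n * (sqrt (dx g x - dx ψ x * ψ x) * ψ x)
  odd := fun x => ψ x + theta n * sqrt (dx g x - dx ψ x * ψ x)

/-- A smooth family of points over `W`, with coordinates in the algebra of the parameters, that
lifts the points of `W`. -/
structure IsSection (g ψ : SuperFun n) (W : Set ℂ) : Prop where
  smooth_even : SmoothOn g W
  smooth_odd : SmoothOn ψ W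
  isEven : ∀ x ∈ W, (g x).IsEven
  isOdd : ∀ x ∈ W, (ψ x).IsOdd
  tf_even : ∀ x ∈ W, tf (g x) = g x
  tf_odd : ∀ x ∈ W, tf (ψ x) = ψ x
  body_eq : ∀ x ∈ W, (g x).body = x

namespace IsSection

variable {g ψ : SuperFun n} {W : Set ℂ} {x : ℂ}

theorem body_dx (h : IsSection g ψ W) (hW : IsOpen W) (hx : x ∈ W) : (dx g x).body = 1 := by
  -- Only the even component matters here; paired with `θ` it becomes the identity modulo the
  -- parameters.
  have hc : SuperMap.EqModXi ⟨g, fun _ => theta n⟩ (ident n) W := fun y hy => by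
    refine ⟨modXi_iff.2 ⟨(h.body_eq y hy).trans (body_algebraMap y).symm, ?_⟩,
      modXi_iff.2 ⟨rfl, rfl⟩⟩
    change g y {0} = algebraMap ℂ (Grassmann (n + 1)) y {0}
    rw [← h.tf_even y hy, tf_apply, if_pos (by simp), algebraMap_apply', if_neg (by simp)]
  exact hc.body_dx_even hW h.smooth_even hx

theorem body_disc (h : IsSection g ψ W) (hW : IsOpen W) (hx : x ∈ W) :
    (dx g x - dx ψ x * ψ x).body = 1 := by
  rw [body_sub, body_mul, (h.isOdd x hx).body_eq_zero, h.body_dx hW hx, mul_zero, sub_zero]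

theorem isEven_disc (h : IsSection g ψ W) (hW : IsOpen W) (hx : x ∈ W) :
    (dx g x - dx ψ x * ψ x).IsEven :=
  (isEven_dx hW h.smooth_even h.isEven x hx).sub
    ((isOdd_dx hW h.smooth_odd h.isOdd x hx).mul (h.isOdd x hx))

theorem tf_disc (h : IsSection g ψ W) (hW : IsOpen W) (hx : x ∈ W) :
    tf (sqrt (dx g x - dx ψ x * ψ x)) = sqrt (dx g x - dx ψ x * ψ x) := by
  rw [tf_sqrt, map_sub, tf_mul, h.tf_odd x hx,
    ← dx_thetaFree (h.smooth_even.differentiableAt hW hx),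
    ← dx_thetaFree (h.smooth_odd.differentiableAt hW hx),
    dx_eqOn hW (F := thetaFree g) (H := g) h.tf_even hx,
    dx_eqOn hW (F := thetaFree ψ) (H := ψ) h.tf_odd hx]

theorem smooth_sqrt (h : IsSection g ψ W) (hW : IsOpen W) :
    SmoothOn (fun x => sqrt (dx g x - dx ψ x * ψ x)) W :=
  contDiffOn_sqrt ((h.smooth_even.dx hW).sub ((h.smooth_odd.dx hW).mul h.smooth_odd))

theorem tf_ofSection_even (h : IsSection g ψ W) (hx : x ∈ W) :
    tf ((ofSection g ψ).even x) = g x := by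
  simp only [ofSection, map_add, tf_theta_mul, add_zero, h.tf_even x hx]

theorem tf_ofSection_odd (h : IsSection g ψ W) (hx : x ∈ W) :
    tf ((ofSection g ψ).odd x) = ψ x := by
  simp only [ofSection, map_add, tf_theta_mul, add_zero, h.tf_odd x hx]

theorem dth_ofSection_even (h : IsSection g ψ W) (hW : IsOpen W) (hx : x ∈ W) :
    dth ((ofSection g ψ).even x) = sqrt (dx g x - dx ψ x * ψ x) * ψ x :=
  dth_add_theta_mul (h.tf_even x hx) (by rw [tf_mul, h.tf_disc hW hx, h.tf_odd x hx])

theorem dth_ofSection_odd (h : IsSection g ψ W) (hW : IsOpen W) (hx : x ∈ W) :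
    dth ((ofSection g ψ).odd x) = sqrt (dx g x - dx ψ x * ψ x) :=
  dth_add_theta_mul (h.tf_odd x hx) (h.tf_disc hW hx)

theorem body_sqrt_disc (h : IsSection g ψ W) (hW : IsOpen W) (hx : x ∈ W) :
    (sqrt (dx g x - dx ψ x * ψ x)).body = 1 := body_sqrtAux (h.body_disc hW hx) _

theorem isSmooth_ofSection (h : IsSection g ψ W) (hW : IsOpen W) :
    (ofSection g ψ).IsSmooth W W where
  smooth_even := h.smooth_even.add
    ((smoothOn_const _).mul ((h.smooth_sqrt hW).mul h.smooth_odd))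
  smooth_odd := h.smooth_odd.add ((smoothOn_const _).mul (h.smooth_sqrt hW))
  isEven x hx := (h.isEven x hx).add (isOdd_theta.mul
    (((h.isEven_disc hW hx).sqrtAux _).mul_isOdd (h.isOdd x hx)))
  isOdd x hx := (h.isOdd x hx).add (isOdd_theta.mul_isEven ((h.isEven_disc hW hx).sqrtAux _))
  mapsTo x hx := by
    rw [base, ← body_tf, h.tf_ofSection_even hx, h.body_eq x hx]; exact hx

theorem eqModXi_ofSection (h : IsSection g ψ W) (hW : IsOpen W) :
    (ofSection g ψ).EqModXi (ident n) W := by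
  intro x hx
  refine ⟨modXi_iff_body.2 ⟨?_, ?_⟩, modXi_iff_body.2 ⟨?_, ?_⟩⟩
  · rw [h.tf_ofSection_even hx, h.body_eq x hx, body_tf]; exact (body_algebraMap x).symm
  · rw [h.dth_ofSection_even hW hx, body_mul, (h.isOdd x hx).body_eq_zero, mul_zero]
    simp only [ident, dth_algebraMap]; rfl
  · rw [h.tf_ofSection_odd hx, (h.isOdd x hx).body_eq_zero]
    simp only [ident, tf_theta]; rfl
  · rw [h.dth_ofSection_odd hW hx, h.body_sqrt_disc hW hx]
    simp only [ident, dth_theta]; rfl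

/-- Both sides equal `l ψ + θ ∂g`: in `(l + θ ∂ψ)(ψ + θ l)` the last product contains `θ` twice, and
`l² + (∂ψ) ψ = ∂g`. -/
theorem D_ofSection (h : IsSection g ψ W) (hW : IsOpen W) (hx : x ∈ W) :
    D (ofSection g ψ).even x = D (ofSection g ψ).odd x * (ofSection g ψ).odd x := by
  have hθθ : theta n * theta n = 0 := isOdd_theta.mul_self
  have dl := (h.smooth_sqrt hW).differentiableAt hW hx
  have dψ := h.smooth_odd.differentiableAt hW hx
  have dg := h.smooth_even.differentiableAt hW hx
  have hθ : ∀ {K : SuperFun n}, DifferentiableAt ℝ K x →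
      DifferentiableAt ℝ (fun y => theta n * K y) x := fun hK =>
    differentiableAt_mul (differentiableAt_const _) hK
  have k : ∀ {K : SuperFun n}, DifferentiableAt ℝ K x →
      theta n * dx (fun y => theta n * K y) x = 0 := fun hK => by
    rw [dx_mul (differentiableAt_const _) hK, dx_const, zero_mul, zero_add, ← mul_assoc, hθθ,
      zero_mul]
  set l := sqrt (dx g x - dx ψ x * ψ x) with hl
  have e1 : D (ofSection g ψ).even x = l * ψ x + theta n * dx g x := by
    rw [D, dtheta_apply, h.dth_ofSection_even hW hx]
    have := dx_add dg (hθ (differentiableAt_mul dl dψ))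
    rw [ofSection, this, mul_add, k (differentiableAt_mul dl dψ), add_zero]
  have e2 : D (ofSection g ψ).odd x = l + theta n * dx ψ x := by
    rw [D, dtheta_apply, h.dth_ofSection_odd hW hx]
    have := dx_add dψ (hθ dl)
    rw [ofSection, this, mul_add, k dl, add_zero]
  have e3 : (ofSection g ψ).odd x = ψ x + theta n * l := rfl
  have hle : l.IsEven := (h.isEven_disc hW hx).sqrtAux _
  have hll : l * l = dx g x - dx ψ x * ψ x := sqrt_mul_self (h.body_disc hW hx)
  have e4 : dx g x = l * l + dx ψ x * ψ x := by rw [hll, sub_add_cancel]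
  have e5 : dx ψ x * theta n = -(theta n * dx ψ x) :=
    (isOdd_dx hW h.smooth_odd h.isOdd x hx).mul_eq_neg isOdd_theta
  have e6 : theta n * dx ψ x * (theta n * l) = 0 := by
    rw [mul_assoc, ← mul_assoc (dx ψ x), e5, neg_mul, mul_neg, ← mul_assoc, ← mul_assoc, hθθ,
      zero_mul, zero_mul, neg_zero]
  have e7 : l * (theta n * l) = theta n * (l * l) := by
    rw [← mul_assoc, hle.mul_comm, mul_assoc]
  rw [e1, e2, e3, e4, add_mul, mul_add l, mul_add (theta n * dx ψ x), e6, e7, mul_add (theta n),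
    add_zero, add_assoc, mul_assoc (theta n) (dx ψ x)]

end IsSection

end SuperMap
end
-- Existence of a superconformal identification by partitions of unity.
noncomputable section

open SuperFun

/-! ## The underlying smooth surface -/

theorem contDiffGroupoid_complex_le_real :
    contDiffGroupoid ω 𝓘(ℂ) ≤ contDiffGroupoid ∞ 𝓘(ℝ, ℂ) := by
  intro e he
  change e ∈ contDiffGroupoid ω 𝓘(ℂ) at he
  change e ∈ contDiffGroupoid ∞ 𝓘(ℝ, ℂ)
  rw [contDiffGroupoid, mem_groupoid_of_pregroupoid] at he ⊢
  have h1 : ContDiffOn ℂ ω e e.source := by simpa [contDiffPregroupoid] using he.1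
  have h2 : ContDiffOn ℂ ω e.symm e.target := by simpa [contDiffPregroupoid] using he.2
  have h3 : ContDiffOn ℝ ∞ e e.source := (h1.restrict_scalars ℝ).of_le le_top
  have h4 : ContDiffOn ℝ ∞ e.symm e.target := (h2.restrict_scalars ℝ).of_le le_top
  constructor
  · simpa [contDiffPregroupoid] using h3
  · simpa [contDiffPregroupoid] using h4

theorem isManifold_real_of_complex (C : Type*) [TopologicalSpace C] [ChartedSpace ℂ C]
    [IsManifold 𝓘(ℂ) ω C] : IsManifold 𝓘(ℝ, ℂ) ∞ C := by
  have : HasGroupoid C (contDiffGroupoid ∞ 𝓘(ℝ, ℂ)) :=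
    ⟨fun he he' => contDiffGroupoid_complex_le_real
      (HasGroupoid.compatible (G := contDiffGroupoid ω 𝓘(ℂ)) he he')⟩
  exact IsManifold.mk' 𝓘(ℝ, ℂ) ∞ C

theorem mem_maximalAtlas_real {C : Type*} [TopologicalSpace C] [ChartedSpace ℂ C]
    {e : OpenPartialHomeomorph C ℂ} (he : e ∈ IsManifold.maximalAtlas 𝓘(ℂ) ω C) :
    e ∈ IsManifold.maximalAtlas 𝓘(ℝ, ℂ) ∞ C := by
  rw [IsManifold.maximalAtlas, mem_maximalAtlas_iff] at he ⊢
  exact fun e' he' => ⟨contDiffGroupoid_complex_le_real (he e' he').1,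
    contDiffGroupoid_complex_le_real (he e' he').2⟩

namespace SuperRiemannSurface

open Grassmann

variable {ι C : Type*} [TopologicalSpace C] [ChartedSpace ℂ C] (S : SuperRiemannSurface ι C)

theorem chart_mem_overlap {α β : ι} {p : C} (hα : p ∈ (S.chart α).source)
    (hβ : p ∈ (S.chart β).source) : S.chart α p ∈ S.overlap α β := by
  rw [mem_overlap, (S.chart α).left_inv hα]
  exact ⟨(S.chart α).map_source hα, hβ⟩

theorem trans_chart {α β : ι} {p : C} (hα : p ∈ (S.chart α).source) :
    S.trans α β (S.chart α p) = S.chart β p := by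
  rw [trans_apply, (S.chart α).left_inv hα]

/-- By the cocycle condition `ζ_{αβ}` is a factor of `ζ_{αα}`, whose square is the derivative of the
identity. -/
theorem zeta_ne_zero {α β : ι} {x : ℂ} (hx : x ∈ S.overlap α β) : S.zeta α β x ≠ 0 := by
  have hd := S.overlap_subset α β hx
  have hαα : S.dom α ⊆ S.overlap α α := fun y hy =>
    S.mem_overlap.2 ⟨hy, (S.chart α).map_target hy⟩
  have h1 : deriv (S.trans α α) x = 1 := by
    have : S.trans α α =ᶠ[nhds x] id := Filter.eventuallyEq_of_mem ((S.isOpen_dom α).mem_nhds hd)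
      fun y hy => (S.chart α).right_inv hy
    rw [this.deriv_eq, deriv_id]
  have h2 : S.zeta α α x ^ 2 = 1 := (S.zeta_sq α α x (hαα hd)).trans h1
  have h3 := S.zeta_cocycle α β α x ⟨hx, hαα hd⟩
  intro h
  rw [h3, h, mul_zero] at h2
  norm_num at h2

/-- Both sides are `θ f'`, because `ζ² = f'`: this is where the spin structure makes `ρ`
superconformal. -/
theorem D_rho [IsManifold 𝓘(ℂ) ω C] {n : ℕ} {α β : ι} {x : ℂ} (hx : x ∈ S.overlap α β) :
    D (S.rho n α β).even x = D (S.rho n α β).odd x * (S.rho n α β).odd x := by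
  have hr := S.rho_isHolomorphic (n := n) α β
  have hO := S.isOpen_overlap α β
  have h1 : dx (S.rho n α β).odd x * theta n = 0 := by
    have hz : HasDerivAt (S.zeta α β) (deriv (S.zeta α β) x) x :=
      ((S.zeta_holomorphic α β x hx).differentiableAt (hO.mem_nhds hx)).hasDerivAt
    have h2 : HasDerivAt (S.rho n α β).odd (deriv (S.zeta α β) x • theta n) x :=
      hz.smul_const (theta n)
    rw [dx_eq_deriv h2.differentiableAt, h2.deriv, smul_mul_assoc, isOdd_theta.mul_self, smul_zero]
  have h3 : (S.rho n α β).odd x = S.zeta α β x • theta n := rfl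
  have h4 : dtheta (S.rho n α β).even x = 0 := dth_algebraMap _
  have h5 : deriv (S.trans α β) x = S.zeta α β x * S.zeta α β x := by
    rw [← sq]; exact (S.zeta_sq α β x hx).symm
  rw [D, S.dx_rho_even hx, h4, zero_add, D, dtheta_apply, h3, map_smul, dth_theta, add_mul,
    mul_smul_comm (S.zeta α β x) (theta n * _), mul_assoc, h1, mul_zero, smul_zero, add_zero,
    smul_mul_smul_comm, one_mul, h5, Algebra.algebraMap_eq_smul_one, mul_smul_comm, mul_one]

end SuperRiemannSurface

namespace Deformation

open Grassmann

variable {ι C : Type*} [TopologicalSpace C] [ChartedSpace ℂ C]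
  {S : SuperRiemannSurface ι C} {n : ℕ} (X : Deformation S n)

/-- A point with coordinates in the algebra of the parameters, over the point `c`. -/
structure IsPoint (c : ℂ) (p : Grassmann (n + 1) × Grassmann (n + 1)) : Prop where
  isEven : p.1.IsEven
  isOdd : p.2.IsOdd
  tf_fst : tf p.1 = p.1
  tf_snd : tf p.2 = p.2
  body_eq : p.1.body = c

/-- The change of coordinates of the deformation on points with Grassmann coordinates. -/
def change (α β : ι) (p : Grassmann (n + 1) × Grassmann (n + 1)) :
    Grassmann (n + 1) × Grassmann (n + 1) :=
  (ev (X.transition α β).even p.1 p.2, ev (X.transition α β).odd p.1 p.2)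

theorem base_transition {α β : ι} {x : ℂ} (hx : x ∈ S.overlap α β) :
    (X.transition α β).base x = S.trans α β x :=
  (modXi_iff.1 (X.central α β x hx).1).1.trans (body_algebraMap _)

theorem isPoint_change {α β : ι} {c : ℂ} (hc : c ∈ S.overlap α β)
    {p : Grassmann (n + 1) × Grassmann (n + 1)} (hp : IsPoint c p) :
    IsPoint (S.trans α β c) (X.change α β p) := by
  have hO := S.isOpen_overlap α β
  have hs := (X.holomorphic α β).toIsSmooth
  have hb : p.1.body ∈ S.overlap α β := by rwa [hp.body_eq]
  refine ⟨isEven_ev hO hs.smooth_even hs.isEven hb hp.isEven hp.isOdd,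
    isOdd_ev hO hs.smooth_odd hs.isOdd hb hp.isEven hp.isOdd, ?_, ?_, ?_⟩
  · simp only [change, tf_ev hO hs.smooth_even hb, hp.tf_fst, hp.tf_snd]
  · simp only [change, tf_ev hO hs.smooth_odd hb, hp.tf_fst, hp.tf_snd]
  · simp only [change]
    rw [body_ev _ _ hp.isOdd.body_eq_zero, hp.body_eq]
    exact X.base_transition hc

/-- The cocycle condition, an identity of superfunctions, passes to points with Grassmann
coordinates by `IsHolomorphic.ev_pull`. -/
theorem change_change {α β γ : ι} {c : ℂ} (hα : c ∈ S.overlap γ α) (hβ : c ∈ S.overlap γ β)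
    {p : Grassmann (n + 1) × Grassmann (n + 1)} (hp : IsPoint c p) :
    X.change α β (X.change γ α p) = X.change γ β p := by
  set O := S.overlap γ α ∩ S.overlap γ β with hOdef
  have hO : IsOpen O := (S.isOpen_overlap γ α).inter (S.isOpen_overlap γ β)
  have hh := X.holomorphic γ α
  have hm : Set.MapsTo (X.transition γ α).base O (S.overlap α β) := fun y hy => by
    rw [X.base_transition hy.1, SuperRiemannSurface.mem_overlap, S.trans_apply]
    have h1 := (S.mem_overlap.1 hy.1).2
    have h2 := (S.mem_overlap.1 hy.2).2
    exact ⟨(S.chart α).map_source h1, by rwa [(S.chart α).left_inv h1]⟩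
  have hu : (X.transition γ α).IsHolomorphic O (S.overlap α β) :=
    ⟨hh.toIsSmooth.mono Set.inter_subset_left hm, hh.holomorphic_even.mono Set.inter_subset_left,
      hh.holomorphic_odd.mono Set.inter_subset_left⟩
  have hb : p.1.body ∈ O := by rw [hp.body_eq]; exact ⟨hα, hβ⟩
  have hs := (X.holomorphic α β).toIsSmooth
  have hc := X.cocycle γ α β
  simp only [change]
  rw [← hu.ev_pull hO (S.isOpen_overlap α β) hs.smooth_even hp.isEven hp.isOdd hb,
    ← hu.ev_pull hO (S.isOpen_overlap α β) hs.smooth_odd hp.isEven hp.isOdd hb,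
    ev_congr hO hc.1 hb, ev_congr hO hc.2 hb]

theorem contDiffOn_change (α β : ι) :
    ContDiffOn ℝ ∞ (X.change α β) {p | p.1.body ∈ S.overlap α β} :=
  (contDiffOn_ev (S.isOpen_overlap α β) (X.holomorphic α β).smooth_even).prodMk
    (contDiffOn_ev (S.isOpen_overlap α β) (X.holomorphic α β).smooth_odd)

/-- A family of smooth local sections of the points of the deformation with Grassmann coordinates,
compatible up to terms of degree `k`. -/
structure IsCompatible (k : ℕ) (s : ι → C → Grassmann (n + 1) × Grassmann (n + 1)) : Prop where
  smooth : ∀ α, ContMDiffOn 𝓘(ℝ, ℂ) 𝓘(ℝ, Grassmann (n + 1) × Grassmann (n + 1)) ∞ (s α)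
    (S.chart α).source
  isPoint : ∀ α, ∀ p ∈ (S.chart α).source, IsPoint (S.chart α p) (s α p)
  compat : ∀ α β, ∀ p ∈ (S.chart α).source, p ∈ (S.chart β).source →
    (s β p).1 - (X.change α β (s α p)).1 ∈ fil (n + 1) k ∧
    (s β p).2 - (X.change α β (s α p)).2 ∈ fil (n + 1) k

theorem exists_isCompatible_one :
    ∃ s, X.IsCompatible 1 s := by
  have hp : ∀ c : ℂ, IsPoint (n := n) c (algebraMap ℂ _ c, 0) := fun c =>
    ⟨isEven_algebraMap _, isOdd_zero, tf_algebraMap _, map_zero _, body_algebraMap _⟩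
  refine ⟨fun α p => (algebraMap ℂ _ (S.chart α p), 0), fun α => ?_, fun α p _ => hp _,
    fun α β p hα hβ => ?_⟩
  · have h1 : ContDiffOn ℝ ∞ (fun c : ℂ => (algebraMap ℂ (Grassmann (n + 1)) c,
        (0 : Grassmann (n + 1)))) Set.univ :=
      ContDiffOn.prodMk (smoothOn_algebraMap (V := Set.univ)) contDiffOn_const
    exact (contMDiffOn_iff_contDiffOn.2 h1).comp
      (contMDiffOn_of_mem_maximalAtlas (mem_maximalAtlas_real (S.chart_mem α)))
      fun _ _ => trivial
  · have h := X.isPoint_change (S.chart_mem_overlap hα hβ) (hp (S.chart α p))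
    rw [S.trans_chart hα] at h
    refine ⟨mem_fil_one.2 ?_, mem_fil_one.2 ?_⟩
    · rw [body_sub, h.body_eq, body_algebraMap, sub_self]
    · rw [body_sub, h.isOdd.body_eq_zero, body_zero, sub_zero]

theorem isPoint_sum {κ : Type*} (t : Finset κ) (w : κ → ℂ) (hw : ∑ i ∈ t, w i = 1) {c : ℂ}
    {q : κ → Grassmann (n + 1) × Grassmann (n + 1)} (hq : ∀ i ∈ t, IsPoint c (q i)) :
    IsPoint c (∑ i ∈ t, w i • (q i).1, ∑ i ∈ t, w i • (q i).2) where
  isEven := IsEven.sum fun i hi => (hq i hi).isEven.smul _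
  isOdd := IsOdd.sum fun i hi => (hq i hi).isOdd.smul _
  tf_fst := by
    simp only [map_sum, map_smul]
    exact Finset.sum_congr rfl fun i hi => by rw [(hq i hi).tf_fst]
  tf_snd := by
    simp only [map_sum, map_smul]
    exact Finset.sum_congr rfl fun i hi => by rw [(hq i hi).tf_snd]
  body_eq := by
    have : (∑ i ∈ t, w i • (q i).1).body = ∑ i ∈ t, w i * (q i).1.body := by
      rw [body, Grassmann.sum_apply]; rfl
    rw [this, Finset.sum_congr rfl fun i hi => by rw [(hq i hi).body_eq], ← Finset.sum_mul, hw,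
      one_mul]

variable [IsManifold 𝓘(ℂ) ω C] [T2Space C] [SecondCountableTopology C]

theorem IsCompatible.exists_succ {k : ℕ} {s : ι → C → Grassmann (n + 1) × Grassmann (n + 1)}
    (hs : X.IsCompatible k s) : ∃ s', X.IsCompatible (k + 1) s' := by
  have := isManifold_real_of_complex C
  have : LocallyCompactSpace C := ChartedSpace.locallyCompactSpace ℂ C
  obtain ⟨f, hf⟩ := SmoothPartitionOfUnity.exists_isSubordinate 𝓘(ℝ, ℂ) (isClosed_univ (X := C))
    (fun α => (S.chart α).source) (fun α => (S.chart α).open_source)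
    (fun p _ => Set.mem_iUnion.2 (S.cover p))
  have hmem : ∀ {p γ}, γ ∈ f.finsupport p → p ∈ (S.chart γ).source := fun {p γ} h =>
    hf γ (subset_tsupport _ ((f.mem_finsupport p).1 h))
  -- The weighted mean, in the coordinates of the chart `α`, of all local sections.
  let s' : ι → C → Grassmann (n + 1) × Grassmann (n + 1) := fun α p =>
    ∑ᶠ γ, f γ p • X.change γ α (s γ p)
  have hw : ∀ p, ∑ γ ∈ f.finsupport p, ((f γ p : ℝ) : ℂ) = 1 := fun p => by
    rw [← Complex.ofReal_sum, f.sum_finsupport p (Set.mem_univ p), Complex.ofReal_one]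
  have hs' : ∀ α p, s' α p = (∑ γ ∈ f.finsupport p, ((f γ p : ℝ) : ℂ) • (X.change γ α (s γ p)).1,
      ∑ γ ∈ f.finsupport p, ((f γ p : ℝ) : ℂ) • (X.change γ α (s γ p)).2) := fun α p => by
    have : s' α p = ∑ γ ∈ f.finsupport p, f γ p • X.change γ α (s γ p) :=
      (f.sum_finsupport_smul_eq_finsum (x₀ := p) fun γ p => X.change γ α (s γ p)).symm
    rw [this]
    refine Prod.ext ?_ ?_
    · simp only [Prod.fst_sum, Prod.smul_fst, real_smul_eq]
    · simp only [Prod.snd_sum, Prod.smul_snd, real_smul_eq]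
  have hpt : ∀ {α γ p}, p ∈ (S.chart α).source → p ∈ (S.chart γ).source →
      IsPoint (S.chart α p) (X.change γ α (s γ p)) := fun {α γ p} hα hγ => by
    have := X.isPoint_change (S.chart_mem_overlap hγ hα) (hs.isPoint γ p hγ)
    rwa [S.trans_chart hγ] at this
  refine ⟨s', fun α p hα => ?_, fun α p hα => ?_, fun α β p hα hβ => ?_⟩
  · refine ContMDiffAt.contMDiffWithinAt ?_
    refine f.contMDiffAt_finsum fun γ hγ => ?_
    have hpγ : p ∈ (S.chart γ).source := hf γ hγ
    have h1 : ContMDiffAt 𝓘(ℝ, ℂ) _ ∞ (s γ) p :=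
      (hs.smooth γ p hpγ).contMDiffAt ((S.chart γ).open_source.mem_nhds hpγ)
    have hopen : IsOpen {q : Grassmann (n + 1) × Grassmann (n + 1) |
        q.1.body ∈ S.overlap γ α} :=
      (S.isOpen_overlap γ α).preimage ((bodyL (n + 1)).continuous.comp continuous_fst)
    have h2 : ContDiffAt ℝ ∞ (X.change γ α) (s γ p) :=
      (X.contDiffOn_change γ α).contDiffAt (hopen.mem_nhds (by
        change (s γ p).1.body ∈ S.overlap γ α
        rw [(hs.isPoint γ p hpγ).body_eq]; exact S.chart_mem_overlap hpγ hα))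
    exact h2.contMDiffAt.comp p h1
  · rw [hs']
    exact isPoint_sum _ _ (hw p) fun γ hγ => hpt hα (hmem hγ)
  · have hcc : ∀ γ ∈ f.finsupport p, X.change γ β (s γ p) =
        X.change α β (X.change γ α (s γ p)) := fun γ hγ =>
      (X.change_change (S.chart_mem_overlap (hmem hγ) hα) (S.chart_mem_overlap (hmem hγ) hβ)
        (hs.isPoint γ p (hmem hγ))).symm
    have hdiff : ∀ γ ∈ f.finsupport p, (X.change γ α (s γ p)).1 - (s α p).1 ∈ fil (n + 1) k ∧
        (X.change γ α (s γ p)).2 - (s α p).2 ∈ fil (n + 1) k := fun γ hγ => by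
      have := hs.compat γ α p (hmem hγ) hα
      rw [← neg_sub (s α p).1, ← neg_sub (s α p).2]
      exact ⟨neg_mem this.1, neg_mem this.2⟩
    -- By `hcc` the new section in the chart `β` is the mean of the images under `ϑ_{αβ}` of the
    -- points averaged in the chart `α`, so its distance from the image of their mean has degree `k
    -- + 1`.
    have haff := fun F : SuperFun n => ev_affine F (f.finsupport p) (fun γ => ((f γ p : ℝ) : ℂ))
      (hw p) (g := fun γ => (X.change γ α (s γ p)).1) (ψ := fun γ => (X.change γ α (s γ p)).2)
      (g₀ := (s α p).1) (ψ₀ := (s α p).2) (k := k)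
      (fun γ hγ => by rw [(hpt hα (hmem hγ)).body_eq, (hs.isPoint α p hα).body_eq])
      (fun γ hγ => (hpt hα (hmem hγ)).isOdd.body_eq_zero)
      (fun γ hγ => (hdiff γ hγ).1) (fun γ hγ => (hdiff γ hγ).2)
    rw [hs', hs']
    refine ⟨?_, ?_⟩
    · have := haff (X.transition α β).even
      simp only
      rw [Finset.sum_congr rfl fun γ hγ => by rw [hcc γ hγ]]
      exact this
    · have := haff (X.transition α β).odd
      simp only
      rw [Finset.sum_congr rfl fun γ hγ => by rw [hcc γ hγ]]
      exact this

theorem exists_isCompatible (k : ℕ) : ∃ s, X.IsCompatible (k + 1) s := by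
  induction k with
  | zero => exact X.exists_isCompatible_one
  | succ k ih => obtain ⟨s, hs⟩ := ih; exact hs.exists_succ

theorem exists_superconformal_identification :
    ∃ Φ : SmoothIdentification X, Φ.IsSuperconformal := by
  -- This gives agreement up to degree `n + 2`, beyond the `n + 1` generators, hence equality.
  obtain ⟨s, hs⟩ := X.exists_isCompatible (n + 1)
  let g : ι → SuperFun n := fun α x => (s α ((S.chart α).symm x)).1
  let ψ : ι → SuperFun n := fun α x => (s α ((S.chart α).symm x)).2
  have hsm : ∀ α, ContDiffOn ℝ ∞ (fun x => s α ((S.chart α).symm x)) (S.dom α) := fun α =>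
    contMDiffOn_iff_contDiffOn.1 ((hs.smooth α).comp
      (contMDiffOn_symm_of_mem_maximalAtlas (mem_maximalAtlas_real (S.chart_mem α)))
      fun x hx => (S.chart α).map_target hx)
  have hpt : ∀ α, ∀ x ∈ S.dom α, IsPoint x (s α ((S.chart α).symm x)) := fun α x hx => by
    have := hs.isPoint α _ ((S.chart α).map_target hx)
    rwa [(S.chart α).right_inv hx] at this
  have hsec : ∀ α, SuperMap.IsSection (g α) (ψ α) (S.dom α) := fun α =>
    ⟨contDiff_fst.comp_contDiffOn (hsm α), contDiff_snd.comp_contDiffOn (hsm α),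
      fun x hx => (hpt α x hx).isEven, fun x hx => (hpt α x hx).isOdd,
      fun x hx => (hpt α x hx).tf_fst, fun x hx => (hpt α x hx).tf_snd,
      fun x hx => (hpt α x hx).body_eq⟩
  have hdom := S.isOpen_dom
  let u : ι → SuperMap n := fun α => SuperMap.ofSection (g α) (ψ α)
  have hus : ∀ α, (u α).IsSmooth (S.dom α) (S.dom α) := fun α =>
    (hsec α).isSmooth_ofSection (hdom α)
  have huc : ∀ α, (u α).EqModXi (SuperMap.ident n) (S.dom α) := fun α =>
    (hsec α).eqModXi_ofSection (hdom α)
  have huD : ∀ α, ∀ x ∈ S.dom α, D (u α).even x = D (u α).odd x * (u α).odd x := fun α x hx =>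
    (hsec α).D_ofSection (hdom α) hx
  have hcomp : ∀ α β, ∀ x ∈ S.overlap α β,
      (g β (S.trans α β x), ψ β (S.trans α β x)) = X.change α β (g α x, ψ α x) := by
    intro α β x hx
    have h := S.mem_overlap.1 hx
    have hp := (S.chart α).map_target h.1
    obtain ⟨h1, h2⟩ := hs.compat α β _ hp h.2
    have e : (S.chart β).symm (S.trans α β x) = (S.chart α).symm x := by
      rw [S.trans_apply, (S.chart β).left_inv h.2]
    simp only [g, ψ, e]
    exact Prod.ext (sub_eq_zero.1 (eq_zero_of_mem_fil (by omega) h1))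
      (sub_eq_zero.1 (eq_zero_of_mem_fil (by omega) h2))
  have hglue : ∀ α β, Set.EqOn ((S.rho n α β).pull (u β).even)
      ((u α).pull (X.transition α β).even) (S.overlap α β) ∧
      Set.EqOn ((S.rho n α β).pull (u β).odd)
      ((u α).pull (X.transition α β).odd) (S.overlap α β) := by
    intro α β
    have hO := S.isOpen_overlap α β
    have hO' := S.isOpen_overlap β α
    have hsub := S.overlap_subset α β
    have hsub' := S.overlap_subset β α
    have hr := S.rho_isHolomorphic (n := n) α β
    have hrs := hr.toIsSmooth
    have hv := (X.holomorphic α β).toIsSmooth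
    have hua : (u α).IsSmooth (S.overlap α β) (S.overlap α β) :=
      (hus α).mono hsub fun y hy => by rwa [(huc α).base_eq (hsub hy)]
    have hbe := (hus β).smooth_even.mono hsub'
    have hbo := (hus β).smooth_odd.mono hsub'
    have hbodd : ∀ y ∈ S.overlap β α, ((u β).odd y).IsOdd := fun y hy => (hus β).isOdd y (hsub' hy)
    -- Agreement at `θ = 0` fixes the `θ`-coefficients only up to the choice of a square root; that
    -- both have body `ζ_{αβ}` selects the same one.
    have hzW : ∀ y ∈ S.overlap α β, (dth ((S.rho n α β).pull (u β).odd y)).body =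
        S.zeta α β y := fun y hy => by
      have h1 := SuperMap.dtheta_pull hO' hbo (hrs.isEven y hy) (hrs.isOdd y hy) (hrs.mapsTo hy)
      rw [dtheta_apply] at h1
      have h2 : dth ((S.rho n α β).even y) = 0 := dth_algebraMap _
      have h3 : dth ((S.rho n α β).odd y) = S.zeta α β y • 1 := by
        change dth (S.zeta α β y • theta n) = _
        rw [map_smul, dth_theta]
      rw [h1, h2, h3, zero_mul, zero_add, body_mul, body_smul, body_one, pull_apply,
        body_ev _ _ (hrs.isOdd y hy).body_eq_zero]
      have h4 := (huc β).body_dtheta_odd (hsub' (hrs.mapsTo hy))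
      rw [SuperMap.base] at h4
      rw [h4, mul_one, mul_one]
    have hzZ : ∀ y ∈ S.overlap α β, (dth ((u α).pull (X.transition α β).odd y)).body =
        S.zeta α β y := fun y hy => by
      have h1 := SuperMap.dtheta_pull hO hv.smooth_odd (hua.isEven y hy) (hua.isOdd y hy)
        (hua.mapsTo hy)
      rw [dtheta_apply] at h1
      have h2 := (huc α).body_dtheta_odd (hsub hy)
      rw [dtheta_apply] at h2
      have h3 := (modXi_iff_body.1 (X.central α β y hy).2).2
      have h5 : dth ((S.rho n α β).odd y) = S.zeta α β y • 1 := by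
        change dth (S.zeta α β y • theta n) = _
        rw [map_smul, dth_theta]
      have h4 : ((u α).even y).body = y := (huc α).base_eq (hsub hy)
      rw [h1, body_add, body_mul, body_mul, (hua.isEven y hy).dth.body_eq_zero, zero_mul, zero_add,
        h2, one_mul, pull_apply, body_ev _ _ (hua.isOdd y hy).body_eq_zero, h4, dtheta_apply, h3,
        h5, body_smul, body_one, mul_one]
    have htf : ∀ F : SuperFun n, SmoothOn F (S.overlap β α) → ∀ y ∈ S.overlap α β,
        tf ((S.rho n α β).pull F y) = tf (F (S.trans α β y)) := fun F hF y hy => by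
      rw [pull_apply, tf_ev hO' hF (hrs.mapsTo hy)]
      have e1 : tf ((S.rho n α β).even y) = algebraMap ℂ _ (S.trans α β y) := tf_algebraMap _
      have e2 : tf ((S.rho n α β).odd y) = 0 := by
        change tf (S.zeta α β y • theta n) = 0
        rw [map_smul, tf_theta, smul_zero]
      rw [e1, e2, ev_algebraMap, zero_mul, add_zero]
    have htf' : ∀ F : SuperFun n, SmoothOn F (S.overlap α β) → ∀ y ∈ S.overlap α β,
        tf ((u α).pull F y) = ev F (g α y) (ψ α y) := fun F hF y hy => by
      rw [pull_apply, tf_ev hO hF (hua.mapsTo hy), (hsec α).tf_ofSection_even (hsub hy),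
        (hsec α).tf_ofSection_odd (hsub hy)]
    have htr : ∀ y ∈ S.overlap α β, S.trans α β y ∈ S.dom β := fun y hy =>
      hsub' (S.trans_mem hy)
    refine eqOn_of_thetaFree_eq hO (hrs.smoothOn_pull hO' hbe) (hrs.smoothOn_pull hO' hbo)
      (hua.smoothOn_pull hO hv.smooth_even) (hua.smoothOn_pull hO hv.smooth_odd)
      (fun y hy => isOdd_ev hO' hbo hbodd (hrs.mapsTo hy) (hrs.isEven y hy) (hrs.isOdd y hy))
      (fun y hy => isOdd_ev hO hv.smooth_odd hv.isOdd (hua.mapsTo hy) (hua.isEven y hy)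
        (hua.isOdd y hy))
      (fun y hy => hrs.D_pull_even_eq hO hO' hy (by rw [hr.dxt_even hO hy]; rfl) (S.D_rho hy) hbe
        hbo hbodd fun z hz => huD β z (hsub' hz))
      (fun y hy => hua.D_pull_even_eq hO hO hy ((huc α).body_dxt_even (hdom α)
        (hus α).smooth_even (hsub hy)) (huD α y (hsub hy)) hv.smooth_even hv.smooth_odd hv.isOdd
        (X.superconformal α β).D_even) (fun y hy => ?_) (fun y hy => ?_)
      (fun y hy => (hzW y hy).trans (hzZ y hy).symm)
      (fun y hy => by rw [hzW y hy]; exact S.zeta_ne_zero hy)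
    · rw [htf _ hbe y hy, htf' _ hv.smooth_even y hy, (hsec β).tf_ofSection_even (htr y hy)]
      exact congrArg Prod.fst (hcomp α β y hy)
    · rw [htf _ hbo y hy, htf' _ hv.smooth_odd y hy, (hsec β).tf_ofSection_odd (htr y hy)]
      exact congrArg Prod.snd (hcomp α β y hy)
  refine ⟨⟨u, hus, huc, fun α β => (hglue α β).1, fun α β => (hglue α β).2⟩, fun α => ?_⟩
  refine (hus α).isSuperconformal (hdom α) (hdom α)
    (fun x hx => (huc α).body_dxt_even (hdom α) (hus α).smooth_even hx) (huD α) fun x hx => ?_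
  have h := (huc α).body_dtheta_odd hx
  rw [dtheta_apply] at h
  change (dth ((u α).odd x)).body ≠ 0
  rw [h]
  exact one_ne_zero

end Deformation

end

theorem mainTheorem6 {ι C : Type*} [TopologicalSpace C] [ChartedSpace ℂ C]
    [IsManifold 𝓘(ℂ) ω C] [T2Space C] [SecondCountableTopology C]
    (S : SuperRiemannSurface ι C) (n : ℕ) (X : Deformation S n) :
    (∃ Φ : SmoothIdentification X, Φ.IsSuperconformal) ∧
    ∀ Φ : SmoothIdentification X, ∃ φ : VectorForm S n,
      φ.IsEven ∧ φ.VanishesModXi ∧ (Φ.IsSuperconformal → φ.IsSuperconformal) ∧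
      Φ.IsComplexStructure (perturbedDolbeault φ) :=
  ⟨X.exists_superconformal_identification, fun Φ => ⟨Φ.form, Φ.form_spec⟩⟩
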